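/- Let $n\ge 1$, $B>0$ and $0<a<b$. Write points of $\mathbb R^n$ as $x=(x_1,\dots,x_{n-1},z)$ and let $$\Omega=\{x:\ -B<x_1,\dots,x_{n-1}<B,\ a<z<b\},\qquad \partial_2\Omega=\{x:\ -B<x_1,\dots,x_{n-1}<B,\ z=b\}.$$ Let $H_0^2(\Omega)$ be the set of the real-valued $u\in H^2(\Omega)$ whose trace vanishes on $\partial\Omega\setminus\partial_2\Omega$. **Theorem 4.2.** There exist a constant $C=C(\Omega)>0$ and a number $\lambda_0=\lambda_0(\Omega)>1$, both depending only on $\Omega$, such that for every $u\in H_0^2(\Omega)$ and every $\lambda\ge\lambda_0$ $$\int_\Omega(\Delta u)^2e^{2\lambda z^2}\,dx\ \ge\ C\int_\Omega\left(\lambda|\nabla u|^2+\lambda^3u^2\right)e^{2\lambda z^2}\,dx\ -\ C\lambda^3\left(\|u\|_{H^1(\partial_2\Omega)}^2+\|\partial_zu\|_{L_2(\partial_2\Omega)}^2\right)e^{2\lambda b^2}.$$ Here derivatives of $u$ are weak derivatives, and $u$ and $\partial_zu$ on $\partial_2\Omega$ are the traces of $u,\partial_zu\in H^1(\Omega)$,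 which exist with $u|_{\partial_2\Omega}\in H^1(\partial_2\Omega)$ and $\partial_zu|_{\partial_2\Omega}\in L_2(\partial_2\Omega)$. For $n=1$ the set $\partial_2\Omega$ is the single point $z=b$, carrying unit mass. -/

import Mathlib

open MeasureTheory Set Filter Topology
open scoped ContDiff

noncomputable section

namespace Carleman

/-- The partial derivative `∂φ/∂x_i` of a function on `ℝ^ι`. -/
def pderiv {ι : Type} [Fintype ι] [DecidableEq ι] (i : ι) (φ : (ι → ℝ) → ℝ) (x : ι → ℝ) : ℝ :=
  fderiv ℝ φ x (Pi.single i 1)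

/-- `g` is the weak (distributional) derivative `∂u/∂x_i` in `U`, tested against `C_c^∞(U)`. -/
def IsWeakDeriv {ι : Type} [Fintype ι] [DecidableEq ι] (U : Set (ι → ℝ)) (i : ι)
    (u g : (ι → ℝ) → ℝ) : Prop :=
  ∀ φ : (ι → ℝ) → ℝ, ContDiff ℝ ∞ φ → HasCompactSupport φ → tsupport φ ⊆ U →
    ∫ x in U, u x * pderiv i φ x = -∫ x in U, g x * φ x

/-- `u ∈ H¹(U)` with weak gradient `g`. -/
structure IsH1 {ι : Type} [Fintype ι] [DecidableEq ι] (U : Set (ι → ℝ))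
    (u : (ι → ℝ) → ℝ) (g : ι → (ι → ℝ) → ℝ) : Prop where
  memLp : MemLp u 2 (volume.restrict U)
  memLp_grad : ∀ i, MemLp (g i) 2 (volume.restrict U)
  isWeakDeriv : ∀ i, IsWeakDeriv U i u (g i)

/-- `u ∈ H²(U)` with weak gradient `g` and weak Hessian `h` (`h i j = ∂_j ∂_i u`). -/
structure IsH2 {ι : Type} [Fintype ι] [DecidableEq ι] (U : Set (ι → ℝ))
    (u : (ι → ℝ) → ℝ) (g : ι → (ι → ℝ) → ℝ) (h : ι → ι → (ι → ℝ) → ℝ) : Prop where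
  isH1 : IsH1 U u g
  isH1_grad : ∀ i, IsH1 U (g i) (h i)

/-- The open box `∏ᵢ (lo i, hi i)`. -/
def box {k : ℕ} (lo hi : Fin k → ℝ) : Set (Fin k → ℝ) :=
  Set.pi Set.univ fun i => Set.Ioo (lo i) (hi i)

/-- The domain of the variables `x_j`, `j ≠ i`: the `m`-dimensional open box which parametrizes the
two faces of `box lo hi` orthogonal to the `i`-th axis through `y ↦ i.insertNth c y`,
`c = lo i` or `c = hi i`. -/
def faceBox {m : ℕ} (lo hi : Fin (m + 1) → ℝ) (i : Fin (m + 1)) : Set (Fin m → ℝ) :=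
  box (fun j => lo (i.succAbove j)) (fun j => hi (i.succAbove j))

/-- `T ∈ L²` is the trace of `u ∈ H¹(box lo hi)` (with weak gradient `g`) on the face `x_i = c`, in
the parametrization `y ↦ i.insertNth c y` of the face: some sequence of functions that are smooth up
to the boundary tends to `u` in `H¹` of the box, and their restrictions to the face tend to `T`
in `L²` of the face. -/
def IsTrace {m : ℕ} (lo hi : Fin (m + 1) → ℝ) (u : (Fin (m + 1) → ℝ) → ℝ)
    (g : Fin (m + 1) → (Fin (m + 1) → ℝ) → ℝ) (i : Fin (m + 1)) (c : ℝ)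
    (T : (Fin m → ℝ) → ℝ) : Prop :=
  MemLp T 2 (volume.restrict (faceBox lo hi i)) ∧
  ∃ φ : ℕ → (Fin (m + 1) → ℝ) → ℝ,
    (∀ k, ContDiff ℝ ∞ (φ k)) ∧
    Tendsto (fun k => eLpNorm (fun x => φ k x - u x) 2 (volume.restrict (box lo hi)))
      atTop (𝓝 0) ∧
    (∀ j, Tendsto (fun k => eLpNorm (fun x => pderiv j (φ k) x - g j x) 2
      (volume.restrict (box lo hi))) atTop (𝓝 0)) ∧
    Tendsto (fun k => eLpNorm (fun y => φ k (i.insertNth c y) - T y) 2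
      (volume.restrict (faceBox lo hi i))) atTop (𝓝 0)

/-- Lower corner `(-B, …, -B, a)`. Points of `ℝⁿ`, `n = m + 1`, are `x = (x_1, …, x_{n-1}, z)`;
the coordinate `z` is `x (Fin.last m)`. -/
def prismLo (m : ℕ) (B a : ℝ) : Fin (m + 1) → ℝ :=
  Fin.snoc (α := fun _ => ℝ) (fun _ => -B) a

/-- Upper corner `(B, …, B, b)`. -/
def prismHi (m : ℕ) (B b : ℝ) : Fin (m + 1) → ℝ :=
  Fin.snoc (α := fun _ => ℝ) (fun _ => B) b

/-- The rectangular prism `Ω = {-B < x_1, …, x_{n-1} < B, a < z < b}`. -/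
def prism (m : ℕ) (B a b : ℝ) : Set (Fin (m + 1) → ℝ) :=
  box (prismLo m B a) (prismHi m B b)

/-- The set of the `(x_1, …, x_{n-1})` with `-B < x_i < B`, parametrizing the top face
`∂₂Ω = {z = b}`. -/
def topFace (m : ℕ) (B : ℝ) : Set (Fin m → ℝ) :=
  box (fun _ => -B) (fun _ => B)

/-- `u ∈ H²(Ω)`, with weak gradient `g` and weak Hessian `h`, and `u = 0` on `∂Ω \ ∂₂Ω` in the sense
of traces: on every lower face (`x_i = -B` and `z = a`) and on every upper face `x_i = B` other than
the top one. -/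
structure IsH20 (m : ℕ) (B a b : ℝ) (u : (Fin (m + 1) → ℝ) → ℝ)
    (g : Fin (m + 1) → (Fin (m + 1) → ℝ) → ℝ)
    (h : Fin (m + 1) → Fin (m + 1) → (Fin (m + 1) → ℝ) → ℝ) : Prop where
  isH2 : IsH2 (prism m B a b) u g h
  trace_lower : ∀ i, IsTrace (prismLo m B a) (prismHi m B b) u g i (prismLo m B a i) 0
  trace_upper : ∀ i, i ≠ Fin.last m →
    IsTrace (prismLo m B a) (prismHi m B b) u g i (prismHi m B b i) 0

/-- `T` is the trace on the top face `z = b` of `v ∈ H¹(Ω)` (with weak gradient `g`). -/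
def IsTopTrace (m : ℕ) (B a b : ℝ) (v : (Fin (m + 1) → ℝ) → ℝ)
    (g : Fin (m + 1) → (Fin (m + 1) → ℝ) → ℝ) (T : (Fin m → ℝ) → ℝ) : Prop :=
  IsTrace (prismLo m B a) (prismHi m B b) v g (Fin.last m) b T

end Carleman

end

/-! Conjugation by the weight, v = e^{λz²}u, turns e^{λz²}Δu into Lv = Δv - 4λz v_z + (4λ²z² - 2λ)v.
Write Lv = P + Q with P = Δv + 4λ²z²v + 2λv and Q = -4λ(z v_z + v). Then (Lv)² ≥ 2PQ, and 2PQ is a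
divergence plus 8λv_z² + 4λ|∇v|² + (16λ³z² - 8λ²)v² (`sq_ge_carlemanFlux`). For λa² ≥ 1 this
quadratic form dominates the weighted energy of u (`pointwise_carleman`).

Integration over the box leaves the fluxes. On the side faces u and its tangential derivative in z
vanish, and every term of the flux contains one of them. On z = a the normal derivative enters with
the good sign and everything else vanishes. On z = b the tangential gradient has the good sign, and
what remains is bounded by λN² + λ³T², where T and N are the traces of u and ∂_z u. This is
`carleman_of_smoothApprox`.

That is not yet the theorem: the same C stands before the energy and before the boundary term, so
shrinking C does not help, while the constant found at the top face is unrelated to the one in the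
bulk. The boundary term is therefore improved to order λ², and then the factor λ absorbs any
constant (`carleman_small_boundary`). For this, T is regularized at scale ε = 1/λ to a smooth f
vanishing outside the face, and the lift of f, linear in z, is subtracted from u. The remaining
trace satisfies λ³‖T - f‖² ≲ λ‖∇T‖². The lift costs a Laplacian of size λ²‖∇T‖², but the weight
concentrates at z = b and integration in z gains 1/λ (`integral_weight_le`).

The regularization needs the extension of T by zero to be in H¹. This follows by integrating a mixed
second derivative over the box in both orders (`integral_trace_mul_pderiv`). Everything passes from
smooth functions to H² by density. The approximants need not vanish on the boundary: their boundary
terms are only shown to tend to zero, through the trace inequality. -/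

namespace Carleman

/-! ### Convergence in L² and of integrals; Minkowski's inequality -/

section LTwo

variable {α : Type*} [MeasurableSpace α] {μ : Measure α}

/-- `f k → f₀` in `L²(μ)`. -/
structure L2Lim (μ : Measure α) (f : ℕ → α → ℝ) (f₀ : α → ℝ) : Prop where
  memLp : ∀ k, MemLp (f k) 2 μ
  memLp_lim : MemLp f₀ 2 μ
  tendsto : Tendsto (fun k => eLpNorm (fun x => f k x - f₀ x) 2 μ) atTop (𝓝 0)

/-- The functions `F k`, `F₀` are integrable and `∫ F k → ∫ F₀`. -/
structure IntLim (μ : Measure α) (F : ℕ → α → ℝ) (F₀ : α → ℝ) : Prop where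
  integrable : ∀ k, Integrable (F k) μ
  integrable_lim : Integrable F₀ μ
  tendsto : Tendsto (fun k => ∫ x, F k x ∂μ) atTop (𝓝 (∫ x, F₀ x ∂μ))

theorem L2Lim.const {f : α → ℝ} (hf : MemLp f 2 μ) : L2Lim μ (fun _ => f) f :=
  ⟨fun _ => hf, hf, by simp⟩

theorem L2Lim.add {f g : ℕ → α → ℝ} {f₀ g₀ : α → ℝ} (hf : L2Lim μ f f₀) (hg : L2Lim μ g g₀) :
    L2Lim μ (fun k x => f k x + g k x) (fun x => f₀ x + g₀ x) := by
  refine ⟨fun k => (hf.memLp k).add (hg.memLp k), hf.memLp_lim.add hg.memLp_lim, ?_⟩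
  have h0 := hf.tendsto.add hg.tendsto
  rw [add_zero] at h0
  refine tendsto_of_tendsto_of_tendsto_of_le_of_le tendsto_const_nhds h0 (fun _ => zero_le)
    fun k => ?_
  have h1 := eLpNorm_add_le ((hf.memLp k).sub hf.memLp_lim).1 ((hg.memLp k).sub hg.memLp_lim).1
    one_le_two
  refine le_trans (le_of_eq ?_) h1
  congr 1
  ext x
  simp only [Pi.add_apply, Pi.sub_apply]
  ring

theorem L2Lim.bdd_mul {f : ℕ → α → ℝ} {f₀ w : α → ℝ} {K : ℝ} (hf : L2Lim μ f f₀)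
    (hw : AEStronglyMeasurable w μ) (hK : ∀ᵐ x ∂μ, ‖w x‖ ≤ K) :
    L2Lim μ (fun k x => w x * f k x) (fun x => w x * f₀ x) := by
  have key : ∀ g : α → ℝ, MemLp g 2 μ → MemLp (fun x => w x * g x) 2 μ := fun g hg =>
    MemLp.of_le_mul hg (hw.mul hg.1) (c := K) <| hK.mono fun x hx => by
      rw [norm_mul]; exact mul_le_mul_of_nonneg_right hx (norm_nonneg _)
  refine ⟨fun k => key _ (hf.memLp k), key _ hf.memLp_lim, ?_⟩
  have h0 : Tendsto (fun k => ENNReal.ofReal K * eLpNorm (fun x => f k x - f₀ x) 2 μ)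
      atTop (𝓝 (ENNReal.ofReal K * 0)) :=
    ENNReal.Tendsto.const_mul hf.tendsto (Or.inr ENNReal.ofReal_ne_top)
  rw [mul_zero] at h0
  refine tendsto_of_tendsto_of_tendsto_of_le_of_le tendsto_const_nhds h0 (fun _ => zero_le)
    fun k => ?_
  refine eLpNorm_le_mul_eLpNorm_of_ae_le_mul (hK.mono fun x hx => ?_) 2
  rw [← mul_sub, norm_mul]
  exact mul_le_mul_of_nonneg_right hx (norm_nonneg _)

theorem L2Lim.const_mul {f : ℕ → α → ℝ} {f₀ : α → ℝ} (hf : L2Lim μ f f₀) (c : ℝ) :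
    L2Lim μ (fun k x => c * f k x) (fun x => c * f₀ x) :=
  hf.bdd_mul (w := fun _ => c) aestronglyMeasurable_const (Eventually.of_forall fun _ => le_rfl)

theorem L2Lim.sub {f g : ℕ → α → ℝ} {f₀ g₀ : α → ℝ} (hf : L2Lim μ f f₀) (hg : L2Lim μ g g₀) :
    L2Lim μ (fun k x => f k x - g k x) (fun x => f₀ x - g₀ x) := by
  simpa [sub_eq_add_neg] using hf.add (hg.const_mul (-1))

theorem L2Lim.sum {ι : Type*} (s : Finset ι) {f : ι → ℕ → α → ℝ} {f₀ : ι → α → ℝ}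
    (hf : ∀ i ∈ s, L2Lim μ (f i) (f₀ i)) :
    L2Lim μ (fun k x => ∑ i ∈ s, f i k x) (fun x => ∑ i ∈ s, f₀ i x) := by
  classical
  induction s using Finset.induction_on with
  | empty => simpa using L2Lim.const (μ := μ) (f := fun _ => (0 : ℝ)) MemLp.zero'
  | insert i s hi ih =>
    simp only [Finset.sum_insert hi]
    exact (hf i (Finset.mem_insert_self _ _)).add
      (ih fun j hj => hf j (Finset.mem_insert_of_mem hj))

theorem L2Lim.congr_lim {f : ℕ → α → ℝ} {f₀ f₁ : α → ℝ} (hf : L2Lim μ f f₀) (h : f₀ =ᵐ[μ] f₁) :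
    L2Lim μ f f₁ := by
  refine ⟨hf.memLp, (memLp_congr_ae h).1 hf.memLp_lim, hf.tendsto.congr fun k => ?_⟩
  exact eLpNorm_congr_ae (h.mono fun x hx => by simp [hx])

theorem L2Lim.congr {f g : ℕ → α → ℝ} {f₀ : α → ℝ} (hf : L2Lim μ f f₀)
    (h : ∀ k, f k =ᵐ[μ] g k) : L2Lim μ g f₀ := by
  refine ⟨fun k => (memLp_congr_ae (h k)).1 (hf.memLp k), hf.memLp_lim,
    hf.tendsto.congr fun k => ?_⟩
  exact eLpNorm_congr_ae ((h k).mono fun x hx => by simp [hx])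

theorem L2Lim.tendsto_toLp {f : ℕ → α → ℝ} {f₀ : α → ℝ} (hf : L2Lim μ f f₀) :
    Tendsto (fun k => (hf.memLp k).toLp (f k)) atTop (𝓝 (hf.memLp_lim.toLp f₀)) :=
  (Lp.tendsto_Lp_iff_tendsto_eLpNorm'' f hf.memLp f₀ hf.memLp_lim).2 hf.tendsto

theorem inner_toLp {f g : α → ℝ} (hf : MemLp f 2 μ) (hg : MemLp g 2 μ) :
    inner ℝ (hf.toLp f) (hg.toLp g) = ∫ x, f x * g x ∂μ := by
  rw [L2.inner_def]
  refine integral_congr_ae ?_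
  filter_upwards [hf.coeFn_toLp, hg.coeFn_toLp] with x h1 h2
  rw [h1, h2]
  simp [mul_comm]

/-- Continuity of the inner product of L². All limits of quadratic expressions, in the bulk and on
the faces, are taken through this. -/
theorem L2Lim.mul {f g : ℕ → α → ℝ} {f₀ g₀ : α → ℝ} (hf : L2Lim μ f f₀) (hg : L2Lim μ g g₀) :
    IntLim μ (fun k x => f k x * g k x) (fun x => f₀ x * g₀ x) := by
  refine ⟨fun k => (hf.memLp k).integrable_mul (hg.memLp k),
    hf.memLp_lim.integrable_mul hg.memLp_lim, ?_⟩
  have h := hf.tendsto_toLp.inner (𝕜 := ℝ) hg.tendsto_toLp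
  simpa only [inner_toLp] using h

theorem L2Lim.sq {f : ℕ → α → ℝ} {f₀ : α → ℝ} (hf : L2Lim μ f f₀) :
    IntLim μ (fun k x => f k x ^ 2) (fun x => f₀ x ^ 2) := by
  simpa only [pow_two] using hf.mul hf

theorem IntLim.add {f g : ℕ → α → ℝ} {f₀ g₀ : α → ℝ} (hf : IntLim μ f f₀) (hg : IntLim μ g g₀) :
    IntLim μ (fun k x => f k x + g k x) (fun x => f₀ x + g₀ x) := by
  refine ⟨fun k => (hf.integrable k).add (hg.integrable k),
    hf.integrable_lim.add hg.integrable_lim, ?_⟩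
  rw [integral_add hf.integrable_lim hg.integrable_lim]
  exact (hf.tendsto.add hg.tendsto).congr fun k =>
    (integral_add (hf.integrable k) (hg.integrable k)).symm

theorem IntLim.const_mul {f : ℕ → α → ℝ} {f₀ : α → ℝ} (hf : IntLim μ f f₀) (c : ℝ) :
    IntLim μ (fun k x => c * f k x) (fun x => c * f₀ x) := by
  refine ⟨fun k => (hf.integrable k).const_mul c, hf.integrable_lim.const_mul c, ?_⟩
  simpa only [integral_const_mul] using hf.tendsto.const_mul c

theorem IntLim.const {f : α → ℝ} (hf : Integrable f μ) : IntLim μ (fun _ => f) f :=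
  ⟨fun _ => hf, hf, tendsto_const_nhds⟩

theorem IntLim.sum {ι : Type*} (s : Finset ι) {f : ι → ℕ → α → ℝ} {f₀ : ι → α → ℝ}
    (hf : ∀ i ∈ s, IntLim μ (f i) (f₀ i)) :
    IntLim μ (fun k x => ∑ i ∈ s, f i k x) (fun x => ∑ i ∈ s, f₀ i x) := by
  classical
  induction s using Finset.induction_on with
  | empty => simpa using IntLim.const (μ := μ) (f := fun _ => (0 : ℝ)) (integrable_zero _ _ _)
  | insert i s hi ih =>
    simp only [Finset.sum_insert hi]
    exact (hf i (Finset.mem_insert_self _ _)).add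
      (ih fun j hj => hf j (Finset.mem_insert_of_mem hj))

theorem eLpNorm_two_eq {f : α → ℝ} (hf : MemLp f 2 μ) :
    eLpNorm f 2 μ = ENNReal.ofReal (√(∫ x, f x ^ 2 ∂μ)) := by
  rw [hf.eLpNorm_eq_integral_rpow_norm two_ne_zero ENNReal.ofNat_ne_top]
  congr 1
  have h : ∀ x, ‖f x‖ ^ (2 : ENNReal).toReal = f x ^ 2 := fun x => by
    rw [ENNReal.toReal_ofNat, Real.rpow_ofNat, Real.norm_eq_abs, sq_abs]
  simp only [h]
  rw [Real.sqrt_eq_rpow, ENNReal.toReal_ofNat, one_div]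

theorem eLpNorm_two_le_iff {f : α → ℝ} (hf : MemLp f 2 μ) {c : ℝ} (hc : 0 ≤ c) :
    eLpNorm f 2 μ ≤ ENNReal.ofReal c ↔ ∫ x, f x ^ 2 ∂μ ≤ c ^ 2 := by
  rw [eLpNorm_two_eq hf, ENNReal.ofReal_le_ofReal_iff hc, Real.sqrt_le_iff]
  simp [hc]

theorem eLpNorm_two_sq (f : α → ℝ) : eLpNorm f 2 μ ^ 2 = ∫⁻ x, ‖f x‖ₑ ^ 2 ∂μ := by
  have := eLpNorm_nnreal_pow_eq_lintegral (μ := μ) (f := f) (p := 2) two_ne_zero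
  simp only [ENNReal.coe_ofNat, NNReal.coe_ofNat, ENNReal.rpow_ofNat] at this
  exact this

/-- Completeness of L². The bound `b k + b l` is the shape that the trace inequality yields for a
difference of two approximants, each compared with the limit in the box. -/
theorem exists_L2Lim_of_le {f : ℕ → α → ℝ} (hf : ∀ k, MemLp (f k) 2 μ) {b : ℕ → ENNReal}
    (hb : Tendsto b atTop (𝓝 0))
    (h : ∀ k l, eLpNorm (fun x => f k x - f l x) 2 μ ≤ b k + b l) : ∃ f₀, L2Lim μ f f₀ := by
  have hc : CauchySeq fun k => (hf k).toLp (f k) := by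
    rw [EMetric.cauchySeq_iff]
    intro ε hε
    have h2 : ε / 2 ≠ 0 := (ENNReal.half_pos hε.ne').ne'
    obtain ⟨N, hN⟩ := eventually_atTop.1 (hb.eventually_lt_const (pos_iff_ne_zero.2 h2))
    refine ⟨N, fun k hk l hl => ?_⟩
    rw [Lp.edist_toLp_toLp]
    calc _ ≤ b k + b l := h k l
      _ < ε / 2 + ε / 2 := ENNReal.add_lt_add (hN k hk) (hN l hl)
      _ = ε := ENNReal.add_halves ε
  obtain ⟨F, hF⟩ := cauchySeq_tendsto_of_complete hc
  refine ⟨F, hf, Lp.memLp F, ?_⟩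
  rw [Lp.tendsto_Lp_iff_tendsto_eLpNorm'] at hF
  refine hF.congr fun k => eLpNorm_congr_ae ?_
  filter_upwards [(hf k).coeFn_toLp] with x hx
  simp [hx]

/-- Minkowski's integral inequality for `p = 2`, with a uniform bound on the inner integrals. -/
theorem lintegral_lintegral_sq_le {β : Type*} [MeasurableSpace β] {ν : Measure β} [SFinite μ]
    [SFinite ν] {F : α → β → ENNReal} (hF : AEMeasurable (Function.uncurry F) (μ.prod ν))
    {M : ENNReal} (hM : ∀ᵐ y ∂ν, ∫⁻ x, F x y ^ 2 ∂μ ≤ M) :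
    ∫⁻ x, (∫⁻ y, F x y ∂ν) ^ 2 ∂μ ≤ ν univ ^ 2 * M := by
  -- Cauchy–Schwarz in y against the constant 1; Tonelli then finishes the proof.
  have h1 : ∀ᵐ x ∂μ, (∫⁻ y, F x y ∂ν) ^ 2 ≤ ν univ * ∫⁻ y, F x y ^ 2 ∂ν := by
    obtain ⟨G, hG, hFG⟩ := hF
    filter_upwards [Measure.ae_ae_of_ae_prod hFG] with x hx'
    have hx : AEMeasurable (F x) ν := ⟨fun y => G (x, y), hG.comp measurable_prodMk_left, hx'⟩
    have h := ENNReal.lintegral_mul_le_Lp_mul_Lq ν (Real.HolderConjugate.two_two)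
      (f := F x) (g := fun _ => 1) hx aemeasurable_const
    simp only [Pi.mul_apply, mul_one, ENNReal.one_rpow, lintegral_one] at h
    calc (∫⁻ y, F x y ∂ν) ^ 2
        ≤ ((∫⁻ y, F x y ^ (2 : ℝ) ∂ν) ^ (1 / 2 : ℝ) * ν univ ^ (1 / 2 : ℝ)) ^ 2 := by gcongr
      _ = _ := by
        rw [mul_pow, ← ENNReal.rpow_natCast, ← ENNReal.rpow_natCast, ← ENNReal.rpow_mul,
          ← ENNReal.rpow_mul]
        norm_num
        rw [mul_comm]
  calc ∫⁻ x, (∫⁻ y, F x y ∂ν) ^ 2 ∂μ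
      ≤ ∫⁻ x, ν univ * ∫⁻ y, F x y ^ 2 ∂ν ∂μ := lintegral_mono_ae h1
    _ = ν univ * ∫⁻ x, ∫⁻ y, F x y ^ 2 ∂ν ∂μ :=
      lintegral_const_mul'' _ (AEMeasurable.lintegral_prod_right' (hF.pow_const 2))
    _ = ν univ * ∫⁻ y, ∫⁻ x, F x y ^ 2 ∂μ ∂ν := by rw [lintegral_lintegral_swap (hF.pow_const 2)]
    _ ≤ ν univ * ∫⁻ _, M ∂ν := by gcongr 1; exact lintegral_mono_ae hM
    _ = ν univ ^ 2 * M := by rw [lintegral_const]; ring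

end LTwo


/-! ### Calculus of partial derivatives -/

section PartialDeriv

variable {ι : Type} [Fintype ι] [DecidableEq ι]

theorem pderiv_eq_deriv {φ : (ι → ℝ) → ℝ} {x : ι → ℝ} (h : DifferentiableAt ℝ φ x) (i : ι) :
    pderiv i φ x = deriv (fun t : ℝ => φ (x + t • Pi.single i 1)) 0 :=
  h.lineDeriv_eq_fderiv.symm

theorem contDiff_pderiv {φ : (ι → ℝ) → ℝ} (h : ContDiff ℝ ∞ φ) (i : ι) :
    ContDiff ℝ ∞ (pderiv i φ) :=
  (h.fderiv_right (m := ∞) (by simp)).clm_apply contDiff_const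

theorem continuous_pderiv {φ : (ι → ℝ) → ℝ} (h : ContDiff ℝ 1 φ) (i : ι) :
    Continuous (pderiv i φ) :=
  (h.continuous_fderiv one_ne_zero).clm_apply continuous_const

theorem hasCompactSupport_pderiv {φ : (ι → ℝ) → ℝ} (h : HasCompactSupport φ) (i : ι) :
    HasCompactSupport (pderiv i φ) :=
  (h.fderiv (𝕜 := ℝ)).comp_left (g := fun L : (ι → ℝ) →L[ℝ] ℝ => L (Pi.single i 1)) rfl

theorem pderiv_add {f g : (ι → ℝ) → ℝ} (hf : Differentiable ℝ f) (hg : Differentiable ℝ g) (i : ι)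
    (x : ι → ℝ) : pderiv i (fun x => f x + g x) x = pderiv i f x + pderiv i g x := by
  simp only [pderiv]
  rw [fderiv_fun_add (hf x) (hg x)]; rfl

theorem pderiv_sub {f g : (ι → ℝ) → ℝ} (hf : Differentiable ℝ f) (hg : Differentiable ℝ g) (i : ι)
    (x : ι → ℝ) : pderiv i (fun x => f x - g x) x = pderiv i f x - pderiv i g x := by
  simp only [pderiv]
  rw [fderiv_fun_sub (hf x) (hg x)]; rfl

theorem pderiv_mul {f g : (ι → ℝ) → ℝ} (hf : Differentiable ℝ f) (hg : Differentiable ℝ g) (i : ι)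
    (x : ι → ℝ) : pderiv i (fun x => f x * g x) x = f x * pderiv i g x + g x * pderiv i f x := by
  simp only [pderiv]
  rw [fderiv_fun_mul (hf x) (hg x)]; rfl

theorem pderiv_const_mul {f : (ι → ℝ) → ℝ} (hf : Differentiable ℝ f) (c : ℝ) (i : ι)
    (x : ι → ℝ) : pderiv i (fun x => c * f x) x = c * pderiv i f x := by
  simp only [pderiv]
  rw [fderiv_const_mul (hf x)]; rfl

theorem pderiv_sum {κ : Type*} (s : Finset κ) {f : κ → (ι → ℝ) → ℝ}
    (hf : ∀ k ∈ s, Differentiable ℝ (f k)) (i : ι) (x : ι → ℝ) :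
    pderiv i (fun x => ∑ k ∈ s, f k x) x = ∑ k ∈ s, pderiv i (f k) x := by
  simp only [pderiv]
  rw [fderiv_fun_sum fun k hk => hf k hk x]
  simp

theorem pderiv_comp_apply {g : ℝ → ℝ} (hg : Differentiable ℝ g) (i j : ι) (x : ι → ℝ) :
    pderiv i (fun x => g (x j)) x = if i = j then deriv g (x j) else 0 := by
  have h : HasFDerivAt (fun x : ι → ℝ => g (x j))
      ((deriv g (x j)) • ContinuousLinearMap.proj (R := ℝ) (φ := fun _ : ι => ℝ) j) x :=
    (hg (x j)).hasDerivAt.comp_hasFDerivAt x (hasFDerivAt_apply j x)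
  rw [pderiv, h.fderiv]
  by_cases hij : i = j
  · subst hij; simp
  · simp [hij, Ne.symm hij]

theorem pderiv_apply (i j : ι) (x : ι → ℝ) :
    pderiv i (fun x => x j) x = if i = j then 1 else 0 := by
  simpa using pderiv_comp_apply (g := fun t => t) differentiable_id i j x

theorem pderiv_comm {φ : (ι → ℝ) → ℝ} (h : ContDiff ℝ ∞ φ) (i j : ι) (x : ι → ℝ) :
    pderiv i (pderiv j φ) x = pderiv j (pderiv i φ) x := by
  have hd : Differentiable ℝ (fderiv ℝ φ) :=
    (h.fderiv_right (m := ∞) (by simp)).differentiable (by simp)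
  have key : ∀ i j : ι, pderiv i (pderiv j φ) x
      = fderiv ℝ (fderiv ℝ φ) x (Pi.single i 1) (Pi.single j 1) := fun i j => by
    change fderiv ℝ (fun y => fderiv ℝ φ y (Pi.single j 1)) x (Pi.single i 1) = _
    rw [fderiv_clm_apply (hd x) (differentiableAt_const _)]
    simp
  rw [key, key]
  exact (h.contDiffAt.isSymmSndFDerivAt (by
    rw [minSmoothness_of_isRCLikeNormedField]; exact WithTop.coe_le_coe.2 (le_top : (2 : ℕ∞) ≤ ⊤))) _ _

end PartialDeriv

/-! ### Integrability on boxes -/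

section Box

variable {m : ℕ} {lo hi : Fin m → ℝ}

theorem isOpen_box (lo hi : Fin m → ℝ) : IsOpen (box lo hi) :=
  isOpen_set_pi finite_univ fun _ _ => isOpen_Ioo

theorem measurableSet_box (lo hi : Fin m → ℝ) : MeasurableSet (box lo hi) :=
  (isOpen_box lo hi).measurableSet

theorem mem_box {x : Fin m → ℝ} : x ∈ box lo hi ↔ ∀ i, lo i < x i ∧ x i < hi i := by
  simp [box, Set.mem_pi]

theorem box_subset_Icc (lo hi : Fin m → ℝ) : box lo hi ⊆ Icc lo hi := fun _ hx =>
  ⟨fun i => (mem_box.1 hx i).1.le, fun i => (mem_box.1 hx i).2.le⟩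

theorem box_ae_eq_Icc (lo hi : Fin m → ℝ) : box lo hi =ᵐ[volume] Icc lo hi :=
  Measure.univ_pi_Ioo_ae_eq_Icc

instance isFiniteMeasure_box (lo hi : Fin m → ℝ) :
    IsFiniteMeasure ((volume : Measure (Fin m → ℝ)).restrict (box lo hi)) :=
  ⟨by
    rw [Measure.restrict_apply_univ]
    exact (measure_mono (box_subset_Icc lo hi)).trans_lt isCompact_Icc.measure_lt_top⟩

theorem exists_bound_box {f : (Fin m → ℝ) → ℝ} (hf : Continuous f) (lo hi : Fin m → ℝ) :
    ∃ K, ∀ᵐ x ∂(volume.restrict (box lo hi)), ‖f x‖ ≤ K := by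
  obtain ⟨K, hK⟩ := (isCompact_Icc (a := lo) (b := hi)).exists_bound_of_continuousOn hf.continuousOn
  exact ⟨K, (ae_restrict_iff' (measurableSet_box lo hi)).2
    (Eventually.of_forall fun x hx => hK x (box_subset_Icc lo hi hx))⟩

theorem memLp_box {f : (Fin m → ℝ) → ℝ} (hf : Continuous f) (lo hi : Fin m → ℝ) :
    MemLp f 2 (volume.restrict (box lo hi)) := by
  obtain ⟨K, hK⟩ := exists_bound_box hf lo hi
  exact MemLp.of_bound hf.aestronglyMeasurable K hK

theorem integrable_box {f : (Fin m → ℝ) → ℝ} (hf : Continuous f) (lo hi : Fin m → ℝ) :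
    Integrable f (volume.restrict (box lo hi)) := by
  obtain ⟨K, hK⟩ := exists_bound_box hf lo hi
  exact (integrable_const K).mono' hf.aestronglyMeasurable hK

theorem L2Lim.continuous_mul {f : ℕ → (Fin m → ℝ) → ℝ} {f₀ w : (Fin m → ℝ) → ℝ}
    (hf : L2Lim (volume.restrict (box lo hi)) f f₀) (hw : Continuous w) :
    L2Lim (volume.restrict (box lo hi)) (fun k x => w x * f k x) (fun x => w x * f₀ x) := by
  obtain ⟨K, hK⟩ := exists_bound_box hw lo hi
  exact hf.bdd_mul hw.aestronglyMeasurable hK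

end Box

/-! ### Faces of a box: divergence theorem and trace inequality -/

section Face

variable {m : ℕ} {lo hi : Fin (m + 1) → ℝ}

theorem insertNth_add (i : Fin (m + 1)) (c c' : ℝ) (y y' : Fin m → ℝ) :
    (i.insertNth (c + c') (y + y') : Fin (m + 1) → ℝ)
      = (i.insertNth c y : Fin (m + 1) → ℝ) + i.insertNth c' y' := by
  ext j
  refine Fin.succAboveCases i ?_ (fun k => ?_) j <;> simp

theorem insertNth_smul_single (i : Fin (m + 1)) (j : Fin m) (t : ℝ) :
    (i.insertNth 0 (t • Pi.single j 1 : Fin m → ℝ) : Fin (m + 1) → ℝ)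
      = t • Pi.single (i.succAbove j) 1 := by
  ext k
  refine Fin.succAboveCases i ?_ (fun l => ?_) k
  · simp [(Fin.succAbove_ne i j).symm]
  · simp [Pi.single_apply]

theorem contDiff_insertNth (i : Fin (m + 1)) (c : ℝ) :
    ContDiff ℝ ∞ (fun y : Fin m → ℝ => (i.insertNth c y : Fin (m + 1) → ℝ)) := by
  rw [contDiff_pi]
  intro j
  refine Fin.succAboveCases i ?_ (fun k => ?_) j
  · simpa using contDiff_const
  · simpa using contDiff_apply ℝ ℝ k

theorem continuous_insertNth (i : Fin (m + 1)) (c : ℝ) :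
    Continuous (fun y : Fin m → ℝ => (i.insertNth c y : Fin (m + 1) → ℝ)) :=
  (contDiff_insertNth i c).continuous

theorem pderiv_insertNth {φ : (Fin (m + 1) → ℝ) → ℝ} (hφ : Differentiable ℝ φ) (i : Fin (m + 1))
    (c : ℝ) (j : Fin m) (y : Fin m → ℝ) :
    pderiv j (fun y => φ (i.insertNth c y)) y = pderiv (i.succAbove j) φ (i.insertNth c y) := by
  have h1 : DifferentiableAt ℝ (fun y => φ (i.insertNth c y)) y :=
    (hφ _).comp y ((contDiff_insertNth i c).differentiable (by simp) y)
  rw [pderiv_eq_deriv h1, pderiv_eq_deriv (hφ _)]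
  congr 1
  ext t
  rw [← insertNth_smul_single, ← insertNth_add, add_zero]

/-- The divergence theorem for the field whose only nonzero component is the i-th one. Open and
closed boxes differ by a null set. -/
theorem integral_pderiv_box (hlt : ∀ i, lo i < hi i) {f : (Fin (m + 1) → ℝ) → ℝ}
    (hf : ContDiff ℝ 1 f) (i : Fin (m + 1)) :
    ∫ x in box lo hi, pderiv i f x = (∫ y in faceBox lo hi i, f (i.insertNth (hi i) y))
      - ∫ y in faceBox lo hi i, f (i.insertNth (lo i) y) := by
  have hd := hf.differentiable one_ne_zero
  have hpt : ∀ x, ∑ j, (if j = i then fderiv ℝ f x else 0) (Pi.single j 1) = pderiv i f x := by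
    intro x
    rw [Finset.sum_eq_single i (fun j _ hj => by simp [hj]) (by simp)]
    simp [pderiv]
  have h := integral_divergence_of_hasFDerivAt_off_countable' lo hi (fun i => (hlt i).le)
    (fun j x => if j = i then f x else 0) (fun j x => if j = i then fderiv ℝ f x else 0) ∅
    countable_empty
    (fun j => by split_ifs; exacts [hf.continuous.continuousOn, continuousOn_const])
    (fun x _ j => by split_ifs; exacts [(hd x).hasFDerivAt, hasFDerivAt_const _ _])
    (by
      simp only [hpt]
      exact (continuous_pderiv hf i).continuousOn.integrableOn_compact isCompact_Icc)
  simp only [hpt] at h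
  rw [setIntegral_congr_set (box_ae_eq_Icc lo hi), h,
    Finset.sum_eq_single i (fun j _ hj => by simp [hj]) (by simp)]
  simp only [if_true]
  rw [faceBox, setIntegral_congr_set (box_ae_eq_Icc _ _), setIntegral_congr_set (box_ae_eq_Icc _ _)]
  rfl

/-- Divergence theorem on a box. -/
theorem integral_divergence_box (hlt : ∀ i, lo i < hi i)
    {F : Fin (m + 1) → (Fin (m + 1) → ℝ) → ℝ} (hF : ∀ i, ContDiff ℝ 1 (F i)) :
    ∫ x in box lo hi, ∑ i, pderiv i (F i) x
      = ∑ i, ((∫ y in faceBox lo hi i, F i (i.insertNth (hi i) y))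
        - ∫ y in faceBox lo hi i, F i (i.insertNth (lo i) y)) := by
  rw [integral_finsetSum _ fun i _ => integrable_box (continuous_pderiv (hF i) i) lo hi]
  exact Finset.sum_congr rfl fun i _ => integral_pderiv_box hlt (hF i) i

/-- The trace inequality for functions which are smooth up to the boundary. -/
theorem integral_face_sq_le (hlt : ∀ i, lo i < hi i) {ψ : (Fin (m + 1) → ℝ) → ℝ}
    (hψ : ContDiff ℝ ∞ ψ) {i : Fin (m + 1)} {c : ℝ} (hc : c = lo i ∨ c = hi i) :
    (hi i - lo i) * ∫ y in faceBox lo hi i, ψ (i.insertNth c y) ^ 2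
      ≤ (1 + (hi i - lo i)) *
        ((∫ x in box lo hi, ψ x ^ 2) + ∫ x in box lo hi, pderiv i ψ x ^ 2) := by
  have hψ1 : ContDiff ℝ 1 ψ := hψ.of_le (by simp)
  have hd := hψ1.differentiable one_ne_zero
  have hci : ∀ c' : ℝ, ContDiff ℝ 1 fun x : Fin (m + 1) → ℝ => x i - c' := fun c' =>
    (contDiff_apply ℝ ℝ i).sub contDiff_const
  have hdd : Differentiable ℝ fun x => ψ x * ψ x := hd.mul hd
  -- The derivative of (x_i - c')ψ² is integrated. With c' the coordinate of the opposite face, only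
  -- the face of interest contributes, with the width of the box as factor.
  have key : ∀ c' : ℝ, lo i ≤ c' → c' ≤ hi i →
      (∫ x in box lo hi, pderiv i (fun x => (x i - c') * (ψ x * ψ x)) x) ≤ (1 + (hi i - lo i)) *
        ((∫ x in box lo hi, ψ x ^ 2) + ∫ x in box lo hi, pderiv i ψ x ^ 2) := by
    intro c' h1 h2
    have i1 : Integrable (fun x => ψ x ^ 2) (volume.restrict (box lo hi)) :=
      integrable_box (hψ1.continuous.pow 2) lo hi
    have i2 : Integrable (fun x => pderiv i ψ x ^ 2) (volume.restrict (box lo hi)) :=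
      integrable_box ((continuous_pderiv hψ1 i).pow 2) lo hi
    rw [← integral_add i1 i2, ← integral_const_mul]
    refine setIntegral_mono_on
      (integrable_box (continuous_pderiv ((hci c').mul (hψ1.mul hψ1)) i) lo hi)
      ((i1.add i2).const_mul _) (measurableSet_box lo hi) fun x hx => ?_
    rw [pderiv_mul ((hci c').differentiable one_ne_zero) hdd, pderiv_mul hd hd,
      pderiv_sub (f := fun x : Fin (m + 1) → ℝ => x i) (differentiable_apply i)
        (differentiable_const c'), pderiv_apply]
    have h0 : pderiv i (fun _ : Fin (m + 1) → ℝ => c') x = 0 := by simp [pderiv]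
    rw [h0]
    have hx' := mem_box.1 hx i
    have h3 : |x i - c'| ≤ hi i - lo i := abs_le.2 ⟨by linarith, by linarith⟩
    have h4 : (x i - c') * (2 * (ψ x * pderiv i ψ x))
        ≤ (hi i - lo i) * (ψ x ^ 2 + pderiv i ψ x ^ 2) := by
      refine (le_abs_self _).trans ?_
      rw [abs_mul]
      refine mul_le_mul h3 ?_ (abs_nonneg _) (by linarith [hlt i])
      exact abs_le.2 ⟨by nlinarith [sq_nonneg (ψ x + pderiv i ψ x)],
        by nlinarith [sq_nonneg (ψ x - pderiv i ψ x)]⟩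
    simp only [if_true]
    nlinarith [sq_nonneg (pderiv i ψ x)]
  rcases hc with rfl | rfl
  · have h := key (hi i) (hlt i).le le_rfl
    rw [integral_pderiv_box hlt ((hci _).mul (hψ1.mul hψ1))] at h
    simp only [Fin.insertNth_apply_same, sub_self, zero_mul, integral_zero,
      integral_const_mul] at h
    simp only [pow_two] at h ⊢
    linarith
  · have h := key (lo i) le_rfl (hlt i).le
    rw [integral_pderiv_box hlt ((hci _).mul (hψ1.mul hψ1))] at h
    simp only [Fin.insertNth_apply_same, sub_self, zero_mul, integral_zero,
      integral_const_mul] at h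
    simp only [pow_two] at h ⊢
    linarith

/-- The trace inequality in norm form, with K independent of the function and of the choice between
the two opposite faces. Only the derivative normal to the face is needed. -/
theorem exists_eLpNorm_face_le (hlt : ∀ i, lo i < hi i) (i : Fin (m + 1)) :
    ∃ K : ℝ, ∀ ψ : (Fin (m + 1) → ℝ) → ℝ, ContDiff ℝ ∞ ψ → ∀ c, c = lo i ∨ c = hi i →
      eLpNorm (fun y => ψ (i.insertNth c y)) 2 (volume.restrict (faceBox lo hi i))
        ≤ ENNReal.ofReal K * (eLpNorm ψ 2 (volume.restrict (box lo hi))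
          + eLpNorm (pderiv i ψ) 2 (volume.restrict (box lo hi))) := by
  have hd : 0 < hi i - lo i := sub_pos.2 (hlt i)
  refine ⟨√((1 + (hi i - lo i)) / (hi i - lo i)), fun ψ hψ c hc => ?_⟩
  have h := integral_face_sq_le hlt hψ hc
  have m1 := memLp_box hψ.continuous lo hi
  have m2 := memLp_box (contDiff_pderiv hψ i).continuous lo hi
  have m3 : MemLp (fun y => ψ (i.insertNth c y)) 2 (volume.restrict (faceBox lo hi i)) :=
    memLp_box (hψ.continuous.comp (continuous_insertNth i c)) _ _
  have n1 : 0 ≤ ∫ x in box lo hi, ψ x ^ 2 := integral_nonneg fun _ => sq_nonneg _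
  have n2 : 0 ≤ ∫ x in box lo hi, pderiv i ψ x ^ 2 := integral_nonneg fun _ => sq_nonneg _
  rw [eLpNorm_two_eq m1, eLpNorm_two_eq m2, ← ENNReal.ofReal_add (by positivity) (by positivity),
    ← ENNReal.ofReal_mul (by positivity), eLpNorm_two_le_iff m3 (by positivity), mul_pow,
    Real.sq_sqrt (by positivity), div_mul_eq_mul_div, le_div_iff₀ hd, mul_comm _ (hi i - lo i)]
  refine h.trans (mul_le_mul_of_nonneg_left ?_ (by positivity))
  rw [add_sq, Real.sq_sqrt n1, Real.sq_sqrt n2]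
  have : 0 ≤ 2 * √(∫ x in box lo hi, ψ x ^ 2) * √(∫ x in box lo hi, pderiv i ψ x ^ 2) := by
    positivity
  linarith

end Face


/-! ### Mollification composed with an affine map -/

section Mollify

variable {n : ℕ}

/-- The convolution of `f` with the kernel `k`, composed with the affine map `x ↦ s x + p`. -/
noncomputable def mollify (k f : (Fin n → ℝ) → ℝ) (s : ℝ) (p x : Fin n → ℝ) : ℝ :=
  ∫ y, f y * k (s • x + p - y)

theorem mollify_eq_convolution (k f : (Fin n → ℝ) → ℝ) (s : ℝ) (p x : Fin n → ℝ) :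
    mollify k f s p x
      = MeasureTheory.convolution f k (ContinuousLinearMap.lsmul ℝ ℝ) volume (s • x + p) := by
  simp [mollify, MeasureTheory.convolution]

theorem mollify_eq_integral_sub (k f : (Fin n → ℝ) → ℝ) (s : ℝ) (p x : Fin n → ℝ) :
    mollify k f s p x = ∫ y, f (s • x + p - y) * k y := by
  rw [mollify, ← integral_sub_left_eq_self (fun y => f y * k (s • x + p - y)) volume (s • x + p)]
  simp

theorem contDiff_mollify {k f : (Fin n → ℝ) → ℝ} (hk : ContDiff ℝ ∞ k) (hkc : HasCompactSupport k)
    (hf : MemLp f 2) (s : ℝ) (p : Fin n → ℝ) : ContDiff ℝ ∞ (mollify k f s p) := by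
  have h := hkc.contDiff_convolution_right (n := ⊤) (ContinuousLinearMap.lsmul ℝ ℝ)
    (hf.locallyIntegrable one_le_two) hk
  have h2 : mollify k f s p = fun x =>
      MeasureTheory.convolution f k (ContinuousLinearMap.lsmul ℝ ℝ) volume (s • x + p) :=
    funext fun x => mollify_eq_convolution k f s p x
  rw [h2]
  exact h.comp ((contDiff_id.const_smul s).add contDiff_const)

theorem pderiv_mollify {k f : (Fin n → ℝ) → ℝ} (hk : ContDiff ℝ ∞ k) (hkc : HasCompactSupport k)
    (hf : MemLp f 2) (s : ℝ) (p : Fin n → ℝ) (i : Fin n) (x : Fin n → ℝ) :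
    pderiv i (mollify k f s p) x = s * mollify (pderiv i k) f s p x := by
  have hk1 : ContDiff ℝ 1 k := hk.of_le (by simp)
  have hloc := hf.locallyIntegrable one_le_two
  have h := hkc.hasFDerivAt_convolution_right (ContinuousLinearMap.lsmul ℝ ℝ) hloc hk1 (s • x + p)
  have h2 : mollify k f s p = fun x =>
      MeasureTheory.convolution f k (ContinuousLinearMap.lsmul ℝ ℝ) volume (s • x + p) :=
    funext fun x => mollify_eq_convolution k f s p x
  have h3 : HasFDerivAt (fun x : Fin n → ℝ => s • x + p)
      (s • ContinuousLinearMap.id ℝ (Fin n → ℝ)) x :=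
    ((hasFDerivAt_id x).const_smul s).add_const p
  have h4 := h.comp x h3
  have h5 : MeasureTheory.convolution f k (ContinuousLinearMap.lsmul ℝ ℝ) volume ∘
      (fun x => s • x + p) = mollify k f s p := h2.symm
  rw [h5] at h4
  rw [pderiv, h4.fderiv, mollify_eq_convolution]
  simp only [ContinuousLinearMap.comp_apply, smul_apply,
    ContinuousLinearMap.id_apply, map_smul]
  rw [convolution_precompR_apply _ hloc (hkc.fderiv (𝕜 := ℝ)) (hk1.continuous_fderiv one_ne_zero)]
  rfl

theorem pderiv_comp_const_sub {k : (Fin n → ℝ) → ℝ} (hk : ContDiff ℝ ∞ k) (q : Fin n → ℝ)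
    (i : Fin n) (y : Fin n → ℝ) : pderiv i (fun y => k (q - y)) y = -pderiv i k (q - y) := by
  have h : HasFDerivAt (fun y => k (q - y))
      ((fderiv ℝ k (q - y)).comp (-ContinuousLinearMap.id ℝ (Fin n → ℝ))) y :=
    ((hk.differentiable (by simp) _).hasFDerivAt).comp y ((hasFDerivAt_id y).const_sub q)
  rw [pderiv, h.fderiv]
  simp [pderiv]

/-- An integration by parts against the shifted kernel moves a derivative from the kernel to the
mollified function. -/
theorem mollify_pderiv_eq {U : Set (Fin n → ℝ)} (hU : MeasurableSet U) {k u g : (Fin n → ℝ) → ℝ}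
    (hk : ContDiff ℝ ∞ k) {s : ℝ} {p x : Fin n → ℝ} {i : Fin n}
    (h : ∫ y in U, u y * pderiv i (fun y => k (s • x + p - y)) y
      = -∫ y in U, g y * k (s • x + p - y)) :
    mollify (pderiv i k) (U.indicator u) s p x = mollify k (U.indicator g) s p x := by
  have e : ∀ w v : (Fin n → ℝ) → ℝ, ∫ y, U.indicator w y * v y = ∫ y in U, w y * v y :=
    fun w v => by
      rw [← integral_indicator hU]
      refine integral_congr_ae (Eventually.of_forall fun y => ?_)
      by_cases hy : y ∈ U <;> simp [hy]
  rw [mollify, mollify, e, e]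
  simp only [pderiv_comp_const_sub hk, mul_neg, integral_neg] at h
  linarith

theorem lintegral_comp_affine {g : (Fin n → ℝ) → ENNReal} (hg : Measurable g) {s : ℝ} (hs : s ≠ 0)
    (q : Fin n → ℝ) :
    ∫⁻ x, g (s • x + q) = ENNReal.ofReal |(s ^ n)⁻¹| * ∫⁻ x, g x := by
  have h1 : ∫⁻ x, g (s • x + q)
      = ∫⁻ x, g (x + q) ∂(Measure.map (fun x : Fin n → ℝ => s • x) volume) := by
    rw [lintegral_map (f := fun x => g (x + q)) (hg.comp (measurable_add_const q))
      (measurable_const_smul s)]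
  rw [h1, Measure.map_addHaar_smul _ hs, lintegral_smul_measure, lintegral_add_right_eq_self]
  simp

/-- Young's inequality, from Minkowski's with respect to the measure |k(y)|dy. The factor `2 ^ n`
bounds the Jacobian of the dilation, as s ≥ 1/2. -/
theorem eLpNorm_mollify_le {k f : (Fin n → ℝ) → ℝ} (hk : Continuous k)
    (hf : AEStronglyMeasurable f volume) {s : ℝ} (hs : 1 / 2 ≤ s) (p : Fin n → ℝ) :
    eLpNorm (mollify k f s p) 2 volume
      ≤ 2 ^ n * (∫⁻ y, ‖k y‖ₑ) * eLpNorm f 2 volume := by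
  have hs0 : 0 < s := by linarith
  obtain ⟨f', hf', hff'⟩ := hf
  have e1 : mollify k f s p = mollify k f' s p := by
    ext x
    exact integral_congr_ae (hff'.mono fun y hy => by simp [hy])
  rw [e1, eLpNorm_congr_ae hff']
  have hm : Measurable f' := hf'.measurable
  have hkm : Measurable fun y => ‖k y‖ₑ := hk.measurable.enorm
  have h1 : ∀ x, ‖mollify k f' s p x‖ₑ
      ≤ ∫⁻ y, ‖f' (s • x + p - y)‖ₑ ∂(volume.withDensity fun y => ‖k y‖ₑ) := fun x => by
    rw [mollify_eq_integral_sub]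
    refine (enorm_integral_le_lintegral_enorm _).trans (le_of_eq ?_)
    have hm2 : Measurable fun y => ‖f' (s • x + p - y)‖ₑ := (hm.comp (by fun_prop)).enorm
    rw [lintegral_withDensity_eq_lintegral_mul _ hkm hm2]
    exact lintegral_congr fun y => by simp [mul_comm]
  have h2 := lintegral_lintegral_sq_le (μ := (volume : Measure (Fin n → ℝ)))
    (ν := volume.withDensity fun y => ‖k y‖ₑ)
    (F := fun x y => ‖f' (s • x + p - y)‖ₑ) (M := 2 ^ n * eLpNorm f' 2 volume ^ 2)
    ((hm.comp (by fun_prop)).enorm.aemeasurable) (Eventually.of_forall fun y => by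
      have h := lintegral_comp_affine (g := fun x => ‖f' x‖ₑ ^ 2) (hm.enorm.pow_const 2) hs0.ne'
        (p - y)
      simp only [add_sub_assoc]
      rw [h, eLpNorm_two_sq]
      gcongr
      rw [show (2 : ENNReal) ^ n = ENNReal.ofReal (2 ^ n) by
        rw [ENNReal.ofReal_pow zero_le_two]; simp]
      apply ENNReal.ofReal_le_ofReal
      rw [abs_of_pos (by positivity), ← inv_pow]
      exact pow_le_pow_left₀ (by positivity) (by
        rw [inv_le_comm₀ hs0 two_pos]; linarith) n)
  rw [withDensity_apply _ MeasurableSet.univ, Measure.restrict_univ] at h2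
  rw [← ENNReal.pow_le_pow_left_iff two_ne_zero, eLpNorm_two_sq]
  calc ∫⁻ x, ‖mollify k f' s p x‖ₑ ^ 2
      ≤ _ := lintegral_mono fun x => by gcongr; exact h1 x
    _ ≤ _ := h2
    _ ≤ (2 ^ n * (∫⁻ y, ‖k y‖ₑ) * eLpNorm f' 2 volume) ^ 2 := by
      rw [mul_pow, mul_pow]
      have : (2 : ENNReal) ^ n ≤ (2 ^ n) ^ 2 := by
        rw [pow_two]; exact le_mul_of_one_le_left' (one_le_pow₀ one_le_two)
      calc _ = 2 ^ n * (∫⁻ y, ‖k y‖ₑ) ^ 2 * eLpNorm f' 2 volume ^ 2 := by ring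
        _ ≤ _ := by gcongr

theorem integrable_mul_kernel {k f : (Fin n → ℝ) → ℝ} (hk : Continuous k)
    (hkc : HasCompactSupport k) (hf : MemLp f 2) (q : Fin n → ℝ) :
    Integrable fun y => f y * k (q - y) := by
  have h : HasCompactSupport fun y => k (q - y) := hkc.comp_homeomorph (Homeomorph.subLeft q)
  have hc : Continuous fun y => k (q - y) := hk.comp (continuous_const.sub continuous_id)
  exact hf.integrable_mul (q := 2) (hc.memLp_of_hasCompactSupport h)

theorem mollify_sub {k f g : (Fin n → ℝ) → ℝ} (hk : Continuous k) (hkc : HasCompactSupport k)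
    (hf : MemLp f 2) (hg : MemLp g 2) (s : ℝ) (p x : Fin n → ℝ) :
    mollify k (f - g) s p x = mollify k f s p x - mollify k g s p x := by
  rw [mollify, mollify, mollify, ← integral_sub (integrable_mul_kernel hk hkc hf _)
    (integrable_mul_kernel hk hkc hg _)]
  simp [sub_mul]

/-- A nonnegative smooth kernel of mass one, supported in the closed ball of radius `ε`. -/
structure IsKernel (k : (Fin n → ℝ) → ℝ) (ε : ℝ) : Prop where
  contDiff : ContDiff ℝ ∞ k
  hasCompactSupport : HasCompactSupport k
  nonneg : ∀ y, 0 ≤ k y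
  integral : ∫ y, k y = 1
  norm_le : ∀ y, k y ≠ 0 → ‖y‖ ≤ ε

theorem IsKernel.lintegral_enorm {k : (Fin n → ℝ) → ℝ} {ε : ℝ} (h : IsKernel k ε) :
    ∫⁻ y, ‖k y‖ₑ = 1 := by
  have hi : Integrable k := h.contDiff.continuous.integrable_of_hasCompactSupport h.hasCompactSupport
  have := ofReal_integral_eq_lintegral_ofReal hi (Eventually.of_forall h.nonneg)
  rw [h.integral, ENNReal.ofReal_one] at this
  rw [this]
  exact lintegral_congr fun y => Real.enorm_eq_ofReal (h.nonneg y)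

/-- The mollification at x is an average of the values of g over the ball of radius ε about s x + p.
-/
theorem IsKernel.abs_mollify_sub_le {k : (Fin n → ℝ) → ℝ} {ε : ℝ} (hk : IsKernel k ε)
    {g : (Fin n → ℝ) → ℝ} (hg : MemLp g 2) {s η : ℝ} {p x : Fin n → ℝ}
    (h : ∀ y, ‖s • x + p - y‖ ≤ ε → |g y - g x| ≤ η) : |mollify k g s p x - g x| ≤ η := by
  have hc := hk.contDiff.continuous
  have hki : Integrable fun y => k (s • x + p - y) :=
    (hc.integrable_of_hasCompactSupport hk.hasCompactSupport).comp_sub_left (s • x + p)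
  have h1 : ∫ y, k (s • x + p - y) = 1 := by
    rw [integral_sub_left_eq_self k volume (s • x + p), hk.integral]
  have e : mollify k g s p x - g x = ∫ y, (g y - g x) * k (s • x + p - y) := by
    simp only [sub_mul]
    rw [integral_sub (integrable_mul_kernel hc hk.hasCompactSupport hg _) (hki.const_mul (g x)),
      integral_const_mul, h1, mul_one, mollify]
  rw [e, ← Real.norm_eq_abs]
  calc ‖∫ y, (g y - g x) * k (s • x + p - y)‖ ≤ ∫ y, η * k (s • x + p - y) := by
        refine norm_integral_le_of_norm_le (hki.const_mul η) (Eventually.of_forall fun y => ?_)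
        rw [norm_mul, Real.norm_eq_abs, Real.norm_of_nonneg (hk.nonneg _)]
        by_cases h0 : k (s • x + p - y) = 0
        · simp [h0]
        · exact mul_le_mul_of_nonneg_right (h y (hk.norm_le _ h0)) (hk.nonneg _)
    _ = η := by rw [integral_const_mul, h1, mul_one]

/-- Mollifications with kernels that shrink, composed with affine maps that tend to the identity,
converge in `L²`. -/
theorem tendsto_mollify {k : ℕ → (Fin n → ℝ) → ℝ} {ε s : ℕ → ℝ} {p : ℕ → Fin n → ℝ}
    (hk : ∀ j, IsKernel (k j) (ε j)) (hε : Tendsto ε atTop (𝓝 0)) (hs : Tendsto s atTop (𝓝 1))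
    (hp : Tendsto p atTop (𝓝 0)) (hs2 : ∀ j, 1 / 2 ≤ s j) {f : (Fin n → ℝ) → ℝ} (hf : MemLp f 2) :
    L2Lim volume (fun j => mollify (k j) f (s j) (p j)) f := by
  have hcd : ∀ j {f : (Fin n → ℝ) → ℝ}, MemLp f 2 → Continuous (mollify (k j) f (s j) (p j)) :=
    fun j f hf => (contDiff_mollify (hk j).contDiff (hk j).hasCompactSupport hf _ _).continuous
  have hbd : ∀ j {f : (Fin n → ℝ) → ℝ}, MemLp f 2 →
      eLpNorm (mollify (k j) f (s j) (p j)) 2 volume ≤ 2 ^ n * eLpNorm f 2 volume :=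
    fun j f hf => by
      have h := eLpNorm_mollify_le (hk j).contDiff.continuous hf.1 (hs2 j) (p j)
      rwa [(hk j).lintegral_enorm, mul_one] at h
  refine ⟨fun j => ⟨(hcd j hf).aestronglyMeasurable, (hbd j hf).trans_lt
    (ENNReal.mul_lt_top (by finiteness) hf.2)⟩, hf, ?_⟩
  rw [ENNReal.tendsto_nhds_zero]
  intro δ hδ
  by_cases hδt : δ = ⊤
  · simp [hδt]
  -- With g continuous of compact support and close to f, the error splits into the mollification of
  -- f - g (at most 2ⁿe), the mollification error of g (at most e) and g - f (at most e).
  set D : ENNReal := 2 ^ n + 2 with hD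
  have hD0 : D ≠ 0 := by simp [hD]
  have hDt : D ≠ ⊤ := by finiteness
  set e : ENNReal := δ / D with he
  have he0 : e ≠ 0 := (ENNReal.div_pos hδ.ne' hDt).ne'
  have het : e ≠ ⊤ := ENNReal.div_ne_top hδt hD0
  obtain ⟨g, hgc, hfg, hg, hgm⟩ := hf.exists_hasCompactSupport_eLpNorm_sub_le ENNReal.ofNat_ne_top he0
  obtain ⟨R, hR0, hR⟩ := hgc.isCompact.isBounded.subset_closedBall_lt 0 0
  -- Outside this ball ‖s x‖ > R + 2, because s ≥ 1/2. As the shift and the kernel radius are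
  -- eventually at most 1, both g and its mollification vanish there.
  set B : Set (Fin n → ℝ) := Metric.closedBall 0 (2 * (R + 2)) with hB
  have hBfin : volume B ≠ ⊤ := (isCompact_closedBall _ _).measure_lt_top.ne
  -- the size of the pointwise error on `B`
  obtain ⟨η, hη0, hη⟩ : ∃ η : ℝ, 0 < η ∧ volume B ^ (1 / 2 : ℝ) * ENNReal.ofReal η ≤ e := by
    have ht : Tendsto (fun η : ℝ => volume B ^ (1 / 2 : ℝ) * ENNReal.ofReal η) (𝓝[>] 0) (𝓝 0) := by
      have h0 : Tendsto (fun η : ℝ => volume B ^ (1 / 2 : ℝ) * ENNReal.ofReal η) (𝓝[>] 0)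
          (𝓝 (volume B ^ (1 / 2 : ℝ) * ENNReal.ofReal 0)) :=
        ENNReal.Tendsto.const_mul (ENNReal.tendsto_ofReal (tendsto_id.mono_left nhdsWithin_le_nhds))
          (Or.inr (ENNReal.rpow_ne_top_of_nonneg (by norm_num) hBfin))
      simpa using h0
    obtain ⟨η, h1, h2⟩ := ((ht.eventually_le_const (pos_iff_ne_zero.2 he0)).and
      self_mem_nhdsWithin).exists
    exact ⟨η, h2, h1⟩
  obtain ⟨d, hd0, hd⟩ := Metric.uniformContinuous_iff.1
    (hgc.uniformContinuous_of_continuous hg) η hη0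
  have ev1 : ∀ᶠ j in atTop, ε j ≤ 1 ∧ ‖p j‖ ≤ 1 ∧
      |s j - 1| * (2 * (R + 2)) + ‖p j‖ + ε j < d := by
    have t1 : Tendsto (fun j => |s j - 1| * (2 * (R + 2)) + ‖p j‖ + ε j) atTop (𝓝 0) := by
      have := ((((hs.sub_const 1).abs).mul_const (2 * (R + 2))).add hp.norm).add hε
      simpa using this
    have t2 := hp.norm
    rw [norm_zero] at t2
    filter_upwards [hε.eventually_le_const one_pos, t2.eventually_le_const one_pos,
      t1.eventually_lt_const hd0] with j a b c using ⟨a, b, c⟩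
  filter_upwards [ev1] with j ⟨hj1, hj2, hj3⟩
  have hmg : eLpNorm (fun x => mollify (k j) g (s j) (p j) x - g x) 2 volume ≤ e := by
    have hpt : ∀ x, ‖mollify (k j) g (s j) (p j) x - g x‖ ≤ B.indicator (fun _ => η) x := by
      intro x
      by_cases hx : x ∈ B
      · rw [indicator_of_mem hx, Real.norm_eq_abs]
        refine (hk j).abs_mollify_sub_le hgm fun y hy => ?_
        have hxn : ‖x‖ ≤ 2 * (R + 2) := by simpa [hB] using hx
        refine (hd (a := y) (b := x) ?_).le
        rw [dist_eq_norm]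
        calc ‖y - x‖ = ‖(s j - 1) • x + p j - (s j • x + p j - y)‖ := by
              congr 1; rw [sub_smul, one_smul]; abel
          _ ≤ ‖(s j - 1) • x‖ + ‖p j‖ + ‖s j • x + p j - y‖ :=
            (norm_sub_le _ _).trans (add_le_add_left (norm_add_le _ _) _)
          _ ≤ |s j - 1| * (2 * (R + 2)) + ‖p j‖ + ε j := by
            rw [norm_smul, Real.norm_eq_abs]; gcongr
          _ < d := hj3
      · rw [indicator_of_notMem hx]
        have hxn : 2 * (R + 2) < ‖x‖ := by simpa [hB] using hx
        have hg0 : ∀ y, R < ‖y‖ → g y = 0 := fun y hy => by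
          by_contra h0
          have := hR (subset_tsupport g h0)
          simp only [Metric.mem_closedBall, dist_zero_right] at this
          linarith
        have hx0 : g x = 0 := hg0 x (by linarith)
        have h := (hk j).abs_mollify_sub_le hgm (s := s j) (p := p j) (x := x) (η := 0)
          fun y hy => by
            rw [hx0, hg0 y ?_]; · simp
            have h1 : ‖s j • x‖ ≤ ‖s j • x + p j - y‖ + ‖p j‖ + ‖y‖ := by
              calc ‖s j • x‖ = ‖(s j • x + p j - y) - p j + y‖ := by congr 1; abel
                _ ≤ _ := (norm_add_le _ _).trans (add_le_add_left (norm_sub_le _ _) _)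
            rw [norm_smul, Real.norm_eq_abs, abs_of_pos (by linarith [hs2 j])] at h1
            have h2 : 1 / 2 * ‖x‖ ≤ s j * ‖x‖ := by gcongr; exact hs2 j
            linarith
        simpa using h
    calc _ ≤ eLpNorm (B.indicator fun _ => η) 2 volume := eLpNorm_mono_real hpt
      _ = volume B ^ (1 / 2 : ℝ) * ENNReal.ofReal η := by
        rw [eLpNorm_indicator_const Metric.isClosed_closedBall.measurableSet two_ne_zero
          ENNReal.ofNat_ne_top, Real.enorm_eq_ofReal hη0.le, mul_comm, ENNReal.toReal_ofNat]
      _ ≤ e := hη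
  have hsub : MemLp (f - g) 2 := hf.sub hgm
  have hdec : (fun x => mollify (k j) f (s j) (p j) x - f x)
      = (mollify (k j) (f - g) (s j) (p j) + fun x => mollify (k j) g (s j) (p j) x - g x)
        + (g - f) := by
    ext x
    simp only [Pi.add_apply, Pi.sub_apply]
    rw [mollify_sub (hk j).contDiff.continuous (hk j).hasCompactSupport hf hgm]
    ring
  have m1 := (hcd j hsub).aestronglyMeasurable (μ := (volume : Measure (Fin n → ℝ)))
  have m2 : AEStronglyMeasurable (fun x => mollify (k j) g (s j) (p j) x - g x) volume :=
    ((hcd j hgm).sub hg).aestronglyMeasurable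
  rw [hdec]
  calc _ ≤ (2 ^ n * e + e) + e := by
        refine (eLpNorm_add_le (m1.add m2) (hgm.sub hf).1 one_le_two).trans (add_le_add
          ((eLpNorm_add_le m1 m2 one_le_two).trans (add_le_add ((hbd j hsub).trans ?_) hmg)) ?_)
        · gcongr
        · rw [eLpNorm_sub_comm]; exact hfg
    _ = D * e := by rw [hD]; ring
    _ = δ := ENNReal.mul_div_cancel hD0 hDt

/-- The standard smooth kernel, scaled to the ball of radius `ε`. -/
noncomputable def stdKernel (n : ℕ) (ε : ℝ) (y : Fin n → ℝ) : ℝ :=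
  (ε ^ n)⁻¹ * (⟨1 / 2, 1, by norm_num, by norm_num⟩ : ContDiffBump (0 : Fin n → ℝ)).normed volume
    (ε⁻¹ • y)

theorem stdKernel_eq (n : ℕ) (ε : ℝ) (y : Fin n → ℝ) :
    stdKernel n ε y = (ε ^ n)⁻¹ * stdKernel n 1 (ε⁻¹ • y) := by
  simp [stdKernel]

theorem isKernel_stdKernel_one (n : ℕ) : IsKernel (stdKernel n 1) 1 := by
  set b : ContDiffBump (0 : Fin n → ℝ) := ⟨1 / 2, 1, by norm_num, by norm_num⟩ with hb
  have e : stdKernel n 1 = b.normed volume := by ext y; simp [stdKernel, hb]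
  rw [e]
  refine ⟨b.contDiff_normed, b.hasCompactSupport_normed, b.nonneg_normed, b.integral_normed, ?_⟩
  intro y hy
  have : y ∈ Function.support (b.normed volume) := hy
  rw [b.support_normed_eq] at this
  simpa using (Metric.ball_subset_closedBall this)

theorem isKernel_stdKernel (n : ℕ) {ε : ℝ} (hε : 0 < ε) : IsKernel (stdKernel n ε) ε := by
  have h1 := isKernel_stdKernel_one n
  have e : stdKernel n ε = fun y => (ε ^ n)⁻¹ * stdKernel n 1 (ε⁻¹ • y) :=
    funext (stdKernel_eq n ε)
  have hε' : ε⁻¹ ≠ 0 := inv_ne_zero hε.ne'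
  refine ⟨?_, ?_, ?_, ?_, ?_⟩
  · rw [e]
    exact contDiff_const.mul (h1.contDiff.comp (contDiff_id.const_smul ε⁻¹))
  · rw [e]
    exact (h1.hasCompactSupport.comp_smul hε').mul_left
  · intro y
    rw [stdKernel_eq]
    exact mul_nonneg (by positivity) (h1.nonneg _)
  · rw [e, integral_const_mul, Measure.integral_comp_inv_smul_of_nonneg _ _ hε.le, h1.integral]
    simp [hε.ne']
  · intro y hy
    rw [stdKernel_eq] at hy
    have := h1.norm_le _ (right_ne_zero_of_mul hy)
    rwa [norm_smul, norm_inv, Real.norm_of_nonneg hε.le, inv_mul_le_iff₀ hε, mul_one] at this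

/-- Scaling: the source of the factor 1/ε that a second derivative of the regularized trace costs.
-/
theorem lintegral_pderiv_stdKernel {n : ℕ} {ε : ℝ} (hε : 0 < ε) (i : Fin n) :
    ∫⁻ y, ‖pderiv i (stdKernel n ε) y‖ₑ
      = ENNReal.ofReal ε⁻¹ * ∫⁻ y, ‖pderiv i (stdKernel n 1) y‖ₑ := by
  have h1 := isKernel_stdKernel_one n
  have hd : Differentiable ℝ (stdKernel n 1) := h1.contDiff.differentiable (by simp)
  have e : ∀ y, pderiv i (stdKernel n ε) y
      = (ε ^ n)⁻¹ * (ε⁻¹ * pderiv i (stdKernel n 1) (ε⁻¹ • y)) := fun y => by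
    have h2 : HasFDerivAt (fun y : Fin n → ℝ => ε⁻¹ • y)
        (ε⁻¹ • ContinuousLinearMap.id ℝ (Fin n → ℝ)) y := (hasFDerivAt_id y).const_smul ε⁻¹
    have h3 : HasFDerivAt (stdKernel n ε) _ y :=
      ((((hd _).hasFDerivAt).comp y h2).const_mul ((ε ^ n)⁻¹)).congr_of_eventuallyEq
        (Eventually.of_forall fun y => stdKernel_eq n ε y)
    rw [pderiv, h3.fderiv]
    simp [pderiv]
  have hm : Measurable fun y => ‖pderiv i (stdKernel n 1) y‖ₑ :=
    (contDiff_pderiv h1.contDiff i).continuous.measurable.enorm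
  have h4 := lintegral_comp_affine hm (inv_ne_zero hε.ne') 0
  simp only [add_zero] at h4
  have e2 : ∀ y, ‖pderiv i (stdKernel n ε) y‖ₑ
      = ENNReal.ofReal ((ε ^ n)⁻¹ * ε⁻¹) * ‖pderiv i (stdKernel n 1) (ε⁻¹ • y)‖ₑ := fun y => by
    rw [e, ← mul_assoc, enorm_mul, Real.enorm_eq_ofReal (by positivity)]
  simp only [e2]
  rw [lintegral_const_mul' _ _ ENNReal.ofReal_ne_top, h4, ← mul_assoc,
    ← ENNReal.ofReal_mul (by positivity)]
  congr 2
  rw [abs_of_pos (by positivity), inv_pow, inv_inv]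
  field_simp

end Mollify


/-! ### L² convergence under restriction and convergent scalar factors -/

section LTwo

variable {α : Type*} [MeasurableSpace α] {μ : Measure α}

theorem L2Lim.restrict {f : ℕ → α → ℝ} {f₀ : α → ℝ} (hf : L2Lim μ f f₀) (s : Set α) :
    L2Lim (μ.restrict s) f f₀ :=
  ⟨fun k => (hf.memLp k).restrict s, hf.memLp_lim.restrict s,
    tendsto_of_tendsto_of_tendsto_of_le_of_le tendsto_const_nhds hf.tendsto (fun _ => zero_le)
      fun _ => eLpNorm_mono_measure _ Measure.restrict_le_self⟩

theorem L2Lim.seq_mul {f : ℕ → α → ℝ} {f₀ : α → ℝ} (hf : L2Lim μ f f₀) {c : ℕ → ℝ} {c₀ : ℝ}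
    (hc : Tendsto c atTop (𝓝 c₀)) : L2Lim μ (fun k x => c k * f k x) (fun x => c₀ * f₀ x) := by
  refine ⟨fun k => (hf.memLp k).const_mul _, hf.memLp_lim.const_mul _, ?_⟩
  have h1 : Tendsto (fun k => ‖c k‖ₑ * eLpNorm (fun x => f k x - f₀ x) 2 μ
      + ‖c k - c₀‖ₑ * eLpNorm f₀ 2 μ) atTop (𝓝 (‖c₀‖ₑ * 0 + ‖c₀ - c₀‖ₑ * eLpNorm f₀ 2 μ)) := by
    refine Tendsto.add (ENNReal.Tendsto.mul hc.enorm (Or.inr (by finiteness)) hf.tendsto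
      (Or.inr (by finiteness))) (ENNReal.Tendsto.mul_const (hc.sub_const c₀).enorm
      (Or.inr hf.memLp_lim.2.ne))
  simp only [mul_zero, sub_self, enorm_zero, zero_mul, add_zero] at h1
  refine tendsto_of_tendsto_of_tendsto_of_le_of_le tendsto_const_nhds h1 (fun _ => zero_le)
    fun k => ?_
  have h2 := eLpNorm_add_le (((hf.memLp k).sub hf.memLp_lim).const_mul (c k)).1
    (hf.memLp_lim.const_mul (c k - c₀)).1 one_le_two
  have e1 := eLpNorm_const_smul (c k) (f k - f₀) 2 μ
  have e2 := eLpNorm_const_smul (c k - c₀) f₀ 2 μ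
  calc _ = eLpNorm ((fun x => c k * (f k - f₀) x) + fun x => (c k - c₀) * f₀ x) 2 μ := by
        congr 1; ext x; simp only [Pi.add_apply, Pi.sub_apply]; ring
    _ ≤ _ := h2
    _ = _ := congr_arg₂ (· + ·) e1 e2

end LTwo

/-! ### Density of smooth functions in H² of a box -/

section Density

variable {m : ℕ} {lo hi : Fin (m + 1) → ℝ}

theorem exists_pos_le_halfWidth (hlt : ∀ i, lo i < hi i) :
    ∃ r : ℝ, 0 < r ∧ ∀ i, 2 * r ≤ hi i - lo i := by
  refine ⟨Finset.univ.inf' Finset.univ_nonempty (fun i => (hi i - lo i) / 2), ?_, fun i => ?_⟩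
  · rw [Finset.lt_inf'_iff]
    intro i _
    linarith [hlt i]
  · linarith [Finset.inf'_le (fun i => (hi i - lo i) / 2) (Finset.mem_univ i)]

/-- Mollification of `f` at scale `δ r`, after a contraction by `1 - δ` towards the centre of the
box: the values on the box only depend on `f` in the box. -/
noncomputable def innerMollify (lo hi : Fin (m + 1) → ℝ) (r δ : ℝ) (f : (Fin (m + 1) → ℝ) → ℝ) :
    (Fin (m + 1) → ℝ) → ℝ :=
  mollify (stdKernel (m + 1) (δ * r)) ((box lo hi).indicator f) (1 - δ)
    (δ • fun i => (lo i + hi i) / 2)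

variable {r δ : ℝ}

/-- Contraction by 1 - δ towards the centre moves a point of the box to distance more than δ times
the half-width from each face, and r is at most every half-width. -/
theorem mem_box_of_norm_le (hr : ∀ i, 2 * r ≤ hi i - lo i) (hδ : 0 < δ) (hδ1 : δ < 1)
    {x y : Fin (m + 1) → ℝ} (hx : x ∈ box lo hi)
    (hy : ‖(1 - δ) • x + (δ • fun i => (lo i + hi i) / 2) - y‖ ≤ δ * r) : y ∈ box lo hi := by
  rw [mem_box] at hx ⊢
  intro i
  have h1 := (norm_le_pi_norm _ i).trans hy
  simp only [Pi.sub_apply, Pi.add_apply, Pi.smul_apply, smul_eq_mul, Real.norm_eq_abs] at h1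
  obtain ⟨h2, h3⟩ := abs_le.1 h1
  have h4 := mul_pos (sub_pos.2 hδ1) (sub_pos.2 (hx i).1)
  have h5 := mul_pos (sub_pos.2 hδ1) (sub_pos.2 (hx i).2)
  have h6 := mul_le_mul_of_nonneg_left (hr i) hδ.le
  constructor <;> nlinarith

theorem memLp_indicator_box {f : (Fin (m + 1) → ℝ) → ℝ}
    (hf : MemLp f 2 (volume.restrict (box lo hi))) : MemLp ((box lo hi).indicator f) 2 :=
  (memLp_indicator_iff_restrict (measurableSet_box lo hi)).2 hf

theorem contDiff_innerMollify (hr0 : 0 < r) (hδ : 0 < δ) {f : (Fin (m + 1) → ℝ) → ℝ}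
    (hf : MemLp f 2 (volume.restrict (box lo hi))) : ContDiff ℝ ∞ (innerMollify lo hi r δ f) :=
  have hK := isKernel_stdKernel (m + 1) (mul_pos hδ hr0)
  contDiff_mollify hK.contDiff hK.hasCompactSupport (memLp_indicator_box hf) _ _

/-- For x in the box the shifted kernel is supported inside the open box, hence is an admissible
test function for the weak derivative. The factor 1 - δ is the chain rule for the contraction. -/
theorem pderiv_innerMollify (hr0 : 0 < r) (hr : ∀ i, 2 * r ≤ hi i - lo i) (hδ : 0 < δ)
    (hδ1 : δ < 1) {u : (Fin (m + 1) → ℝ) → ℝ} {g : Fin (m + 1) → (Fin (m + 1) → ℝ) → ℝ}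
    (h : IsH1 (box lo hi) u g) (i : Fin (m + 1)) {x : Fin (m + 1) → ℝ} (hx : x ∈ box lo hi) :
    pderiv i (innerMollify lo hi r δ u) x = (1 - δ) * innerMollify lo hi r δ (g i) x := by
  have hK := isKernel_stdKernel (m + 1) (mul_pos hδ hr0)
  rw [innerMollify, innerMollify,
    pderiv_mollify hK.contDiff hK.hasCompactSupport (memLp_indicator_box h.memLp),
    mollify_pderiv_eq (measurableSet_box lo hi) hK.contDiff]
  refine h.isWeakDeriv i _ (hK.contDiff.comp (contDiff_const.sub contDiff_id))
    (hK.hasCompactSupport.comp_homeomorph (Homeomorph.subLeft _)) ?_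
  refine (closure_minimal (t := {y | ‖(1 - δ) • x + (δ • fun i => (lo i + hi i) / 2) - y‖ ≤ δ * r})
    (fun y hy => hK.norm_le _ hy) ?_).trans fun y hy => mem_box_of_norm_le hr hδ hδ1 hx hy
  exact isClosed_le (by fun_prop) continuous_const

theorem tendsto_innerMollify (hr0 : 0 < r) {δ : ℕ → ℝ} (hδ : ∀ k, 0 < δ k)
    (hδ2 : ∀ k, δ k ≤ 1 / 2) (hδ0 : Tendsto δ atTop (𝓝 0)) {f : (Fin (m + 1) → ℝ) → ℝ}
    (hf : MemLp f 2 (volume.restrict (box lo hi))) :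
    L2Lim (volume.restrict (box lo hi)) (fun k => innerMollify lo hi r (δ k) f) f := by
  refine ((tendsto_mollify (k := fun k => stdKernel (m + 1) (δ k * r)) (ε := fun k => δ k * r)
    (s := fun k => 1 - δ k) (p := fun k => δ k • fun i => (lo i + hi i) / 2)
    (fun k => isKernel_stdKernel _ (mul_pos (hδ k) hr0)) (by simpa using hδ0.mul_const r)
    (by simpa using hδ0.const_sub 1) (by simpa using hδ0.smul_const (fun i => (lo i + hi i) / 2))
    (fun k => by linarith [hδ2 k]) (memLp_indicator_box hf)).restrict (box lo hi)).congr_lim ?_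
  filter_upwards [ae_restrict_mem (measurableSet_box lo hi)] with x hx
  simp [hx]

/-- Functions that are smooth up to the boundary are dense in `H²` of a box. -/
theorem IsH2.exists_approx (hlt : ∀ i, lo i < hi i) {u : (Fin (m + 1) → ℝ) → ℝ}
    {g : Fin (m + 1) → (Fin (m + 1) → ℝ) → ℝ}
    {h : Fin (m + 1) → Fin (m + 1) → (Fin (m + 1) → ℝ) → ℝ} (hu : IsH2 (box lo hi) u g h) :
    ∃ φ : ℕ → (Fin (m + 1) → ℝ) → ℝ, (∀ k, ContDiff ℝ ∞ (φ k)) ∧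
      L2Lim (volume.restrict (box lo hi)) φ u ∧
      (∀ i, L2Lim (volume.restrict (box lo hi)) (fun k => pderiv i (φ k)) (g i)) ∧
      ∀ i j, L2Lim (volume.restrict (box lo hi)) (fun k => pderiv j (pderiv i (φ k))) (h i j) := by
  obtain ⟨r, hr0, hr⟩ := exists_pos_le_halfWidth hlt
  -- The shift by 2 keeps δ ≤ 1/2, so that the dilation factor 1 - δ stays at least 1/2.
  set δ : ℕ → ℝ := fun k => 1 / ((k : ℝ) + 2) with hδd
  have hδ : ∀ k, 0 < δ k := fun k => by positivity
  have hδ2 : ∀ k, δ k ≤ 1 / 2 := fun k => by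
    apply one_div_le_one_div_of_le two_pos
    linarith [(Nat.cast_nonneg k : (0 : ℝ) ≤ k)]
  have hδ0 : Tendsto δ atTop (𝓝 0) := by
    have := (tendsto_one_div_add_atTop_nhds_zero_nat (𝕜 := ℝ)).comp (tendsto_add_atTop_nat 1)
    refine this.congr fun k => ?_
    simp only [Function.comp_apply, hδd]
    push_cast
    ring
  have hs : Tendsto (fun k => 1 - δ k) atTop (𝓝 1) := by simpa using hδ0.const_sub 1
  have hd1 : ∀ k i, ∀ x ∈ box lo hi, pderiv i (innerMollify lo hi r (δ k) u) x
      = (1 - δ k) * innerMollify lo hi r (δ k) (g i) x := fun k i x hx =>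
    pderiv_innerMollify hr0 hr (hδ k) (by linarith [hδ2 k]) hu.isH1 i hx
  have hd2 : ∀ k i j, ∀ x ∈ box lo hi, pderiv j (pderiv i (innerMollify lo hi r (δ k) u)) x
      = (1 - δ k) * ((1 - δ k) * innerMollify lo hi r (δ k) (h i j) x) := fun k i j x hx => by
    -- The formula for the first derivative holds only in the box, which is open, so it may be
    -- differentiated there.
    have hev : pderiv i (innerMollify lo hi r (δ k) u) =ᶠ[𝓝 x]
        fun x => (1 - δ k) * innerMollify lo hi r (δ k) (g i) x :=
      ((isOpen_box lo hi).eventually_mem hx).mono fun x hx => hd1 k i x hx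
    rw [pderiv, hev.fderiv_eq]
    have hc := contDiff_innerMollify (lo := lo) (hi := hi) hr0 (hδ k) (hu.isH1.memLp_grad i)
    rw [← pderiv_innerMollify hr0 hr (hδ k) (by linarith [hδ2 k]) (hu.isH1_grad i) j hx]
    exact pderiv_const_mul (hc.differentiable (by simp)) _ j x
  refine ⟨fun k => innerMollify lo hi r (δ k) u,
    fun k => contDiff_innerMollify hr0 (hδ k) hu.isH1.memLp,
    tendsto_innerMollify hr0 hδ hδ2 hδ0 hu.isH1.memLp, fun i => ?_, fun i j => ?_⟩
  · have h1 := (tendsto_innerMollify hr0 hδ hδ2 hδ0 (hu.isH1.memLp_grad i)).seq_mul hs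
    simp only [one_mul] at h1
    refine h1.congr fun k => ?_
    filter_upwards [ae_restrict_mem (measurableSet_box lo hi)] with x hx
    rw [hd1 k i x hx]
  · have h1 := ((tendsto_innerMollify hr0 hδ hδ2 hδ0 ((hu.isH1_grad i).memLp_grad j)).seq_mul
      hs).seq_mul hs
    simp only [one_mul] at h1
    refine h1.congr fun k => ?_
    filter_upwards [ae_restrict_mem (measurableSet_box lo hi)] with x hx
    rw [hd2 k i j x hx]

end Density


/-! ### Traces as limits; tangential derivatives and the extension by zero -/

section Traces

theorem L2Lim.intLim {α : Type*} [MeasurableSpace α] {μ : Measure α} [IsFiniteMeasure μ]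
    {f : ℕ → α → ℝ} {f₀ : α → ℝ} (hf : L2Lim μ f f₀) : IntLim μ f f₀ := by
  simpa using hf.mul (L2Lim.const (memLp_const (1 : ℝ)))

variable {m : ℕ} {lo hi : Fin (m + 1) → ℝ}

instance isFiniteMeasure_faceBox (lo hi : Fin (m + 1) → ℝ) (i : Fin (m + 1)) :
    IsFiniteMeasure ((volume : Measure (Fin m → ℝ)).restrict (faceBox lo hi i)) :=
  isFiniteMeasure_box _ _

theorem memLp_face {ψ : (Fin (m + 1) → ℝ) → ℝ} (hψ : Continuous ψ) (i : Fin (m + 1)) (c : ℝ) :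
    MemLp (fun y => ψ (i.insertNth c y)) 2 (volume.restrict (faceBox lo hi i)) :=
  memLp_box (hψ.comp (continuous_insertNth i c)) _ _

/-- The trace inequality for ψ_k - ψ_l makes the restrictions to the face a Cauchy sequence. Applied
to the first derivatives of an H² approximation, it also gives the traces of the gradient. -/
theorem exists_trace (hlt : ∀ i, lo i < hi i) {ψ : ℕ → (Fin (m + 1) → ℝ) → ℝ}
    {v w : (Fin (m + 1) → ℝ) → ℝ} (hψ : ∀ k, ContDiff ℝ ∞ (ψ k)) {i : Fin (m + 1)}
    (hv : L2Lim (volume.restrict (box lo hi)) ψ v)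
    (hw : L2Lim (volume.restrict (box lo hi)) (fun k => pderiv i (ψ k)) w)
    {c : ℝ} (hc : c = lo i ∨ c = hi i) :
    ∃ T, L2Lim (volume.restrict (faceBox lo hi i)) (fun k y => ψ k (i.insertNth c y)) T := by
  obtain ⟨K, hK⟩ := exists_eLpNorm_face_le hlt i
  have hb : Tendsto (fun k => ENNReal.ofReal K *
      (eLpNorm (fun x => ψ k x - v x) 2 (volume.restrict (box lo hi))
        + eLpNorm (fun x => pderiv i (ψ k) x - w x) 2 (volume.restrict (box lo hi))))
      atTop (𝓝 (ENNReal.ofReal K * (0 + 0))) :=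
    ENNReal.Tendsto.const_mul (hv.tendsto.add hw.tendsto) (Or.inr ENNReal.ofReal_ne_top)
  rw [add_zero, mul_zero] at hb
  refine exists_L2Lim_of_le (fun k => memLp_face (hψ k).continuous i c) hb fun k l => ?_
  have h := hK (fun x => ψ k x - ψ l x) ((hψ k).sub (hψ l)) c hc
  refine h.trans ?_
  rw [← mul_add]
  refine mul_le_mul_right ?_ _
  have tri : ∀ {f : ℕ → (Fin (m + 1) → ℝ) → ℝ} {f₀ : (Fin (m + 1) → ℝ) → ℝ},
      L2Lim (volume.restrict (box lo hi)) f f₀ →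
      eLpNorm (fun x => f k x - f l x) 2 (volume.restrict (box lo hi))
        ≤ eLpNorm (fun x => f k x - f₀ x) 2 (volume.restrict (box lo hi))
          + eLpNorm (fun x => f l x - f₀ x) 2 (volume.restrict (box lo hi)) := fun {f f₀} hf => by
    have h1 := eLpNorm_sub_le ((hf.memLp k).sub hf.memLp_lim).1 ((hf.memLp l).sub hf.memLp_lim).1
      one_le_two
    refine le_trans (le_of_eq ?_) h1
    congr 1; ext x; simp
  have e : pderiv i (fun x => ψ k x - ψ l x) = fun x => pderiv i (ψ k) x - pderiv i (ψ l) x :=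
    funext fun x => pderiv_sub ((hψ k).differentiable (by simp))
      ((hψ l).differentiable (by simp)) i x
  rw [e]
  calc _ ≤ _ := add_le_add (tri hv) (tri hw)
    _ = _ := by abel

/-- The trace on a face does not depend on the approximating sequence. -/
theorem L2Lim.trace_of_trace (hlt : ∀ i, lo i < hi i) {ψ ψ' : ℕ → (Fin (m + 1) → ℝ) → ℝ}
    {v w : (Fin (m + 1) → ℝ) → ℝ} (hψ : ∀ k, ContDiff ℝ ∞ (ψ k)) (hψ' : ∀ k, ContDiff ℝ ∞ (ψ' k))
    {i : Fin (m + 1)}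
    (hv : L2Lim (volume.restrict (box lo hi)) ψ v)
    (hw : L2Lim (volume.restrict (box lo hi)) (fun k => pderiv i (ψ k)) w)
    (hv' : L2Lim (volume.restrict (box lo hi)) ψ' v)
    (hw' : L2Lim (volume.restrict (box lo hi)) (fun k => pderiv i (ψ' k)) w)
    {c : ℝ} (hc : c = lo i ∨ c = hi i) {T : (Fin m → ℝ) → ℝ}
    (hT : L2Lim (volume.restrict (faceBox lo hi i)) (fun k y => ψ' k (i.insertNth c y)) T) :
    L2Lim (volume.restrict (faceBox lo hi i)) (fun k y => ψ k (i.insertNth c y)) T := by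
  obtain ⟨K, hK⟩ := exists_eLpNorm_face_le hlt i
  have hdv := hv.sub hv'
  have hdw := hw.sub hw'
  have e : ∀ k, pderiv i (fun x => ψ k x - ψ' k x)
      = fun x => pderiv i (ψ k) x - pderiv i (ψ' k) x := fun k =>
    funext fun x => pderiv_sub ((hψ k).differentiable (by simp))
      ((hψ' k).differentiable (by simp)) i x
  have hdiff : L2Lim (volume.restrict (faceBox lo hi i))
      (fun k y => ψ k (i.insertNth c y) - ψ' k (i.insertNth c y)) (fun _ => 0) := by
    refine ⟨fun k => (memLp_face (hψ k).continuous i c).sub (memLp_face (hψ' k).continuous i c),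
      MemLp.zero', ?_⟩
    have hb : Tendsto (fun k => ENNReal.ofReal K *
        (eLpNorm (fun x => ψ k x - ψ' k x - (v x - v x)) 2 (volume.restrict (box lo hi))
          + eLpNorm (fun x => pderiv i (ψ k) x - pderiv i (ψ' k) x - (w x - w x)) 2
            (volume.restrict (box lo hi)))) atTop (𝓝 (ENNReal.ofReal K * (0 + 0))) :=
      ENNReal.Tendsto.const_mul (hdv.tendsto.add hdw.tendsto) (Or.inr ENNReal.ofReal_ne_top)
    rw [add_zero, mul_zero] at hb
    refine tendsto_of_tendsto_of_tendsto_of_le_of_le tendsto_const_nhds hb (fun _ => zero_le)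
      fun k => ?_
    have h := hK (fun x => ψ k x - ψ' k x) ((hψ k).sub (hψ' k)) c hc
    rw [e k] at h
    simpa using h
  simpa using hdiff.add hT

/-- Smooth functions that tend to `u` in `H²` of a box, with weak gradient `g` and Hessian `h`. -/
structure SmoothApprox (lo hi : Fin (m + 1) → ℝ) (φ : ℕ → (Fin (m + 1) → ℝ) → ℝ)
    (u : (Fin (m + 1) → ℝ) → ℝ) (g : Fin (m + 1) → (Fin (m + 1) → ℝ) → ℝ)
    (h : Fin (m + 1) → Fin (m + 1) → (Fin (m + 1) → ℝ) → ℝ) : Prop where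
  contDiff : ∀ k, ContDiff ℝ ∞ (φ k)
  lim : L2Lim (volume.restrict (box lo hi)) φ u
  lim_grad : ∀ i, L2Lim (volume.restrict (box lo hi)) (fun k => pderiv i (φ k)) (g i)
  lim_hess : ∀ i j, L2Lim (volume.restrict (box lo hi))
    (fun k => pderiv j (pderiv i (φ k))) (h i j)

/-- The definition of trace provides some H¹-approximating sequence. This transfers its conclusion
to the one fixed sequence that converges in H² and is used for all faces at once. -/
theorem SmoothApprox.trace_of_isTrace (hlt : ∀ i, lo i < hi i) {φ : ℕ → (Fin (m + 1) → ℝ) → ℝ}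
    {u : (Fin (m + 1) → ℝ) → ℝ} {g : Fin (m + 1) → (Fin (m + 1) → ℝ) → ℝ}
    {h : Fin (m + 1) → Fin (m + 1) → (Fin (m + 1) → ℝ) → ℝ} (hφ : SmoothApprox lo hi φ u g h)
    {i : Fin (m + 1)} {c : ℝ} (hc : c = lo i ∨ c = hi i) {T : (Fin m → ℝ) → ℝ}
    (hT : IsTrace lo hi u g i c T) :
    L2Lim (volume.restrict (faceBox lo hi i)) (fun k y => φ k (i.insertNth c y)) T := by
  obtain ⟨hT1, ψ, hψ, hψu, hψg, hψT⟩ := hT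
  exact L2Lim.trace_of_trace hlt hφ.contDiff hψ hφ.lim (hφ.lim_grad i)
    ⟨fun k => memLp_box (hψ k).continuous lo hi, hφ.lim.memLp_lim, hψu⟩
    ⟨fun k => memLp_box (contDiff_pderiv (hψ k) i).continuous lo hi, (hφ.lim_grad i).memLp_lim,
      hψg i⟩ hc ⟨fun k => memLp_face (hψ k).continuous i c, hT1, hψT⟩

theorem setIntegral_mul_pderiv {U : Set (Fin m → ℝ)}
    {ψ θ : (Fin m → ℝ) → ℝ} (hψ : ContDiff ℝ ∞ ψ) (hθ : ContDiff ℝ ∞ θ) (hθc : HasCompactSupport θ)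
    (hθU : tsupport θ ⊆ U) (j : Fin m) :
    ∫ y in U, ψ y * pderiv j θ y = -∫ y in U, pderiv j ψ y * θ y := by
  have hθ' := contDiff_pderiv hθ j
  have hψ' := contDiff_pderiv hψ j
  have s1 : ∀ y, y ∉ U → θ y = 0 := fun y hy =>
    image_eq_zero_of_notMem_tsupport fun h => hy (hθU h)
  have s2 : ∀ y, y ∉ U → pderiv j θ y = 0 := fun y hy => by
    have hy' : y ∉ tsupport θ := fun h => hy (hθU h)
    have : fderiv ℝ θ y = 0 := image_eq_zero_of_notMem_tsupport
      fun h => hy' (tsupport_fderiv_subset ℝ h)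
    simp [pderiv, this]
  rw [setIntegral_eq_integral_of_forall_compl_eq_zero (fun y hy => by rw [s2 y hy, mul_zero]),
    setIntegral_eq_integral_of_forall_compl_eq_zero (fun y hy => by rw [s1 y hy, mul_zero])]
  have hθ'c := hasCompactSupport_pderiv hθc j
  exact integral_mul_fderiv_eq_neg_fderiv_mul_of_integrable
    ((hψ'.continuous.mul hθ.continuous).integrable_of_hasCompactSupport hθc.mul_left)
    ((hψ.continuous.mul hθ'.continuous).integrable_of_hasCompactSupport hθ'c.mul_left)
    ((hψ.continuous.mul hθ.continuous).integrable_of_hasCompactSupport hθc.mul_left)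
    (fun x _ => hψ.differentiable (by simp) x) (fun x _ => hθ.differentiable (by simp) x)

/-- The trace of a tangential derivative is the weak derivative of the trace. -/
theorem isWeakDeriv_trace {φ : ℕ → (Fin (m + 1) → ℝ) → ℝ} (hφ : ∀ k, ContDiff ℝ ∞ (φ k))
    {i : Fin (m + 1)} {c : ℝ} {j : Fin m} {T S : (Fin m → ℝ) → ℝ}
    (hT : L2Lim (volume.restrict (faceBox lo hi i)) (fun k y => φ k (i.insertNth c y)) T)
    (hS : L2Lim (volume.restrict (faceBox lo hi i))
      (fun k y => pderiv (i.succAbove j) (φ k) (i.insertNth c y)) S) :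
    IsWeakDeriv (faceBox lo hi i) j T S := by
  intro θ hθ hθc hθU
  have h1 := (hT.mul (L2Lim.const (memLp_box (contDiff_pderiv hθ j).continuous _ _))).tendsto
  have h2 := (hS.mul (L2Lim.const (memLp_box hθ.continuous _ _))).tendsto
  refine tendsto_nhds_unique h1 (h2.neg.congr fun k => ?_)
  have hψ : ContDiff ℝ ∞ fun y => φ k (i.insertNth c y) := (hφ k).comp (contDiff_insertNth i c)
  have h := setIntegral_mul_pderiv hψ hθ hθc hθU j
  simp only [pderiv_insertNth ((hφ k).differentiable (by simp))] at h
  exact h.symm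

/-- If the trace vanishes, so do the traces of the tangential derivatives. -/
theorem tangential_trace_zero (hlt : ∀ i, lo i < hi i) {φ : ℕ → (Fin (m + 1) → ℝ) → ℝ}
    {u : (Fin (m + 1) → ℝ) → ℝ} {g : Fin (m + 1) → (Fin (m + 1) → ℝ) → ℝ}
    {h : Fin (m + 1) → Fin (m + 1) → (Fin (m + 1) → ℝ) → ℝ} (hφ : SmoothApprox lo hi φ u g h)
    {i : Fin (m + 1)} {c : ℝ} (hc : c = lo i ∨ c = hi i)
    (hT : L2Lim (volume.restrict (faceBox lo hi i)) (fun k y => φ k (i.insertNth c y)) 0)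
    (j : Fin m) :
    L2Lim (volume.restrict (faceBox lo hi i))
      (fun k y => pderiv (i.succAbove j) (φ k) (i.insertNth c y)) 0 := by
  obtain ⟨S, hS⟩ := exists_trace hlt (fun k => contDiff_pderiv (hφ.contDiff k) (i.succAbove j))
    (hφ.lim_grad (i.succAbove j)) (hφ.lim_hess (i.succAbove j) i) hc
  refine hS.congr_lim ?_
  -- The limit S exists by the H² bound; being the weak derivative of the zero trace, it vanishes by
  -- the fundamental lemma of the calculus of variations.
  have hw := isWeakDeriv_trace hφ.contDiff hT hS
  have hloc : LocallyIntegrableOn S (faceBox lo hi i) volume :=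
    IntegrableOn.locallyIntegrableOn (hS.memLp_lim.integrable one_le_two)
  have h0 := (isOpen_box _ _).ae_eq_zero_of_integral_contDiff_smul_eq_zero hloc
    fun θ hθ hθc hθU => by
      have h1 := hw θ hθ hθc hθU
      simp only [Pi.zero_apply, zero_mul, integral_zero] at h1
      have s1 : ∀ y, y ∉ faceBox lo hi i → θ y • S y = 0 := fun y hy => by
        rw [image_eq_zero_of_notMem_tsupport fun h => hy (hθU h), zero_smul]
      rw [← setIntegral_eq_integral_of_forall_compl_eq_zero s1]
      simp only [smul_eq_mul, mul_comm (θ _)]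
      linarith
  exact (ae_restrict_iff' (measurableSet_box _ _)).2 h0

/-- If `u` and its `i`-th derivative have zero trace on the two faces orthogonal to a tangential
direction of the face `x_i = hi i`, the trace of `u` on this face can be integrated by parts in this
direction without boundary terms, as its extension by zero. -/
theorem integral_trace_mul_pderiv (hlt : ∀ i, lo i < hi i) {φ : ℕ → (Fin (m + 1) → ℝ) → ℝ}
    (hφ : ∀ k, ContDiff ℝ ∞ (φ k)) {i : Fin (m + 1)} {j : Fin m} {T S : (Fin m → ℝ) → ℝ}
    (hT : L2Lim (volume.restrict (faceBox lo hi i)) (fun k y => φ k (i.insertNth (hi i) y)) T)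
    (hS : L2Lim (volume.restrict (faceBox lo hi i))
      (fun k y => pderiv (i.succAbove j) (φ k) (i.insertNth (hi i) y)) S)
    (hside : ∀ c, c = lo (i.succAbove j) ∨ c = hi (i.succAbove j) →
      L2Lim (volume.restrict (faceBox lo hi (i.succAbove j)))
        (fun k y => φ k ((i.succAbove j).insertNth c y)) 0 ∧
      L2Lim (volume.restrict (faceBox lo hi (i.succAbove j)))
        (fun k y => pderiv i (φ k) ((i.succAbove j).insertNth c y)) 0)
    {θ : (Fin m → ℝ) → ℝ} (hθ : ContDiff ℝ ∞ θ) :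
    ∫ y in faceBox lo hi i, T y * pderiv j θ y = -∫ y in faceBox lo hi i, S y * θ y := by
  set l := i.succAbove j with hl
  -- θ is extended to the box by a factor that is 1 on the face x_i = hi i and 0 on the opposite
  -- one, so that the latter contributes nothing.
  set Θ : (Fin (m + 1) → ℝ) → ℝ := fun x =>
    θ (fun j => x (i.succAbove j)) * ((x i - lo i) * (hi i - lo i)⁻¹) with hΘ
  have hd : hi i - lo i ≠ 0 := (sub_pos.2 (hlt i)).ne'
  have hΘc : ContDiff ℝ ∞ Θ :=
    (hθ.comp (contDiff_pi.2 fun j => contDiff_apply ℝ ℝ (i.succAbove j))).mul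
      (((contDiff_apply ℝ ℝ i).sub contDiff_const).mul contDiff_const)
  have hΘtop : ∀ y, Θ (i.insertNth (hi i) y) = θ y := fun y => by simp [hΘ, hd]
  have hΘbot : ∀ y, Θ (i.insertNth (lo i) y) = 0 := fun y => by simp [hΘ]
  set f : ℕ → (Fin (m + 1) → ℝ) → ℝ := fun k x => φ k x * Θ x with hf
  have hfc : ∀ k, ContDiff ℝ ∞ (f k) := fun k => (hφ k).mul hΘc
  have hfd : ∀ k, Differentiable ℝ (f k) := fun k => (hfc k).differentiable (by simp)
  have hφd : ∀ k, Differentiable ℝ (φ k) := fun k => (hφ k).differentiable (by simp)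
  have hΘd : Differentiable ℝ Θ := hΘc.differentiable (by simp)
  have htop : ∀ k y, pderiv l (f k) (i.insertNth (hi i) y)
      = φ k (i.insertNth (hi i) y) * pderiv j θ y
        + pderiv l (φ k) (i.insertNth (hi i) y) * θ y := fun k y => by
    rw [hf, pderiv_mul (hφd k) hΘd, hΘtop, ← pderiv_insertNth hΘd]
    simp only [hΘtop]
    ring
  have hbot : ∀ k y, pderiv l (f k) (i.insertNth (lo i) y) = 0 := fun k y => by
    rw [← pderiv_insertNth (hfd k)]
    simp [hf, hΘbot, pderiv]
  have hsd : ∀ k x, pderiv i (f k) x = pderiv i Θ x * φ k x + Θ x * pderiv i (φ k) x :=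
    fun k x => by rw [hf, pderiv_mul (hφd k) hΘd]; ring
  -- The integral of ∂_i∂_l(φΘ) over the box is evaluated in both orders. Integrating first in x_i
  -- gives the top face, first in x_l the two side faces. No traces on edges are needed.
  have hflux : ∀ k, (∫ y in faceBox lo hi i, φ k (i.insertNth (hi i) y) * pderiv j θ y)
        + (∫ y in faceBox lo hi i, pderiv l (φ k) (i.insertNth (hi i) y) * θ y)
      = (∫ y in faceBox lo hi l, pderiv i (f k) (l.insertNth (hi l) y))
        - ∫ y in faceBox lo hi l, pderiv i (f k) (l.insertNth (lo l) y) := fun k => by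
    have h1 := integral_pderiv_box hlt ((contDiff_pderiv (hfc k) l).of_le (by simp)) i
    have h2 := integral_pderiv_box hlt ((contDiff_pderiv (hfc k) i).of_le (by simp)) l
    simp only [pderiv_comm (hfc k) l i] at h2
    rw [h2] at h1
    simp only [htop, hbot, integral_zero, sub_zero] at h1
    rw [h1, integral_add]
    · exact integrable_box (((hφ k).continuous.comp (continuous_insertNth i _)).mul
        (contDiff_pderiv hθ j).continuous) _ _
    · exact integrable_box (((contDiff_pderiv (hφ k) l).continuous.comp
        (continuous_insertNth i _)).mul hθ.continuous) _ _
  have hsides : ∀ c, c = lo l ∨ c = hi l → Tendsto (fun k =>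
      ∫ y in faceBox lo hi l, pderiv i (f k) (l.insertNth c y)) atTop (𝓝 0) := fun c hc => by
    obtain ⟨h1, h2⟩ := hside c hc
    have h3 := ((h1.continuous_mul ((contDiff_pderiv hΘc i).continuous.comp
      (continuous_insertNth l c))).add (h2.continuous_mul (hΘc.continuous.comp
      (continuous_insertNth l c)))).intLim.tendsto
    simpa [hsd, faceBox] using h3
  have hlim := (hsides (hi l) (Or.inr rfl)).sub (hsides (lo l) (Or.inl rfl))
  have hlim2 := (hT.mul (L2Lim.const
      (memLp_box (contDiff_pderiv hθ j).continuous _ _))).tendsto.add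
    (hS.mul (L2Lim.const (memLp_box hθ.continuous _ _))).tendsto
  have := tendsto_nhds_unique hlim2 (hlim.congr fun k => (hflux k).symm)
  linarith

end Traces


/-! ### The pointwise identity for the conjugated operator -/

section Identity

variable {m : ℕ} (z : Fin (m + 1)) (lam : ℝ)

/-- The flux in the Carleman identity for the conjugated function `v = e^{λ z²} φ`. -/
noncomputable def carlemanFlux (v : (Fin (m + 1) → ℝ) → ℝ) (i : Fin (m + 1))
    (x : Fin (m + 1) → ℝ) : ℝ :=
  -8 * lam * ((x z * pderiv z v x + v x) * pderiv i v x)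
    + if i = z then x z * (4 * lam * ∑ j, pderiv j v x ^ 2)
      - (16 * lam ^ 3 * x z ^ 3 + 8 * lam ^ 2 * x z) * v x ^ 2 else 0

theorem contDiff_carlemanFlux {v : (Fin (m + 1) → ℝ) → ℝ} (hv : ContDiff ℝ ∞ v)
    (i : Fin (m + 1)) : ContDiff ℝ ∞ (carlemanFlux z lam v i) := by
  have hz : ContDiff ℝ ∞ fun x : Fin (m + 1) → ℝ => x z := contDiff_apply ℝ ℝ z
  have hp : ∀ j, ContDiff ℝ ∞ (pderiv j v) := contDiff_pderiv hv
  refine ContDiff.add (contDiff_const.mul (((hz.mul (hp z)).add hv).mul (hp i))) ?_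
  split_ifs
  · exact (hz.mul (contDiff_const.mul (ContDiff.sum fun j _ => (hp j).pow 2))).sub
      (((contDiff_const.mul (hz.pow 3)).add (contDiff_const.mul hz)).mul (hv.pow 2))
  · exact contDiff_const

/-- The flux is designed so that the third-order cancellations of a Rellich identity take place: the
terms ∂_i v ∂_z∂_i v from the multiplier z v_z cancel against z ∂_z|∇v|²; no mixed second
derivatives remain. -/
theorem sum_pderiv_carlemanFlux {v : (Fin (m + 1) → ℝ) → ℝ} (hv : ContDiff ℝ ∞ v)
    (x : Fin (m + 1) → ℝ) :
    ∑ i, pderiv i (carlemanFlux z lam v i) x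
      = -8 * lam * (x z * pderiv z v x + v x) * (∑ i, pderiv i (pderiv i v) x)
        - 8 * lam * pderiv z v x ^ 2 - 4 * lam * ∑ i, pderiv i v x ^ 2
        - (48 * lam ^ 3 * x z ^ 2 + 8 * lam ^ 2) * v x ^ 2
        - (32 * lam ^ 3 * x z ^ 3 + 16 * lam ^ 2 * x z) * (v x * pderiv z v x) := by
  have dz : Differentiable ℝ fun x : Fin (m + 1) → ℝ => x z := differentiable_apply z
  have dv : Differentiable ℝ v := hv.differentiable (by simp)
  have dp : ∀ j, Differentiable ℝ (pderiv j v) := fun j =>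
    (contDiff_pderiv hv j).differentiable (by simp)
  have d1 : Differentiable ℝ fun x => x z * pderiv z v x := dz.mul (dp z)
  have d2 : Differentiable ℝ fun x => x z * pderiv z v x + v x := d1.add dv
  have d3 : ∀ i, Differentiable ℝ fun x => (x z * pderiv z v x + v x) * pderiv i v x :=
    fun i => d2.mul (dp i)
  have d4 : ∀ j, Differentiable ℝ fun x => pderiv j v x ^ 2 := fun j => (dp j).pow 2
  have d5 : Differentiable ℝ fun x => ∑ j, pderiv j v x ^ 2 :=
    Differentiable.fun_sum fun j _ => d4 j
  have d6 : Differentiable ℝ fun x => 4 * lam * ∑ j, pderiv j v x ^ 2 := d5.const_mul _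
  have d7 : Differentiable ℝ fun x => x z * (4 * lam * ∑ j, pderiv j v x ^ 2) := dz.mul d6
  have d8 : Differentiable ℝ fun x : Fin (m + 1) → ℝ =>
      16 * lam ^ 3 * x z ^ 3 + 8 * lam ^ 2 * x z :=
    ((dz.pow 3).const_mul _).add (dz.const_mul _)
  have d9 : Differentiable ℝ fun x => v x ^ 2 := dv.pow 2
  have d10 : Differentiable ℝ fun x : Fin (m + 1) → ℝ => x z ^ 3 := dz.pow 3
  have d11 : Differentiable ℝ fun x : Fin (m + 1) → ℝ => 16 * lam ^ 3 * x z ^ 3 := d10.const_mul _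
  have d12 : Differentiable ℝ fun x : Fin (m + 1) → ℝ => 8 * lam ^ 2 * x z := dz.const_mul _
  have d13 : Differentiable ℝ fun x =>
      (16 * lam ^ 3 * x z ^ 3 + 8 * lam ^ 2 * x z) * v x ^ 2 := d8.mul d9
  have d14 : Differentiable ℝ fun x => x z * (4 * lam * ∑ j, pderiv j v x ^ 2)
      - (16 * lam ^ 3 * x z ^ 3 + 8 * lam ^ 2 * x z) * v x ^ 2 := d7.sub d13
  have psq : ∀ {f : (Fin (m + 1) → ℝ) → ℝ}, Differentiable ℝ f → ∀ i,
      pderiv i (fun x => f x ^ 2) x = 2 * (f x * pderiv i f x) := fun {f} hf i => by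
    simp only [pow_two]
    rw [pderiv_mul hf hf]; ring
  have e1 : ∀ i, pderiv i (fun x => -8 * lam * ((x z * pderiv z v x + v x) * pderiv i v x)) x
      = -8 * lam * ((x z * pderiv z v x + v x) * pderiv i (pderiv i v) x
        + pderiv i v x * (x z * pderiv z (pderiv i v) x
          + pderiv z v x * (if i = z then 1 else 0) + pderiv i v x)) := fun i => by
    rw [pderiv_const_mul (d3 i), pderiv_mul d2 (dp i), pderiv_add d1 dv, pderiv_mul dz (dp z),
      pderiv_apply, pderiv_comm hv i z]
  have e2 : pderiv z (fun x => x z * (4 * lam * ∑ j, pderiv j v x ^ 2)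
      - (16 * lam ^ 3 * x z ^ 3 + 8 * lam ^ 2 * x z) * v x ^ 2) x
      = x z * (4 * lam * ∑ j, 2 * (pderiv j v x * pderiv z (pderiv j v) x))
        + 4 * lam * (∑ j, pderiv j v x ^ 2)
        - ((16 * lam ^ 3 * x z ^ 3 + 8 * lam ^ 2 * x z) * (2 * (v x * pderiv z v x))
          + v x ^ 2 * (48 * lam ^ 3 * x z ^ 2 + 8 * lam ^ 2)) := by
    have e3 : pderiv z (fun x : Fin (m + 1) → ℝ =>
        16 * lam ^ 3 * x z ^ 3 + 8 * lam ^ 2 * x z) x = 48 * lam ^ 3 * x z ^ 2 + 8 * lam ^ 2 := by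
      rw [pderiv_add d11 d12, pderiv_const_mul d10,
        pderiv_const_mul dz, pderiv_apply,
        pderiv_comp_apply (g := fun t => t ^ 3) (differentiable_pow 3)]
      simp
      ring
    rw [pderiv_sub d7 d13, pderiv_mul dz d6, pderiv_mul d8 d9, pderiv_const_mul d5,
      pderiv_sum _ fun j _ => d4 j, pderiv_apply, psq dv, e3]
    simp only [psq (dp _), if_true]
    ring
  have e4 : ∀ i, pderiv i (carlemanFlux z lam v i) x
      = -8 * lam * ((x z * pderiv z v x + v x) * pderiv i (pderiv i v) x
        + pderiv i v x * (x z * pderiv z (pderiv i v) x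
          + pderiv z v x * (if i = z then 1 else 0) + pderiv i v x))
        + if i = z then x z * (4 * lam * ∑ j, 2 * (pderiv j v x * pderiv z (pderiv j v) x))
        + 4 * lam * (∑ j, pderiv j v x ^ 2)
        - ((16 * lam ^ 3 * x z ^ 3 + 8 * lam ^ 2 * x z) * (2 * (v x * pderiv z v x))
          + v x ^ 2 * (48 * lam ^ 3 * x z ^ 2 + 8 * lam ^ 2)) else 0 := fun i => by
    rw [← e1]
    by_cases hi : i = z
    · subst hi
      simp only [if_true]
      rw [← e2]
      have := pderiv_add ((d3 i).const_mul (-8 * lam)) d14 i x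
      rw [← this]
      congr 1
      ext y
      simp [carlemanFlux]
    · simp only [if_neg hi, add_zero]
      congr 1
      ext y
      simp [carlemanFlux, hi]
  simp only [e4, Finset.sum_add_distrib, Finset.sum_ite_eq', Finset.mem_univ, if_true]
  have s1 : ∀ i, -8 * lam * ((x z * pderiv z v x + v x) * pderiv i (pderiv i v) x
        + pderiv i v x * (x z * pderiv z (pderiv i v) x
          + pderiv z v x * (if i = z then 1 else 0) + pderiv i v x))
      = -8 * lam * (x z * pderiv z v x + v x) * pderiv i (pderiv i v) x
        + (-4 * lam * x z) * (2 * (pderiv i v x * pderiv z (pderiv i v) x))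
        + (-8 * lam) * pderiv i v x ^ 2
        + (if i = z then -8 * lam * (pderiv i v x * pderiv z v x) else 0) := fun i => by
    split_ifs <;> ring
  simp only [s1, Finset.sum_add_distrib, Finset.sum_ite_eq', Finset.mem_univ, if_true,
    ← Finset.mul_sum]
  ring

/-- The multiplier z v_z + βv produces λ(8β - 4)|∇v|² and λ³(48 - 32β)z²v². The skew-adjoint choice
β = 1/2 would lose the full gradient; β = 1 keeps both coefficients positive. -/
theorem sq_ge_carlemanFlux {v : (Fin (m + 1) → ℝ) → ℝ} (hv : ContDiff ℝ ∞ v)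
    (x : Fin (m + 1) → ℝ) :
    ∑ i, pderiv i (carlemanFlux z lam v i) x + 8 * lam * pderiv z v x ^ 2
        + 4 * lam * (∑ i, pderiv i v x ^ 2) + (16 * lam ^ 3 * x z ^ 2 - 8 * lam ^ 2) * v x ^ 2
      ≤ ((∑ i, pderiv i (pderiv i v) x) - 4 * lam * x z * pderiv z v x
        + (4 * lam ^ 2 * x z ^ 2 - 2 * lam) * v x) ^ 2 := by
  rw [sum_pderiv_carlemanFlux z lam hv]
  -- The squares of the two parts of the operator; their double product is the divergence plus the
  -- quadratic form.
  have h1 := sq_nonneg ((∑ i, pderiv i (pderiv i v) x) + 4 * lam ^ 2 * x z ^ 2 * v x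
    + 2 * lam * v x)
  have h2 := sq_nonneg (4 * lam * x z * pderiv z v x + 4 * lam * v x)
  linear_combination h1 + h2

end Identity

/-! ### Return from v to u: the pointwise Carleman inequality -/

section Conjugation

variable {m : ℕ} (z : Fin (m + 1)) (lam : ℝ)

/-- The conjugated function `e^{λ z²} φ`. -/
noncomputable def conjugate (φ : (Fin (m + 1) → ℝ) → ℝ) (x : Fin (m + 1) → ℝ) : ℝ :=
  Real.exp (lam * x z ^ 2) * φ x

theorem contDiff_weight : ContDiff ℝ ∞ fun x : Fin (m + 1) → ℝ => Real.exp (lam * x z ^ 2) :=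
  (contDiff_const.mul ((contDiff_apply ℝ ℝ z).pow 2)).exp

theorem contDiff_conjugate {φ : (Fin (m + 1) → ℝ) → ℝ} (hφ : ContDiff ℝ ∞ φ) :
    ContDiff ℝ ∞ (conjugate z lam φ) := (contDiff_weight z lam).mul hφ

theorem pderiv_weight (i : Fin (m + 1)) (x : Fin (m + 1) → ℝ) :
    pderiv i (fun x : Fin (m + 1) → ℝ => Real.exp (lam * x z ^ 2)) x
      = Real.exp (lam * x z ^ 2) * if i = z then 2 * lam * x z else 0 := by
  have hd : Differentiable ℝ fun t : ℝ => Real.exp (lam * t ^ 2) := by fun_prop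
  rw [pderiv_comp_apply (g := fun t => Real.exp (lam * t ^ 2)) hd]
  split_ifs
  · have h : HasDerivAt (fun t : ℝ => Real.exp (lam * t ^ 2)) _ (x z) :=
      (((hasDerivAt_pow 2 (x z)).const_mul lam)).exp
    rw [h.deriv]
    push_cast
    ring
  · simp

theorem pderiv_conjugate {φ : (Fin (m + 1) → ℝ) → ℝ} (hφ : Differentiable ℝ φ) (i : Fin (m + 1))
    (x : Fin (m + 1) → ℝ) : pderiv i (conjugate z lam φ) x
      = Real.exp (lam * x z ^ 2) * (pderiv i φ x + if i = z then 2 * lam * x z * φ x else 0) := by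
  have h := pderiv_mul ((contDiff_weight z lam).differentiable (by simp)) hφ i x
  rw [pderiv_weight] at h
  refine h.trans ?_
  split_ifs <;> ring

theorem pderiv_pderiv_conjugate {φ : (Fin (m + 1) → ℝ) → ℝ} (hφ : ContDiff ℝ ∞ φ)
    (i : Fin (m + 1)) (x : Fin (m + 1) → ℝ) : pderiv i (pderiv i (conjugate z lam φ)) x
      = Real.exp (lam * x z ^ 2) * (pderiv i (pderiv i φ) x + if i = z then
        4 * lam * x z * pderiv i φ x + (2 * lam + 4 * lam ^ 2 * x z ^ 2) * φ x else 0) := by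
  have dφ : Differentiable ℝ φ := hφ.differentiable (by simp)
  have dp : Differentiable ℝ (pderiv i φ) := (contDiff_pderiv hφ i).differentiable (by simp)
  have dw : Differentiable ℝ fun x : Fin (m + 1) → ℝ => Real.exp (lam * x z ^ 2) :=
    (contDiff_weight z lam).differentiable (by simp)
  have dz : Differentiable ℝ fun x : Fin (m + 1) → ℝ => x z := differentiable_apply z
  have dz2 : Differentiable ℝ fun x : Fin (m + 1) → ℝ => 2 * lam * x z := dz.const_mul _
  have d3 : Differentiable ℝ fun x => 2 * lam * x z * φ x := dz2.mul dφ
  have d4 : Differentiable ℝ fun x => pderiv i φ x + 2 * lam * x z * φ x := dp.add d3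
  by_cases hi : i = z
  · subst hi
    have e : pderiv i (conjugate i lam φ)
        = fun x => Real.exp (lam * x i ^ 2) * (pderiv i φ x + 2 * lam * x i * φ x) :=
      funext fun x => by rw [pderiv_conjugate i lam dφ]; simp
    rw [e, pderiv_mul dw d4, pderiv_add dp d3, pderiv_mul dz2 dφ,
      pderiv_const_mul dz, pderiv_apply, pderiv_weight]
    simp only [if_true]
    ring
  · have e : pderiv i (conjugate z lam φ)
        = fun x => Real.exp (lam * x z ^ 2) * pderiv i φ x :=
      funext fun x => by rw [pderiv_conjugate z lam dφ]; simp [hi]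
    rw [e, pderiv_mul dw dp, pderiv_weight]
    simp [hi]

/-- The pointwise Carleman inequality. -/
theorem pointwise_carleman {φ : (Fin (m + 1) → ℝ) → ℝ} (hφ : ContDiff ℝ ∞ φ)
    {x : Fin (m + 1) → ℝ} {a c : ℝ} (hl : 0 < lam) (ha : 0 < a) (hax : a ≤ x z)
    (hla : 1 ≤ lam * a ^ 2) (hc1 : c ≤ 1 / 2) (hc2 : c ≤ a ^ 2) :
    ∑ i, pderiv i (carlemanFlux z lam (conjugate z lam φ) i) x
        + c * ((lam * (∑ i, pderiv i φ x ^ 2) + lam ^ 3 * φ x ^ 2)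
          * Real.exp (2 * lam * x z ^ 2))
      ≤ (∑ i, pderiv i (pderiv i φ) x) ^ 2 * Real.exp (2 * lam * x z ^ 2) := by
  have dφ : Differentiable ℝ φ := hφ.differentiable (by simp)
  have h := sq_ge_carlemanFlux z lam (contDiff_conjugate z lam hφ) x
  set W := Real.exp (lam * x z ^ 2) with hW
  have hW2 : Real.exp (2 * lam * x z ^ 2) = W ^ 2 := by
    rw [hW, ← Real.exp_nat_mul]; congr 1; push_cast; ring
  have hv : conjugate z lam φ x = W * φ x := rfl
  have hL : (∑ i, pderiv i (pderiv i (conjugate z lam φ)) x)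
      - 4 * lam * x z * pderiv z (conjugate z lam φ) x
      + (4 * lam ^ 2 * x z ^ 2 - 2 * lam) * conjugate z lam φ x
      = W * ∑ i, pderiv i (pderiv i φ) x := by
    simp only [pderiv_pderiv_conjugate z lam hφ, pderiv_conjugate z lam dφ, ← Finset.mul_sum,
      Finset.sum_add_distrib, Finset.sum_ite_eq', Finset.mem_univ, if_true, hv, ← hW]
    ring
  rw [hL] at h
  set P := pderiv z (conjugate z lam φ) x with hP
  have hPz : P = W * (pderiv z φ x + 2 * lam * x z * φ x) := by
    rw [hP, pderiv_conjugate z lam dφ]; simp [hW]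
  have hgrad : ∑ i, pderiv i (conjugate z lam φ) x ^ 2
      = W ^ 2 * (∑ i, pderiv i φ x ^ 2) + 4 * lam * x z * (W * φ x) * P
        - 4 * lam ^ 2 * x z ^ 2 * (W * φ x) ^ 2 := by
    have s : ∀ i, pderiv i (conjugate z lam φ) x ^ 2 = W ^ 2 * pderiv i φ x ^ 2
        + if i = z then W ^ 2 * (2 * pderiv i φ x * (2 * lam * x z * φ x)
          + (2 * lam * x z * φ x) ^ 2) else 0 := fun i => by
      rw [pderiv_conjugate z lam dφ, ← hW]
      split_ifs <;> ring
    simp only [s, Finset.sum_add_distrib, Finset.sum_ite_eq', Finset.mem_univ, if_true,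
      ← Finset.mul_sum, hPz]
    ring
  rw [hv] at h
  rw [hW2]
  set G := ∑ i, pderiv i (conjugate z lam φ) x ^ 2 with hG
  have hG0 : 0 ≤ G := Finset.sum_nonneg fun i _ => sq_nonneg _
  set V := W * φ x with hV
  set D := ∑ i, pderiv i φ x ^ 2 with hD
  have hZ2 : a ^ 2 ≤ x z ^ 2 := pow_le_pow_left₀ ha.le hax 2
  -- Since λz² ≥ 1, the term -8λ²v² consumes at most half of 16λ³z²v².
  have t1 : lam ^ 2 * V ^ 2 ≤ lam ^ 3 * x z ^ 2 * V ^ 2 := by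
    refine mul_le_mul_of_nonneg_right ?_ (sq_nonneg V)
    have : 1 ≤ lam * x z ^ 2 := hla.trans (mul_le_mul_of_nonneg_left hZ2 hl.le)
    nlinarith [mul_le_mul_of_nonneg_left this (sq_nonneg lam)]
  have t2 : c * (lam ^ 3 * V ^ 2) ≤ lam ^ 3 * x z ^ 2 * V ^ 2 := by
    have h1 : c * (lam ^ 3 * V ^ 2) ≤ x z ^ 2 * (lam ^ 3 * V ^ 2) :=
      mul_le_mul_of_nonneg_right (hc2.trans hZ2) (by positivity)
    linarith
  -- `λ e^{2λz²} |∇φ|² ≤ λ |∇v|² + λ v_z² + 8 λ³ z² v²`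
  have t3 : lam * (W ^ 2 * D) ≤ lam * G + lam * P ^ 2 + 8 * lam ^ 3 * x z ^ 2 * V ^ 2 := by
    have e : W ^ 2 * D = G - 4 * lam * x z * V * P + 4 * lam ^ 2 * x z ^ 2 * V ^ 2 := by
      rw [hgrad]; ring
    have := mul_nonneg hl.le (sq_nonneg (P + 2 * lam * x z * V))
    rw [e]
    linarith
  have hWD : 0 ≤ lam * (W ^ 2 * D) :=
    mul_nonneg hl.le (mul_nonneg (sq_nonneg _) (Finset.sum_nonneg fun i _ => sq_nonneg _))
  have t4 : c * (lam * (W ^ 2 * D)) ≤ 1 / 2 * (lam * (W ^ 2 * D)) :=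
    mul_le_mul_of_nonneg_right hc1 hWD
  have t5 : c * ((lam * D + lam ^ 3 * φ x ^ 2) * W ^ 2)
      = c * (lam * (W ^ 2 * D)) + c * (lam ^ 3 * V ^ 2) := by rw [hV]; ring
  have t6 : (∑ i, pderiv i (pderiv i φ) x) ^ 2 * W ^ 2
      = (W * ∑ i, pderiv i (pderiv i φ) x) ^ 2 := by ring
  rw [t5, t6]
  have g1 := mul_nonneg hl.le hG0
  have g2 := mul_nonneg hl.le (sq_nonneg P)
  have g3 : 0 ≤ lam ^ 3 * x z ^ 2 * V ^ 2 := by positivity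
  linarith

end Conjugation


/-! ### Signs of the flux on the top and bottom faces -/

section Flux

variable {m : ℕ} (z : Fin (m + 1)) (lam : ℝ)

theorem exp_two_mul (lam t : ℝ) : Real.exp (2 * lam * t ^ 2) = Real.exp (lam * t ^ 2) ^ 2 := by
  rw [← Real.exp_nat_mul]; congr 1; push_cast; ring

theorem sum_sq_pderiv_conjugate {φ : (Fin (m + 1) → ℝ) → ℝ} (hφ : Differentiable ℝ φ)
    (x : Fin (m + 1) → ℝ) : ∑ i, pderiv i (conjugate z lam φ) x ^ 2
      = pderiv z (conjugate z lam φ) x ^ 2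
        + Real.exp (lam * x z ^ 2) ^ 2 * ∑ j, pderiv (z.succAbove j) φ x ^ 2 := by
  rw [Fin.sum_univ_succAbove _ z, Finset.mul_sum]
  congr 1
  refine Finset.sum_congr rfl fun j _ => ?_
  rw [pderiv_conjugate z lam hφ]
  simp [Fin.succAbove_ne]
  ring

/-- The tangential gradient enters the outgoing flux as +4λz|∇'v|² and is dropped. The rest is
quadratic in v and v_z = e^{λz²}(φ_z + 2λzφ), whence λ on the normal derivative and λ³ on the
function. -/
theorem carlemanFlux_top_ge {φ : (Fin (m + 1) → ℝ) → ℝ} (hφ : Differentiable ℝ φ)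
    {x : Fin (m + 1) → ℝ} (hl : 1 ≤ lam) (hx : 0 < x z) :
    -((12 + 16 * x z + 32 * x z ^ 2 + 48 * x z ^ 3)
        * (lam * pderiv z φ x ^ 2 + lam ^ 3 * φ x ^ 2) * Real.exp (2 * lam * x z ^ 2))
      ≤ carlemanFlux z lam (conjugate z lam φ) z x := by
  have hl0 : 0 < lam := by linarith
  rw [carlemanFlux, if_pos rfl, sum_sq_pderiv_conjugate z lam hφ, exp_two_mul,
    pderiv_conjugate z lam hφ, if_pos rfl, conjugate]
  set W := Real.exp (lam * x z ^ 2)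
  set b := x z
  set N := pderiv z φ x
  set T := φ x
  set R := ∑ j, pderiv (z.succAbove j) φ x ^ 2
  have hR : 0 ≤ R := Finset.sum_nonneg fun _ _ => sq_nonneg _
  have h1 : 0 ≤ lam * (W * T - W * (N + 2 * lam * b * T)) ^ 2 := by positivity
  have h2 : 0 ≤ (4 * b + 4) * lam * (W * (N - 2 * lam * b * T)) ^ 2 := by positivity
  have h3 : 0 ≤ b * lam * W ^ 2 * R := by positivity
  have h4 : lam ≤ lam ^ 3 := le_self_pow₀ hl (by norm_num)
  have h5 : lam ^ 2 ≤ lam ^ 3 := pow_le_pow_right₀ hl (by norm_num)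
  have h6 := mul_le_mul_of_nonneg_right h4 (sq_nonneg (W * T))
  have h7 := mul_le_mul_of_nonneg_right (mul_le_mul_of_nonneg_left h5 hx.le) (sq_nonneg (W * T))
  have h8 : 0 ≤ (4 + 8 * b + 32 * b ^ 2 + 48 * b ^ 3) * lam * (W * N) ^ 2 := by positivity
  have h9 : 0 ≤ (8 + 8 * b) * lam ^ 3 * (W * T) ^ 2 := by positivity
  nlinarith

/-- The term -4λz v_z² absorbs the cross term -8λ v v_z by completing the square. No normal
derivative remains, only quantities with zero trace on the bottom face. -/
theorem carlemanFlux_bottom_le {φ : (Fin (m + 1) → ℝ) → ℝ} (hφ : Differentiable ℝ φ)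
    {x : Fin (m + 1) → ℝ} (hl : 0 ≤ lam) (hx : 0 < x z) :
    carlemanFlux z lam (conjugate z lam φ) z x
      ≤ (4 * lam / x z * φ x ^ 2 + 4 * lam * x z * ∑ j, pderiv (z.succAbove j) φ x ^ 2)
        * Real.exp (2 * lam * x z ^ 2) := by
  rw [carlemanFlux, if_pos rfl, sum_sq_pderiv_conjugate z lam hφ, exp_two_mul]
  set P := pderiv z (conjugate z lam φ) x
  rw [conjugate]
  set W := Real.exp (lam * x z ^ 2)
  set a := x z with ha
  set V := φ x
  set R := ∑ j, pderiv (z.succAbove j) φ x ^ 2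
  have h1 : 0 ≤ 4 * lam / a * (a * P + W * V) ^ 2 := by positivity
  have h2 : 4 * lam / a * (a * P + W * V) ^ 2
      = 4 * lam * a * P ^ 2 + 8 * lam * P * (W * V) + 4 * lam / a * (W * V) ^ 2 := by
    field_simp
    ring
  have h3 : 0 ≤ (16 * lam ^ 3 * a ^ 3 + 8 * lam ^ 2 * a) * (W * V) ^ 2 := by positivity
  have h4 : (4 * lam / a * V ^ 2 + 4 * lam * a * R) * W ^ 2
      = 4 * lam / a * (W * V) ^ 2 + 4 * lam * a * R * W ^ 2 := by ring
  rw [h4]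
  nlinarith

end Flux

/-! ### The integrated estimate and its passage to H² -/

section Integrated

variable {m : ℕ} {lo hi : Fin (m + 1) → ℝ} (z : Fin (m + 1)) (lam : ℝ)

/-- The Carleman estimate for functions that are smooth up to the boundary. -/
theorem smooth_carleman (hlt : ∀ i, lo i < hi i) (ha : 0 < lo z) (hl : 1 ≤ lam)
    (hla : 1 ≤ lam * lo z ^ 2) {c : ℝ} (hc1 : c ≤ 1 / 2) (hc2 : c ≤ lo z ^ 2)
    {φ : (Fin (m + 1) → ℝ) → ℝ} (hφ : ContDiff ℝ ∞ φ) :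
    c * (∫ x in box lo hi, (lam * (∑ i, pderiv i φ x ^ 2) + lam ^ 3 * φ x ^ 2)
          * Real.exp (2 * lam * x z ^ 2))
      ≤ (∫ x in box lo hi, (∑ i, pderiv i (pderiv i φ) x) ^ 2 * Real.exp (2 * lam * x z ^ 2))
        + (12 + 16 * hi z + 32 * hi z ^ 2 + 48 * hi z ^ 3)
          * (∫ y in faceBox lo hi z, (lam * pderiv z φ (z.insertNth (hi z) y) ^ 2
            + lam ^ 3 * φ (z.insertNth (hi z) y) ^ 2)) * Real.exp (2 * lam * hi z ^ 2)
        + (∫ y in faceBox lo hi z, (4 * lam / lo z * φ (z.insertNth (lo z) y) ^ 2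
            + 4 * lam * lo z * ∑ j, pderiv (z.succAbove j) φ (z.insertNth (lo z) y) ^ 2))
          * Real.exp (2 * lam * lo z ^ 2)
        + ∑ j, ((∫ y in faceBox lo hi (z.succAbove j),
              carlemanFlux z lam (conjugate z lam φ) (z.succAbove j)
                ((z.succAbove j).insertNth (lo (z.succAbove j)) y))
            - ∫ y in faceBox lo hi (z.succAbove j),
              carlemanFlux z lam (conjugate z lam φ) (z.succAbove j)
                ((z.succAbove j).insertNth (hi (z.succAbove j)) y)) := by
  have dφ : Differentiable ℝ φ := hφ.differentiable (by simp)
  have hF := contDiff_carlemanFlux z lam (contDiff_conjugate z lam hφ)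
  have hp : ∀ i, Continuous (pderiv i φ) := fun i => (contDiff_pderiv hφ i).continuous
  have hpp : ∀ i, Continuous (pderiv i (pderiv i φ)) := fun i =>
    (contDiff_pderiv (contDiff_pderiv hφ i) i).continuous
  have hφc := hφ.continuous
  have hdiv := integral_divergence_box hlt fun i => (hF i).of_le (by simp : (1 : WithTop ℕ∞) ≤ ∞)
  rw [Fin.sum_univ_succAbove _ z] at hdiv
  have i1 : Integrable (fun x => ∑ i, pderiv i (carlemanFlux z lam (conjugate z lam φ) i) x)
      (volume.restrict (box lo hi)) :=
    integrable_box (continuous_finsetSum _ fun i _ => (contDiff_pderiv (hF i) i).continuous) _ _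
  have i2 : Integrable (fun x => (lam * (∑ i, pderiv i φ x ^ 2) + lam ^ 3 * φ x ^ 2)
      * Real.exp (2 * lam * x z ^ 2)) (volume.restrict (box lo hi)) :=
    integrable_box (by fun_prop) _ _
  have i3 : Integrable (fun x => (∑ i, pderiv i (pderiv i φ) x) ^ 2
      * Real.exp (2 * lam * x z ^ 2)) (volume.restrict (box lo hi)) :=
    integrable_box (by fun_prop) _ _
  have hbulk : (∫ x in box lo hi, ∑ i, pderiv i (carlemanFlux z lam (conjugate z lam φ) i) x)
      + c * (∫ x in box lo hi, (lam * (∑ i, pderiv i φ x ^ 2) + lam ^ 3 * φ x ^ 2)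
          * Real.exp (2 * lam * x z ^ 2))
      ≤ ∫ x in box lo hi, (∑ i, pderiv i (pderiv i φ) x) ^ 2 * Real.exp (2 * lam * x z ^ 2) := by
    rw [← integral_const_mul, ← integral_add i1 (i2.const_mul c)]
    exact setIntegral_mono_on (i1.add (i2.const_mul c)) i3 (measurableSet_box lo hi) fun x hx =>
      pointwise_carleman z lam hφ (by linarith) ha (mem_box.1 hx z).1.le hla hc1 hc2
  have hins : ∀ c : ℝ, Continuous fun y : Fin m → ℝ => (z.insertNth c y : Fin (m + 1) → ℝ) :=
    continuous_insertNth z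
  have hzb : 0 < hi z := ha.trans (hlt z)
  have htop : -((12 + 16 * hi z + 32 * hi z ^ 2 + 48 * hi z ^ 3)
        * (∫ y in faceBox lo hi z, (lam * pderiv z φ (z.insertNth (hi z) y) ^ 2
          + lam ^ 3 * φ (z.insertNth (hi z) y) ^ 2)) * Real.exp (2 * lam * hi z ^ 2))
      ≤ ∫ y in faceBox lo hi z,
          carlemanFlux z lam (conjugate z lam φ) z (z.insertNth (hi z) y) := by
    rw [← integral_const_mul, ← integral_mul_const, ← integral_neg]
    refine integral_mono ?_ (integrable_box ((hF z).continuous.comp (hins _)) _ _) fun y => ?_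
    · have := hins (hi z)
      refine integrable_box ?_ _ _
      fun_prop
    · simpa using carlemanFlux_top_ge z lam dφ (x := z.insertNth (hi z) y) hl (by simpa using hzb)
  have hbot : (∫ y in faceBox lo hi z,
        carlemanFlux z lam (conjugate z lam φ) z (z.insertNth (lo z) y))
      ≤ (∫ y in faceBox lo hi z, (4 * lam / lo z * φ (z.insertNth (lo z) y) ^ 2
            + 4 * lam * lo z * ∑ j, pderiv (z.succAbove j) φ (z.insertNth (lo z) y) ^ 2))
          * Real.exp (2 * lam * lo z ^ 2) := by
    rw [← integral_mul_const]
    refine integral_mono (integrable_box ((hF z).continuous.comp (hins _)) _ _) ?_ fun y => ?_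
    · have := hins (lo z)
      refine integrable_box ?_ _ _
      fun_prop
    · simpa using carlemanFlux_bottom_le z lam dφ (x := z.insertNth (lo z) y) (by linarith)
        (by simpa using ha)
  simp only [Finset.sum_sub_distrib] at hdiv ⊢
  linarith

/-- The basic Carleman estimate for functions in `H²` with zero trace on all faces but the one
where the weight is largest. -/
theorem carleman_of_smoothApprox (hlt : ∀ i, lo i < hi i) (ha : 0 < lo z) (hl : 1 ≤ lam)
    (hla : 1 ≤ lam * lo z ^ 2) {c : ℝ} (hc1 : c ≤ 1 / 2) (hc2 : c ≤ lo z ^ 2)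
    {φ : ℕ → (Fin (m + 1) → ℝ) → ℝ}
    {u : (Fin (m + 1) → ℝ) → ℝ} {g : Fin (m + 1) → (Fin (m + 1) → ℝ) → ℝ}
    {h : Fin (m + 1) → Fin (m + 1) → (Fin (m + 1) → ℝ) → ℝ} (hφ : SmoothApprox lo hi φ u g h)
    (hbot : L2Lim (volume.restrict (faceBox lo hi z)) (fun k y => φ k (z.insertNth (lo z) y)) 0)
    (hside : ∀ j c, c = lo (z.succAbove j) ∨ c = hi (z.succAbove j) →
      L2Lim (volume.restrict (faceBox lo hi (z.succAbove j)))
        (fun k y => φ k ((z.succAbove j).insertNth c y)) 0)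
    {T N : (Fin m → ℝ) → ℝ}
    (hT : L2Lim (volume.restrict (faceBox lo hi z)) (fun k y => φ k (z.insertNth (hi z) y)) T)
    (hN : L2Lim (volume.restrict (faceBox lo hi z))
      (fun k y => pderiv z (φ k) (z.insertNth (hi z) y)) N) :
    c * (∫ x in box lo hi, (lam * (∑ i, g i x ^ 2) + lam ^ 3 * u x ^ 2)
          * Real.exp (2 * lam * x z ^ 2))
      ≤ (∫ x in box lo hi, (∑ i, h i i x) ^ 2 * Real.exp (2 * lam * x z ^ 2))
        + (12 + 16 * hi z + 32 * hi z ^ 2 + 48 * hi z ^ 3)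
          * (∫ y in faceBox lo hi z, (lam * N y ^ 2 + lam ^ 3 * T y ^ 2))
          * Real.exp (2 * lam * hi z ^ 2) := by
  have hW : Continuous fun x : Fin (m + 1) → ℝ => Real.exp (lam * x z ^ 2) :=
    (contDiff_weight z lam).continuous
  have wsq : ∀ t s : ℝ, t ^ 2 * Real.exp (2 * lam * s ^ 2) = (Real.exp (lam * s ^ 2) * t) ^ 2 :=
    fun t s => by rw [exp_two_mul]; ring
  have L1 : IntLim (volume.restrict (box lo hi))
      (fun k x => (lam * (∑ i, pderiv i (φ k) x ^ 2) + lam ^ 3 * φ k x ^ 2)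
        * Real.exp (2 * lam * x z ^ 2))
      (fun x => (lam * (∑ i, g i x ^ 2) + lam ^ 3 * u x ^ 2) * Real.exp (2 * lam * x z ^ 2)) := by
    have := ((IntLim.sum Finset.univ fun i _ =>
      ((hφ.lim_grad i).continuous_mul hW).sq).const_mul lam).add
      (((hφ.lim.continuous_mul hW).sq).const_mul (lam ^ 3))
    simpa only [add_mul, mul_assoc lam, mul_assoc (lam ^ 3), Finset.sum_mul, wsq] using this
  have L2 : IntLim (volume.restrict (box lo hi))
      (fun k x => (∑ i, pderiv i (pderiv i (φ k)) x) ^ 2 * Real.exp (2 * lam * x z ^ 2))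
      (fun x => (∑ i, h i i x) ^ 2 * Real.exp (2 * lam * x z ^ 2)) := by
    have := ((L2Lim.sum Finset.univ fun i _ => hφ.lim_hess i i).continuous_mul hW).sq
    simpa only [wsq] using this
  have L3 : IntLim (volume.restrict (faceBox lo hi z))
      (fun k y => lam * pderiv z (φ k) (z.insertNth (hi z) y) ^ 2
        + lam ^ 3 * φ k (z.insertNth (hi z) y) ^ 2)
      (fun y => lam * N y ^ 2 + lam ^ 3 * T y ^ 2) :=
    (hN.sq.const_mul lam).add (hT.sq.const_mul (lam ^ 3))
  have L4 : Tendsto (fun k => ∫ y in faceBox lo hi z,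
      (4 * lam / lo z * φ k (z.insertNth (lo z) y) ^ 2
        + 4 * lam * lo z * ∑ j, pderiv (z.succAbove j) (φ k) (z.insertNth (lo z) y) ^ 2))
      atTop (𝓝 0) := by
    have := ((hbot.sq.const_mul (4 * lam / lo z)).add ((IntLim.sum Finset.univ fun j _ =>
      (tangential_trace_zero hlt hφ (Or.inl rfl) hbot j).sq).const_mul (4 * lam * lo z))).tendsto
    simpa using this
  -- On a side face the flux is -8λ(z v_z + v) times the normal derivative. The first factor tends
  -- to 0 in L², as z is tangential there, and the second converges, so the integral of the product
  -- tends to 0.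
  have L5 : ∀ j c, c = lo (z.succAbove j) ∨ c = hi (z.succAbove j) →
      Tendsto (fun k => ∫ y in faceBox lo hi (z.succAbove j),
        carlemanFlux z lam (conjugate z lam (φ k)) (z.succAbove j)
          ((z.succAbove j).insertNth c y)) atTop (𝓝 0) := fun j c hc => by
    have hne : z.succAbove j ≠ z := Fin.succAbove_ne z j
    obtain ⟨j', hj'⟩ := Fin.exists_succAbove_eq hne.symm
    have t1 := hside j c hc
    have t2 := tangential_trace_zero hlt hφ hc t1 j'
    rw [hj'] at t2
    obtain ⟨S, t3⟩ := exists_trace hlt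
      (fun k => contDiff_pderiv (hφ.contDiff k) (z.succAbove j)) (hφ.lim_grad _)
      (hφ.lim_hess _ (z.succAbove j)) hc
    have hin := continuous_insertNth (z.succAbove j) c
    have hw1 : Continuous fun y : Fin m → ℝ =>
        ((z.succAbove j).insertNth c y : Fin (m + 1) → ℝ) z := (continuous_apply z).comp hin
    have t4 := (t2.continuous_mul hw1).add (t1.continuous_mul
      (w := fun y => 2 * lam * ((z.succAbove j).insertNth c y : Fin (m + 1) → ℝ) z ^ 2 + 1)
      (by fun_prop))
    have t5 := t3.continuous_mul (w := fun y =>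
      -8 * lam * Real.exp (2 * lam * ((z.succAbove j).insertNth c y : Fin (m + 1) → ℝ) z ^ 2))
      (by fun_prop)
    have t6 := (t4.mul t5).tendsto
    simp only [Pi.zero_apply, mul_zero, add_zero, zero_mul, integral_zero] at t6
    refine t6.congr fun k => ?_
    refine integral_congr_ae (Eventually.of_forall fun y => ?_)
    have dφ : Differentiable ℝ (φ k) := (hφ.contDiff k).differentiable (by simp)
    simp only [carlemanFlux, pderiv_conjugate z lam dφ, if_neg hne, if_true, conjugate,
      exp_two_mul]
    ring
  have key : ∀ k, _ := fun k => smooth_carleman z lam hlt ha hl hla hc1 hc2 (hφ.contDiff k)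
  have R := (((L2.tendsto.add ((L3.tendsto.const_mul
    (12 + 16 * hi z + 32 * hi z ^ 2 + 48 * hi z ^ 3)).mul_const
      (Real.exp (2 * lam * hi z ^ 2)))).add (L4.mul_const (Real.exp (2 * lam * lo z ^ 2)))).add
    (tendsto_finsetSum Finset.univ fun j _ => (L5 j _ (Or.inl rfl)).sub (L5 j _ (Or.inr rfl))))
  have := le_of_tendsto_of_tendsto (L1.tendsto.const_mul c) R (Eventually.of_forall key)
  simpa using this

end Integrated


/-! ### Regularization of the trace at scale ε with zero boundary values -/

section Smoothing

variable {n : ℕ}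

theorem fderiv_apply_eq_sum (f : (Fin n → ℝ) → ℝ) (w d : Fin n → ℝ) :
    fderiv ℝ f w d = ∑ j, d j * pderiv j f w := by
  conv_lhs => rw [← Finset.univ_sum_single d]
  rw [map_sum]
  refine Finset.sum_congr rfl fun j _ => ?_
  rw [pderiv, ← smul_eq_mul, ← map_smul, ← Pi.single_smul, smul_eq_mul, mul_one]

theorem enorm_sub_le_lintegral {f : (Fin n → ℝ) → ℝ} (hf : ContDiff ℝ 1 f) {x d : Fin n → ℝ}
    {R : ℝ} (hd : ∀ j, |d j| ≤ R) :
    ‖f (x + d) - f x‖ₑ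
      ≤ ∫⁻ r in Ioc (0 : ℝ) 1, ‖R * ∑ j, |pderiv j f (x + r • d)|‖ₑ := by
  have hder : ∀ r : ℝ, HasDerivAt (fun r : ℝ => f (x + r • d)) (fderiv ℝ f (x + r • d) d) r :=
    fun r => by
      have h1 : HasDerivAt (fun r : ℝ => x + r • d) d r := by
        simpa using ((hasDerivAt_id r).smul_const d).const_add x
      exact ((hf.differentiable one_ne_zero _).hasFDerivAt).comp_hasDerivAt r h1
  have hc : Continuous fun r : ℝ => fderiv ℝ f (x + r • d) d :=
    ((hf.continuous_fderiv one_ne_zero).comp (by fun_prop)).clm_apply continuous_const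
  have h := intervalIntegral.integral_eq_sub_of_hasDerivAt (a := 0) (b := 1)
    (fun r _ => hder r) (hc.intervalIntegrable 0 1)
  simp only [one_smul, zero_smul, add_zero] at h
  rw [← h, intervalIntegral.integral_of_le zero_le_one]
  refine (enorm_integral_le_lintegral_enorm _).trans (lintegral_mono fun r => ?_)
  rw [enorm_le_iff_norm_le, fderiv_apply_eq_sum, Real.norm_eq_abs, Real.norm_eq_abs]
  refine le_trans ?_ (le_abs_self _)
  rw [Finset.mul_sum]
  refine (Finset.abs_sum_le_sum_abs _ _).trans (Finset.sum_le_sum fun j _ => ?_)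
  rw [abs_mul]
  exact mul_le_mul_of_nonneg_right (hd j) (abs_nonneg _)

/-- The displacement (s - 1)x - y is at most 2ε + ε in each coordinate on the cube. The difference
is the integral of the derivative along the segment, estimated by Minkowski's inequality. -/
theorem eLpNorm_dilate_sub_le {B : ℝ} {f : (Fin n → ℝ) → ℝ} (hf : ContDiff ℝ 1 f) {ε s : ℝ}
    (hs : 1 ≤ s) (hsB : (s - 1) * B ≤ 2 * ε) {y : Fin n → ℝ} (hy : ‖y‖ ≤ ε) :
    ∫⁻ x in topFace n B, ‖f (s • x - y) - f x‖ₑ ^ 2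
      ≤ (ENNReal.ofReal (3 * ε) * eLpNorm (fun x => ∑ j, |pderiv j f x|) 2 volume) ^ 2 := by
  set H : (Fin n → ℝ) → ℝ := fun x => ∑ j, |pderiv j f x| with hH
  have hHc : Continuous H := continuous_finsetSum _ fun j _ => (continuous_pderiv hf j).abs
  have hε : 0 ≤ ε := (norm_nonneg y).trans hy
  have hM : ∀ᵐ r ∂(volume.restrict (Ioc (0 : ℝ) 1)), ∫⁻ x in topFace n B,
      ‖3 * ε * H (x + r • ((s - 1) • x - y))‖ₑ ^ 2
        ≤ (ENNReal.ofReal (3 * ε) * eLpNorm H 2 volume) ^ 2 := by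
    filter_upwards [ae_restrict_mem measurableSet_Ioc] with r hr
    refine (setLIntegral_le_lintegral _ _).trans ?_
    -- The point on the segment is a dilation of x by a factor at least 1, whose change of variables
    -- costs nothing.
    have h1 : 1 ≤ 1 + r * (s - 1) := by nlinarith [hr.1]
    have h2 := lintegral_comp_affine (g := fun x => ‖H x‖ₑ ^ 2)
      (hHc.measurable.enorm.pow_const 2) (s := 1 + r * (s - 1)) (by linarith) (-(r • y))
    have e : ∀ x, ‖3 * ε * H (x + r • ((s - 1) • x - y))‖ₑ ^ 2
        = ENNReal.ofReal (3 * ε) ^ 2 * ‖H ((1 + r * (s - 1)) • x + -(r • y))‖ₑ ^ 2 := fun x => by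
      rw [enorm_mul, mul_pow, Real.enorm_eq_ofReal (by positivity)]
      congr 4
      rw [smul_sub, smul_smul, add_smul, one_smul]
      abel
    simp only [e]
    rw [lintegral_const_mul' _ _ (by finiteness), h2, mul_pow, eLpNorm_two_sq]
    refine mul_le_mul_right ?_ _
    refine mul_le_of_le_one_left' (ENNReal.ofReal_le_one.2 ?_)
    rw [abs_of_pos (by positivity)]
    exact inv_le_one_of_one_le₀ (one_le_pow₀ h1)
  have h := lintegral_lintegral_sq_le (μ := volume.restrict (topFace n B))
    (ν := volume.restrict (Ioc (0 : ℝ) 1))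
    (F := fun x r => ‖3 * ε * H (x + r • ((s - 1) • x - y))‖ₑ)
    (by
      have : Continuous (Function.uncurry fun (x : Fin n → ℝ) (r : ℝ) =>
          ‖3 * ε * H (x + r • ((s - 1) • x - y))‖ₑ) := by
        unfold Function.uncurry
        fun_prop
      exact this.measurable.aemeasurable) hM
  simp only [Measure.restrict_apply_univ, Real.volume_Ioc, sub_zero, ENNReal.ofReal_one, one_pow,
    one_mul] at h
  refine le_trans (lintegral_mono_ae ?_) h
  filter_upwards [ae_restrict_mem (measurableSet_box _ _)] with x hx
  have hd : ∀ j, |((s - 1) • x - y) j| ≤ 3 * ε := fun j => by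
    have h1 := (norm_le_pi_norm y j).trans hy
    have h2 := mem_box.1 hx j
    have h3 : |x j| ≤ B := abs_le.2 ⟨h2.1.le, h2.2.le⟩
    rw [Real.norm_eq_abs] at h1
    simp only [Pi.sub_apply, Pi.smul_apply, smul_eq_mul]
    calc _ ≤ |(s - 1) * x j| + |y j| := abs_sub _ _
      _ ≤ (s - 1) * B + ε := by
        rw [abs_mul, abs_of_nonneg (by linarith : 0 ≤ s - 1)]
        exact add_le_add (mul_le_mul_of_nonneg_left h3 (by linarith)) h1
      _ ≤ 3 * ε := by linarith
  have h4 := enorm_sub_le_lintegral hf (x := x) hd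
  have e : x + ((s - 1) • x - y) = s • x - y := by rw [sub_smul, one_smul]; abel
  rw [e] at h4
  exact pow_le_pow_left₀ zero_le h4 2

theorem eLpNorm_mollify_sub_le {B : ℝ} {k f : (Fin n → ℝ) → ℝ} {ε s : ℝ} (hk : IsKernel k ε)
    (hf : ContDiff ℝ 1 f) (hs : 1 ≤ s) (hsB : (s - 1) * B ≤ 2 * ε) :
    eLpNorm (fun x => mollify k f s 0 x - f x) 2 (volume.restrict (topFace n B))
      ≤ ENNReal.ofReal (3 * ε) * eLpNorm (fun x => ∑ j, |pderiv j f x|) 2 volume := by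
  have hkc := hk.contDiff.continuous
  have hkm : Measurable fun y => ‖k y‖ₑ := hkc.measurable.enorm
  set ν := (volume : Measure (Fin n → ℝ)).withDensity fun y => ‖k y‖ₑ with hν
  have hν1 : ν univ = 1 := by
    rw [hν, withDensity_apply _ MeasurableSet.univ, Measure.restrict_univ, hk.lintegral_enorm]
  have hfc := hf.continuous
  have hpt : ∀ x, ‖mollify k f s 0 x - f x‖ₑ ≤ ∫⁻ y, ‖f (s • x - y) - f x‖ₑ ∂ν := fun x => by
    have e : mollify k f s 0 x - f x = ∫ y, (f (s • x - y) - f x) * k y := by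
      have i1 : Integrable fun y => f (s • x - y) * k y :=
        ((hfc.comp (continuous_const.sub continuous_id)).mul
          hkc).integrable_of_hasCompactSupport hk.hasCompactSupport.mul_left
      have i2 : Integrable k := hkc.integrable_of_hasCompactSupport hk.hasCompactSupport
      simp only [sub_mul]
      rw [integral_sub i1 (i2.const_mul _), integral_const_mul, hk.integral, mul_one,
        mollify_eq_integral_sub, add_zero]
    rw [e]
    refine (enorm_integral_le_lintegral_enorm _).trans (le_of_eq ?_)
    have hm : Measurable fun y => ‖f (s • x - y) - f x‖ₑ :=
      Continuous.measurable (by fun_prop)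
    rw [hν, lintegral_withDensity_eq_lintegral_mul _ hkm hm]
    exact lintegral_congr fun y => by simp [mul_comm]
  have h := lintegral_lintegral_sq_le (μ := volume.restrict (topFace n B)) (ν := ν)
    (F := fun x y => ‖f (s • x - y) - f x‖ₑ)
    (M := (ENNReal.ofReal (3 * ε) * eLpNorm (fun x => ∑ j, |pderiv j f x|) 2 volume) ^ 2)
    (by
      have : Continuous (Function.uncurry fun (x y : Fin n → ℝ) => ‖f (s • x - y) - f x‖ₑ) := by
        unfold Function.uncurry
        fun_prop
      exact this.measurable.aemeasurable)
    ((ae_withDensity_iff hkm).2 (Eventually.of_forall fun y hy =>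
      eLpNorm_dilate_sub_le hf hs hsB (hk.norm_le y (by simpa using hy))))
  rw [hν1, one_pow, one_mul] at h
  rw [← ENNReal.pow_le_pow_left_iff two_ne_zero, eLpNorm_two_sq]
  exact (lintegral_mono fun x => pow_le_pow_left₀ zero_le (hpt x) 2).trans h

/-- The mollification of `T` at scale `ε`, contracted so as to vanish outside the box. -/
noncomputable def outerMollify (B ε : ℝ) (T : (Fin n → ℝ) → ℝ) : (Fin n → ℝ) → ℝ :=
  mollify (stdKernel n ε) ((topFace n B).indicator T) (1 + 2 * ε / B) 0

theorem memLp_indicator_topFace {B : ℝ} {T : (Fin n → ℝ) → ℝ}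
    (hT : MemLp T 2 (volume.restrict (topFace n B))) : MemLp ((topFace n B).indicator T) 2 :=
  (memLp_indicator_iff_restrict (measurableSet_box _ _)).2 hT

theorem eLpNorm_indicator_topFace {B : ℝ} (T : (Fin n → ℝ) → ℝ) :
    eLpNorm ((topFace n B).indicator T) 2 volume
      = eLpNorm T 2 (volume.restrict (topFace n B)) :=
  eLpNorm_indicator_eq_eLpNorm_restrict (measurableSet_box _ _)

theorem contDiff_outerMollify {B ε : ℝ} (hε : 0 < ε) {T : (Fin n → ℝ) → ℝ}
    (hT : MemLp T 2 (volume.restrict (topFace n B))) : ContDiff ℝ ∞ (outerMollify B ε T) :=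
  contDiff_mollify (isKernel_stdKernel n hε).contDiff (isKernel_stdKernel n hε).hasCompactSupport
    (memLp_indicator_topFace hT) _ _

/-- With s = 1 + 2ε/B one has sB = B + 2ε: a point s x with x outside the cube is farther than ε
from the cube, beyond the reach of the kernel. -/
theorem outerMollify_eq_zero {B ε : ℝ} (hB : 0 < B) (hε : 0 < ε) (T : (Fin n → ℝ) → ℝ)
    {x : Fin n → ℝ} (hx : x ∉ topFace n B) : outerMollify B ε T x = 0 := by
  rw [outerMollify, mollify, ← integral_zero (Fin n → ℝ) ℝ]
  refine integral_congr_ae (Eventually.of_forall fun y => ?_)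
  dsimp only
  by_contra h0
  have hy : y ∈ topFace n B := by
    by_contra hy
    exact h0 (by simp [hy])
  have hk := (isKernel_stdKernel n hε).norm_le _ (right_ne_zero_of_mul h0)
  apply hx
  refine mem_box.2 fun i => ?_
  have h1 := (norm_le_pi_norm _ i).trans hk
  have h2 := mem_box.1 hy i
  simp only [add_zero, Pi.sub_apply, Pi.smul_apply, smul_eq_mul, Real.norm_eq_abs] at h1
  obtain ⟨h3, h4⟩ := abs_le.1 h1
  have h5 : 0 < 2 * ε / B := by positivity
  have h6 : 2 * ε / B * B = 2 * ε := by field_simp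
  constructor
  · by_contra h7
    nlinarith
  · by_contra h7
    nlinarith

/-- `S j` is the weak derivative of the extension by zero of `T`. -/
def IsZeroExtDeriv (B : ℝ) (T : (Fin n → ℝ) → ℝ) (S : Fin n → (Fin n → ℝ) → ℝ) : Prop :=
  ∀ j, ∀ θ : (Fin n → ℝ) → ℝ, ContDiff ℝ ∞ θ →
    ∫ y in topFace n B, T y * pderiv j θ y = -∫ y in topFace n B, S j y * θ y

/-- The shifted kernel may cross the boundary of the cube. This is where the integration by parts is
needed for all smooth θ and not only for those supported in the cube. -/
theorem pderiv_mollify_zeroExt {B ε s : ℝ} (hε : 0 < ε) {T : (Fin n → ℝ) → ℝ}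
    {S : Fin n → (Fin n → ℝ) → ℝ} (hT : MemLp T 2 (volume.restrict (topFace n B)))
    (hTS : IsZeroExtDeriv B T S) (j : Fin n) :
    pderiv j (mollify (stdKernel n ε) ((topFace n B).indicator T) s 0)
      = fun x => s * mollify (stdKernel n ε) ((topFace n B).indicator (S j)) s 0 x := by
  have hK := isKernel_stdKernel n hε
  ext x
  rw [pderiv_mollify hK.contDiff hK.hasCompactSupport (memLp_indicator_topFace hT),
    mollify_pderiv_eq (U := topFace n B) (measurableSet_box _ _) hK.contDiff]
  exact hTS j _ (hK.contDiff.comp (contDiff_const.sub contDiff_id))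

/-- T itself is not differentiable, so the bound is proved for mollifications of its zero extension,
whose gradients are controlled by S uniformly, and then passes to the limit. -/
theorem eLpNorm_outerMollify_sub_le {B ε : ℝ} (hB : 0 < B) (hε : 0 < ε) {T : (Fin n → ℝ) → ℝ}
    {S : Fin n → (Fin n → ℝ) → ℝ} (hT : MemLp T 2 (volume.restrict (topFace n B)))
    (hS : ∀ j, MemLp (S j) 2 (volume.restrict (topFace n B))) (hTS : IsZeroExtDeriv B T S) :
    eLpNorm (fun x => outerMollify B ε T x - T x) 2 (volume.restrict (topFace n B))
      ≤ ENNReal.ofReal (3 * ε) *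
        (2 ^ n * ∑ j, eLpNorm (S j) 2 (volume.restrict (topFace n B))) := by
  set T₀ := (topFace n B).indicator T with hT₀
  have hT₀m : MemLp T₀ 2 := memLp_indicator_topFace hT
  set s := 1 + 2 * ε / B with hs
  have hs1 : 1 ≤ s := by rw [hs]; linarith [show 0 ≤ 2 * ε / B by positivity]
  have hsB : (s - 1) * B ≤ 2 * ε := by rw [hs]; apply le_of_eq; field_simp; ring
  have hK := isKernel_stdKernel n hε
  set δ : ℕ → ℝ := fun k => 1 / ((k : ℝ) + 1) with hδd
  have hδ : ∀ k, 0 < δ k := fun k => by positivity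
  set f : ℕ → (Fin n → ℝ) → ℝ := fun k => mollify (stdKernel n (δ k)) T₀ 1 0 with hf
  have hlim : L2Lim volume f T₀ :=
    tendsto_mollify (ε := δ) (s := fun _ => 1) (p := fun _ => 0)
      (fun k => isKernel_stdKernel n (hδ k)) tendsto_one_div_add_atTop_nhds_zero_nat
      tendsto_const_nhds tendsto_const_nhds (fun _ => by norm_num) hT₀m
  have hfc : ∀ k, ContDiff ℝ ∞ (f k) := fun k =>
    contDiff_mollify (isKernel_stdKernel n (hδ k)).contDiff
      (isKernel_stdKernel n (hδ k)).hasCompactSupport hT₀m _ _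
  have hgrad : ∀ k, eLpNorm (fun x => ∑ j, |pderiv j (f k) x|) 2 volume
      ≤ 2 ^ n * ∑ j, eLpNorm (S j) 2 (volume.restrict (topFace n B)) := fun k => by
    have e : (fun x => ∑ j, |pderiv j (f k) x|) = ∑ j, fun x => |pderiv j (f k) x| := by
      ext x; simp
    rw [e, Finset.mul_sum]
    refine (eLpNorm_sum_le (fun j _ => (contDiff_pderiv (hfc k)
      j).continuous.abs.aestronglyMeasurable) one_le_two).trans (Finset.sum_le_sum fun j _ => ?_)
    have e2 : eLpNorm (fun x => |pderiv j (f k) x|) 2 volume = eLpNorm (pderiv j (f k)) 2 volume :=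
      eLpNorm_norm (pderiv j (f k))
    rw [e2, pderiv_mollify_zeroExt (hδ k) hT hTS, ← eLpNorm_indicator_topFace (S j)]
    simp only [one_mul]
    have := eLpNorm_mollify_le (isKernel_stdKernel n (hδ k)).contDiff.continuous
      (memLp_indicator_topFace (hS j)).1 (s := 1) (by norm_num) 0
    rwa [(isKernel_stdKernel n (hδ k)).lintegral_enorm, mul_one] at this
  set err : ℕ → ENNReal := fun k => eLpNorm (fun x => f k x - T₀ x) 2 volume with herr
  -- Three errors: regularizing T₀ - f_k, the smooth estimate for f_k, and f_k - T₀. The first and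
  -- last tend to zero with k, at fixed ε.
  have hbound : ∀ k, eLpNorm (fun x => outerMollify B ε T x - T x) 2
        (volume.restrict (topFace n B))
      ≤ (2 ^ n * err k + ENNReal.ofReal (3 * ε) *
        (2 ^ n * ∑ j, eLpNorm (S j) 2 (volume.restrict (topFace n B)))) + err k := fun k => by
    have hsub : MemLp (T₀ - f k) 2 := hT₀m.sub (hlim.memLp k)
    have b1 : eLpNorm (mollify (stdKernel n ε) (T₀ - f k) s 0) 2
        (volume.restrict (topFace n B)) ≤ 2 ^ n * err k := by
      refine (eLpNorm_mono_measure _ Measure.restrict_le_self).trans ?_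
      have := eLpNorm_mollify_le hK.contDiff.continuous hsub.1 (s := s) (by linarith) 0
      rw [hK.lintegral_enorm, mul_one] at this
      refine this.trans (mul_le_mul_right (le_of_eq ?_) _)
      rw [eLpNorm_sub_comm]
      rfl
    have b2 : eLpNorm (fun x => mollify (stdKernel n ε) (f k) s 0 x - f k x) 2
        (volume.restrict (topFace n B)) ≤ ENNReal.ofReal (3 * ε) *
        (2 ^ n * ∑ j, eLpNorm (S j) 2 (volume.restrict (topFace n B))) :=
      (eLpNorm_mollify_sub_le hK ((hfc k).of_le (by simp)) hs1 hsB).trans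
        (mul_le_mul_right (hgrad k) _)
    have b3 : eLpNorm (fun x => f k x - T₀ x) 2 (volume.restrict (topFace n B)) ≤ err k :=
      eLpNorm_mono_measure _ Measure.restrict_le_self
    have m1 : AEStronglyMeasurable (mollify (stdKernel n ε) (T₀ - f k) s 0)
        (volume.restrict (topFace n B)) :=
      (contDiff_mollify hK.contDiff hK.hasCompactSupport hsub _ _).continuous.aestronglyMeasurable
    have m2 : AEStronglyMeasurable (fun x => mollify (stdKernel n ε) (f k) s 0 x - f k x)
        (volume.restrict (topFace n B)) :=
      ((contDiff_mollify hK.contDiff hK.hasCompactSupport (hlim.memLp k) _ _).continuous.sub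
        (hfc k).continuous).aestronglyMeasurable
    have m3 : AEStronglyMeasurable (fun x => f k x - T₀ x) (volume.restrict (topFace n B)) :=
      ((hlim.memLp k).sub hT₀m).1.restrict
    have e : (fun x => outerMollify B ε T x - T x) =ᵐ[volume.restrict (topFace n B)]
        (mollify (stdKernel n ε) (T₀ - f k) s 0
          + fun x => mollify (stdKernel n ε) (f k) s 0 x - f k x) + fun x => f k x - T₀ x := by
      filter_upwards [ae_restrict_mem (measurableSet_box _ _)] with x hx
      have hx' : T₀ x = T x := indicator_of_mem hx T
      simp only [Pi.add_apply]
      rw [mollify_sub hK.contDiff.continuous hK.hasCompactSupport hT₀m (hlim.memLp k), hx',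
        outerMollify]
      ring
    rw [eLpNorm_congr_ae e]
    exact (eLpNorm_add_le (m1.add m2) m3 one_le_two).trans (add_le_add
      ((eLpNorm_add_le m1 m2 one_le_two).trans (add_le_add b1 b2)) b3)
  have hr : Tendsto (fun k => (2 ^ n * err k + ENNReal.ofReal (3 * ε) *
        (2 ^ n * ∑ j, eLpNorm (S j) 2 (volume.restrict (topFace n B)))) + err k) atTop
      (𝓝 ((2 ^ n * 0 + ENNReal.ofReal (3 * ε) *
        (2 ^ n * ∑ j, eLpNorm (S j) 2 (volume.restrict (topFace n B)))) + 0)) :=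
    ((ENNReal.Tendsto.const_mul hlim.tendsto (Or.inr (by finiteness))).add_const _).add
      hlim.tendsto
  rw [mul_zero, zero_add, add_zero] at hr
  exact ge_of_tendsto' hr hbound

theorem integral_sq_le_of_eLpNorm_le {α β : Type*} [MeasurableSpace α] [MeasurableSpace β]
    {μ : Measure α} {ν : Measure β} {f : α → ℝ} {g : β → ℝ} (hf : MemLp f 2 μ) (hg : MemLp g 2 ν)
    {c : ℝ} (hc : 0 ≤ c) (h : eLpNorm f 2 μ ≤ ENNReal.ofReal c * eLpNorm g 2 ν) :
    ∫ x, f x ^ 2 ∂μ ≤ c ^ 2 * ∫ x, g x ^ 2 ∂ν := by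
  have hn : 0 ≤ ∫ x, g x ^ 2 ∂ν := integral_nonneg fun _ => sq_nonneg _
  rw [eLpNorm_two_eq hg, ← ENNReal.ofReal_mul hc, eLpNorm_two_le_iff hf (by positivity), mul_pow,
    Real.sq_sqrt hn] at h
  exact h

/-- Smooth approximation of a function in `H¹₀` of a cube, at scale `ε`, by functions that vanish
outside the cube. -/
theorem exists_smoothing (n : ℕ) {B : ℝ} (hB : 0 < B) :
    ∃ K : ℝ, 0 < K ∧ ∀ ε, 0 < ε → ε ≤ B → ∀ (T : (Fin n → ℝ) → ℝ)
      (S : Fin n → (Fin n → ℝ) → ℝ), MemLp T 2 (volume.restrict (topFace n B)) →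
      (∀ j, MemLp (S j) 2 (volume.restrict (topFace n B))) → IsZeroExtDeriv B T S →
      ∃ f : (Fin n → ℝ) → ℝ, ContDiff ℝ ∞ f ∧ (∀ x, x ∉ topFace n B → f x = 0) ∧
        ((∫ y in topFace n B, f y ^ 2) ≤ K * ∫ y in topFace n B, T y ^ 2) ∧
        (∀ j, (∫ y in topFace n B, pderiv j f y ^ 2) ≤ K * ∫ y in topFace n B, S j y ^ 2) ∧
        (∀ j, (∫ y in topFace n B, pderiv j (pderiv j f) y ^ 2)
          ≤ K / ε ^ 2 * ∫ y in topFace n B, S j y ^ 2) ∧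
        (∫ y in topFace n B, (f y - T y) ^ 2)
          ≤ K * ε ^ 2 * ∑ j, ∫ y in topFace n B, S j y ^ 2 := by
  have hA : ∀ j : Fin n, ∫⁻ y, ‖pderiv j (stdKernel n 1) y‖ₑ ≠ ⊤ := fun j => by
    have h1 := isKernel_stdKernel_one n
    exact ((contDiff_pderiv h1.contDiff j).continuous.integrable_of_hasCompactSupport
      (hasCompactSupport_pderiv h1.hasCompactSupport j)).2.ne
  set A : Fin n → ℝ := fun j => (∫⁻ y, ‖pderiv j (stdKernel n 1) y‖ₑ).toReal with hAd
  have hA0 : ∀ j, 0 ≤ A j := fun j => ENNReal.toReal_nonneg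
  -- Here 2ⁿ is the mollification bound, 3 ≥ s and 9 ≥ s² come from ε ≤ B, the factor n from
  -- Cauchy–Schwarz over the directions, and A j is the L¹ norm of a derivative of the unit kernel.
  set K : ℝ := (3 * 2 ^ n) ^ 2 * (1 + n) + (9 * 2 ^ n) ^ 2 * ∑ j, A j ^ 2 with hK
  have hAs : 0 ≤ ∑ j, A j ^ 2 := Finset.sum_nonneg fun _ _ => sq_nonneg _
  have hK1 : (3 * 2 ^ n) ^ 2 ≤ K := by
    rw [hK]
    have : (0 : ℝ) ≤ (3 * 2 ^ n) ^ 2 * n := by positivity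
    have : 0 ≤ (9 * 2 ^ n) ^ 2 * ∑ j, A j ^ 2 := by positivity
    linarith
  have hK2 : (3 * 2 ^ n) ^ 2 * n ≤ K := by
    rw [hK]
    have : (0 : ℝ) ≤ (3 * 2 ^ n) ^ 2 := by positivity
    have : 0 ≤ (9 * 2 ^ n) ^ 2 * ∑ j, A j ^ 2 := by positivity
    linarith
  have hK3 : ∀ j, (9 * 2 ^ n * A j) ^ 2 ≤ K := fun j => by
    have h1 : A j ^ 2 ≤ ∑ j, A j ^ 2 :=
      Finset.single_le_sum (fun _ _ => sq_nonneg _) (Finset.mem_univ j)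
    have h2 := mul_le_mul_of_nonneg_left h1 (sq_nonneg ((9 : ℝ) * 2 ^ n))
    rw [hK, mul_pow]
    have : (0 : ℝ) ≤ (3 * 2 ^ n) ^ 2 * (1 + n) := by positivity
    linarith
  have hK0 : 0 < K := lt_of_lt_of_le (by positivity) hK1
  refine ⟨K, hK0, fun ε hε hεB T S hT hS hTS => ?_⟩
  have hker := isKernel_stdKernel n hε
  have hkerd := contDiff_pderiv hker.contDiff
  set s := 1 + 2 * ε / B with hs
  have hs1 : 1 ≤ s := by rw [hs]; linarith [show 0 ≤ 2 * ε / B by positivity]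
  have hs3 : s ≤ 3 := by
    have : 2 * ε / B ≤ 2 := by rw [div_le_iff₀ hB]; linarith
    rw [hs]; linarith
  have p2 : (2 : ENNReal) ^ n = ENNReal.ofReal (2 ^ n) := by
    rw [ENNReal.ofReal_pow zero_le_two]; simp
  have hfc := contDiff_outerMollify hε hT
  have hgrad : ∀ j, pderiv j (outerMollify B ε T) = fun x => s * mollify (stdKernel n ε)
      ((topFace n B).indicator (S j)) s 0 x := fun j => pderiv_mollify_zeroExt hε hT hTS j
  have nn : ∀ g : (Fin n → ℝ) → ℝ, 0 ≤ ∫ y in topFace n B, g y ^ 2 := fun g =>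
    integral_nonneg fun _ => sq_nonneg _
  have mB : ∀ {g : (Fin n → ℝ) → ℝ}, ContDiff ℝ ∞ g →
      MemLp g 2 (volume.restrict (topFace n B)) := fun hg => memLp_box hg.continuous _ _
  have hscale : ∀ g : (Fin n → ℝ) → ℝ, ∀ c : ℝ, 0 ≤ c →
      eLpNorm (fun x => c * g x) 2 volume = ENNReal.ofReal c * eLpNorm g 2 volume :=
    fun g c hc => by
      have := eLpNorm_const_smul c g 2 (volume : Measure (Fin n → ℝ))
      rw [Real.enorm_eq_ofReal hc] at this
      exact this
  refine ⟨outerMollify B ε T, hfc, fun x hx => outerMollify_eq_zero hB hε T hx, ?_,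
    fun j => ?_, fun j => ?_, ?_⟩
  · refine (integral_sq_le_of_eLpNorm_le (mB hfc) hT (c := 2 ^ n) (by positivity) ?_).trans
      (mul_le_mul_of_nonneg_right (le_trans ?_ hK1) (nn T))
    · rw [← p2, ← eLpNorm_indicator_topFace T]
      refine (eLpNorm_mono_measure _ Measure.restrict_le_self).trans ?_
      have := eLpNorm_mollify_le hker.contDiff.continuous (memLp_indicator_topFace hT).1
        (s := s) (by linarith) 0
      rwa [hker.lintegral_enorm, mul_one] at this
    · exact pow_le_pow_left₀ (by positivity) (by nlinarith [show (0 : ℝ) < 2 ^ n by positivity]) 2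
  · refine (integral_sq_le_of_eLpNorm_le (mB (contDiff_pderiv hfc j)) (hS j) (c := 3 * 2 ^ n)
      (by positivity) ?_).trans (mul_le_mul_of_nonneg_right hK1 (nn _))
    rw [ENNReal.ofReal_mul (by norm_num), ← p2, ← eLpNorm_indicator_topFace (S j), hgrad]
    refine (eLpNorm_mono_measure _ Measure.restrict_le_self).trans ?_
    have := eLpNorm_mollify_le hker.contDiff.continuous (memLp_indicator_topFace (hS j)).1
      (s := s) (by linarith) 0
    rw [hker.lintegral_enorm, mul_one] at this
    rw [hscale _ s (by linarith), mul_assoc]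
    exact mul_le_mul' (ENNReal.ofReal_le_ofReal hs3) this
  · have hpp : pderiv j (pderiv j (outerMollify B ε T)) = fun x => s ^ 2 *
        mollify (pderiv j (stdKernel n ε)) ((topFace n B).indicator (S j)) s 0 x := by
      ext x
      have hd : Differentiable ℝ (mollify (stdKernel n ε) ((topFace n B).indicator (S j)) s 0) :=
        (contDiff_mollify hker.contDiff hker.hasCompactSupport
          (memLp_indicator_topFace (hS j)) _ _).differentiable (by simp)
      rw [hgrad, pderiv_const_mul hd, pderiv_mollify hker.contDiff hker.hasCompactSupport
        (memLp_indicator_topFace (hS j))]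
      ring
    refine (integral_sq_le_of_eLpNorm_le (mB (contDiff_pderiv (contDiff_pderiv hfc j) j)) (hS j)
      (c := 9 * 2 ^ n * (ε⁻¹ * A j)) (mul_nonneg (by positivity)
        (mul_nonneg (by positivity) (hA0 j))) ?_).trans
      (mul_le_mul_of_nonneg_right ?_ (nn _))
    · rw [hpp]
      refine (eLpNorm_mono_measure _ Measure.restrict_le_self).trans ?_
      have := eLpNorm_mollify_le (hkerd j).continuous (memLp_indicator_topFace (hS j)).1
        (s := s) (by linarith) 0
      rw [lintegral_pderiv_stdKernel hε, ← ENNReal.ofReal_toReal (hA j),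
        ← ENNReal.ofReal_mul (by positivity), p2, ← ENNReal.ofReal_mul (by positivity),
        eLpNorm_indicator_topFace] at this
      rw [hscale _ _ (by positivity), mul_assoc 9, ENNReal.ofReal_mul (by norm_num), mul_assoc]
      refine mul_le_mul' (ENNReal.ofReal_le_ofReal ?_) this
      nlinarith
    · have e : (9 * 2 ^ n * (ε⁻¹ * A j)) ^ 2 = (9 * 2 ^ n * A j) ^ 2 / ε ^ 2 := by
        field_simp
      rw [e]
      exact div_le_div_of_nonneg_right (hK3 j) (by positivity)
  · have hdm : MemLp (fun y => outerMollify B ε T y - T y) 2 (volume.restrict (topFace n B)) :=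
      (mB hfc).sub hT
    have h := eLpNorm_outerMollify_sub_le hB hε hT hS hTS
    set q : Fin n → ℝ := fun j => √(∫ y in topFace n B, S j y ^ 2) with hq
    have hq0 : ∀ j, 0 ≤ q j := fun j => Real.sqrt_nonneg _
    have e : ∑ j, eLpNorm (S j) 2 (volume.restrict (topFace n B)) = ENNReal.ofReal (∑ j, q j) := by
      rw [ENNReal.ofReal_sum_of_nonneg fun j _ => hq0 j]
      exact Finset.sum_congr rfl fun j _ => eLpNorm_two_eq (hS j)
    have hqs : 0 ≤ ∑ j, q j := Finset.sum_nonneg fun j _ => hq0 j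
    rw [e, p2, ← ENNReal.ofReal_mul (by positivity), ← ENNReal.ofReal_mul (by positivity),
      eLpNorm_two_le_iff hdm (by positivity)] at h
    refine h.trans ?_
    have h1 : (∑ j, q j) ^ 2 ≤ n * ∑ j, ∫ y in topFace n B, S j y ^ 2 := by
      have := sq_sum_le_card_mul_sum_sq (s := Finset.univ) (f := q)
      simpa [hq, Real.sq_sqrt (nn _)] using this
    calc (3 * ε * (2 ^ n * ∑ j, q j)) ^ 2
        = (3 * 2 ^ n) ^ 2 * ε ^ 2 * (∑ j, q j) ^ 2 := by ring
      _ ≤ (3 * 2 ^ n) ^ 2 * ε ^ 2 * (n * ∑ j, ∫ y in topFace n B, S j y ^ 2) := by gcongr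
      _ = (3 * 2 ^ n) ^ 2 * n * (ε ^ 2 * ∑ j, ∫ y in topFace n B, S j y ^ 2) := by ring
      _ ≤ K * (ε ^ 2 * ∑ j, ∫ y in topFace n B, S j y ^ 2) :=
        mul_le_mul_of_nonneg_right hK2 (mul_nonneg (by positivity)
          (Finset.sum_nonneg fun j _ => nn _))
      _ = _ := by ring

end Smoothing


/-! ### Lift of a function on the top face into the box -/

section Lift

variable {m : ℕ} {lo hi : Fin (m + 1) → ℝ} (z : Fin (m + 1))

theorem pderiv_comp_succAbove {f : (Fin m → ℝ) → ℝ} (hf : Differentiable ℝ f) (j : Fin m)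
    (x : Fin (m + 1) → ℝ) :
    pderiv (z.succAbove j) (fun x => f fun j => x (z.succAbove j)) x
      = pderiv j f fun j => x (z.succAbove j) := by
  have hd : Differentiable ℝ fun x : Fin (m + 1) → ℝ => f fun j => x (z.succAbove j) :=
    hf.comp (by fun_prop)
  rw [pderiv_eq_deriv (hd x), pderiv_eq_deriv (hf _)]
  congr 1
  ext t
  congr 1
  ext k
  simp [Pi.single_apply]

theorem pderiv_comp_succAbove_self {f : (Fin m → ℝ) → ℝ} (hf : Differentiable ℝ f)
    (x : Fin (m + 1) → ℝ) : pderiv z (fun x => f fun j => x (z.succAbove j)) x = 0 := by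
  have hd : Differentiable ℝ fun x : Fin (m + 1) → ℝ => f fun j => x (z.succAbove j) :=
    hf.comp (by fun_prop)
  rw [pderiv_eq_deriv (hd x)]
  simp [Fin.succAbove_ne]

/-- The extension of a function on the face `x_z = hi z` to the box, linear in `x_z` and zero on the
opposite face. -/
noncomputable def faceLift (lo hi : Fin (m + 1) → ℝ) (f : (Fin m → ℝ) → ℝ)
    (x : Fin (m + 1) → ℝ) : ℝ :=
  (f fun j => x (z.succAbove j)) * ((x z - lo z) * (hi z - lo z)⁻¹)

theorem contDiff_comp_succAbove {f : (Fin m → ℝ) → ℝ} (hf : ContDiff ℝ ∞ f) :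
    ContDiff ℝ ∞ fun x : Fin (m + 1) → ℝ => f fun j => x (z.succAbove j) :=
  hf.comp (contDiff_pi.2 fun j => contDiff_apply ℝ ℝ (z.succAbove j))

theorem contDiff_faceLift {f : (Fin m → ℝ) → ℝ} (hf : ContDiff ℝ ∞ f) :
    ContDiff ℝ ∞ (faceLift z lo hi f) :=
  (contDiff_comp_succAbove z hf).mul
    (((contDiff_apply ℝ ℝ z).sub contDiff_const).mul contDiff_const)

theorem pderiv_slope (i : Fin (m + 1)) (x : Fin (m + 1) → ℝ) :
    pderiv i (fun x : Fin (m + 1) → ℝ => (x z - lo z) * (hi z - lo z)⁻¹) x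
      = if i = z then (hi z - lo z)⁻¹ else 0 := by
  rw [pderiv_comp_apply (g := fun t => (t - lo z) * (hi z - lo z)⁻¹) (by fun_prop)]
  have h : HasDerivAt (fun t : ℝ => (t - lo z) * (hi z - lo z)⁻¹) (1 * (hi z - lo z)⁻¹) (x z) :=
    ((hasDerivAt_id _).sub_const _).mul_const _
  rw [h.deriv, one_mul]

theorem pderiv_faceLift {f : (Fin m → ℝ) → ℝ} (hf : ContDiff ℝ ∞ f) (j : Fin m) :
    pderiv (z.succAbove j) (faceLift z lo hi f) = faceLift z lo hi (pderiv j f) := by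
  ext x
  have hfd := hf.differentiable (by simp)
  have h := pderiv_mul ((contDiff_comp_succAbove z hf).differentiable (by simp))
    (by fun_prop : Differentiable ℝ fun x : Fin (m + 1) → ℝ => (x z - lo z) * (hi z - lo z)⁻¹)
    (z.succAbove j) x
  rw [pderiv_comp_succAbove z hfd, pderiv_slope, if_neg (Fin.succAbove_ne z j), mul_zero,
    zero_add, mul_comm] at h
  exact h

theorem pderiv_faceLift_self {f : (Fin m → ℝ) → ℝ} (hf : ContDiff ℝ ∞ f) :
    pderiv z (faceLift z lo hi f)
      = fun x => (f fun j => x (z.succAbove j)) * (hi z - lo z)⁻¹ := by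
  ext x
  have hfd := hf.differentiable (by simp)
  have h := pderiv_mul ((contDiff_comp_succAbove z hf).differentiable (by simp))
    (by fun_prop : Differentiable ℝ fun x : Fin (m + 1) → ℝ => (x z - lo z) * (hi z - lo z)⁻¹)
    z x
  rw [pderiv_comp_succAbove_self z hfd, pderiv_slope, if_pos rfl, mul_zero, add_zero] at h
  exact h

theorem pderiv_pderiv_faceLift_self {f : (Fin m → ℝ) → ℝ} (hf : ContDiff ℝ ∞ f)
    (x : Fin (m + 1) → ℝ) : pderiv z (pderiv z (faceLift z lo hi f)) x = 0 := by
  rw [pderiv_faceLift_self z hf]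
  exact pderiv_comp_succAbove_self z (f := fun y => f y * (hi z - lo z)⁻¹)
    ((hf.differentiable (by simp)).mul_const _) x

theorem faceLift_sq_le {x : Fin (m + 1) → ℝ} (hx : x ∈ box lo hi) (f : (Fin m → ℝ) → ℝ) :
    faceLift z lo hi f x ^ 2 ≤ (f fun j => x (z.succAbove j)) ^ 2 := by
  have h := mem_box.1 hx z
  have h0 : 0 < hi z - lo z := by linarith [h.1, h.2]
  rw [faceLift, mul_pow]
  refine mul_le_of_le_one_right (sq_nonneg _) (pow_le_one₀ ?_ ?_)
  · exact mul_nonneg (by linarith [h.1]) (by positivity)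
  · rw [← div_eq_mul_inv, div_le_one h0]
    linarith [h.2]

/-- The weight concentrates at the face `x_z = hi z`. -/
theorem integral_weight_le (hlt : ∀ i, lo i < hi i) (ha : 0 < lo z) {lam : ℝ} (hl : 0 < lam)
    {f : (Fin m → ℝ) → ℝ} (hf : ContDiff ℝ ∞ f) :
    ∫ x in box lo hi, (f fun j => x (z.succAbove j)) ^ 2 * Real.exp (2 * lam * x z ^ 2)
      ≤ Real.exp (2 * lam * hi z ^ 2) / (4 * lam * lo z) *
        ∫ y in faceBox lo hi z, f y ^ 2 := by
  set F : (Fin (m + 1) → ℝ) → ℝ := fun x =>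
    (f fun j => x (z.succAbove j)) ^ 2 * Real.exp (2 * lam * x z ^ 2) with hF
  have hq := (contDiff_comp_succAbove z hf).pow 2
  have hw := contDiff_weight z (2 * lam)
  have hFc : ContDiff ℝ ∞ F := hq.mul hw
  -- F is its own z-derivative up to 4λz ≥ 4λ lo z. Integrating this derivative gives the gain 1/λ.
  have hpd : ∀ x, pderiv z F x = 4 * lam * (x z * F x) := fun x => by
    rw [hF, pderiv_mul (hq.differentiable (by simp)) (hw.differentiable (by simp)), pderiv_weight,
      if_pos rfl, pderiv_comp_succAbove_self z (f := fun y => f y ^ 2)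
        ((hf.pow 2).differentiable (by simp))]
    ring
  have h1 := integral_pderiv_box hlt (hFc.of_le (by simp)) z
  simp only [hpd] at h1
  have h2 : ∀ c y, F (z.insertNth c y) = Real.exp (2 * lam * c ^ 2) * f y ^ 2 := fun c y => by
    simp [hF, mul_comm]
  simp only [h2, integral_const_mul] at h1
  have h3 : lo z * ∫ x in box lo hi, F x ≤ ∫ x in box lo hi, x z * F x := by
    rw [← integral_const_mul]
    refine setIntegral_mono_on ((integrable_box hFc.continuous lo hi).const_mul _)
      (integrable_box ((continuous_apply z).mul hFc.continuous) lo hi) (measurableSet_box lo hi)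
      fun x hx => ?_
    exact mul_le_mul_of_nonneg_right (mem_box.1 hx z).1.le (by positivity)
  have h4 : 0 ≤ Real.exp (2 * lam * lo z ^ 2) * ∫ y in faceBox lo hi z, f y ^ 2 :=
    mul_nonneg (Real.exp_pos _).le (integral_nonneg fun _ => sq_nonneg _)
  have h5 := mul_le_mul_of_nonneg_left h3 (by positivity : 0 ≤ 4 * lam)
  rw [div_mul_eq_mul_div, le_div_iff₀ (by positivity)]
  linarith

end Lift

/-! ### Weighted energies of differences and of the lift -/

section Final

variable {m : ℕ} {lo hi : Fin (m + 1) → ℝ}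

/-- Allows the basic estimate to be applied to u minus the lift without a separate density argument.
-/
theorem SmoothApprox.sub_smooth {φ : ℕ → (Fin (m + 1) → ℝ) → ℝ} {u : (Fin (m + 1) → ℝ) → ℝ}
    {g : Fin (m + 1) → (Fin (m + 1) → ℝ) → ℝ}
    {h : Fin (m + 1) → Fin (m + 1) → (Fin (m + 1) → ℝ) → ℝ} (hφ : SmoothApprox lo hi φ u g h)
    {w : (Fin (m + 1) → ℝ) → ℝ} (hw : ContDiff ℝ ∞ w) :
    SmoothApprox lo hi (fun k x => φ k x - w x) (fun x => u x - w x)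
      (fun i x => g i x - pderiv i w x) (fun i j x => h i j x - pderiv j (pderiv i w) x) := by
  have hwd : Differentiable ℝ w := hw.differentiable (by simp)
  have e1 : ∀ k i, pderiv i (fun x => φ k x - w x) = fun x => pderiv i (φ k) x - pderiv i w x :=
    fun k i => funext fun x => pderiv_sub ((hφ.contDiff k).differentiable (by simp)) hwd i x
  have e2 : ∀ k i j, pderiv j (pderiv i fun x => φ k x - w x)
      = fun x => pderiv j (pderiv i (φ k)) x - pderiv j (pderiv i w) x := fun k i j =>
    funext fun x => by
      rw [e1]
      exact pderiv_sub ((contDiff_pderiv (hφ.contDiff k) i).differentiable (by simp))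
        ((contDiff_pderiv hw i).differentiable (by simp)) j x
  refine ⟨fun k => (hφ.contDiff k).sub hw, hφ.lim.sub (L2Lim.const (memLp_box hw.continuous _ _)),
    fun i => ?_, fun i j => ?_⟩
  · simp only [e1]
    exact (hφ.lim_grad i).sub (L2Lim.const (memLp_box (contDiff_pderiv hw i).continuous _ _))
  · simp only [e2]
    exact (hφ.lim_hess i j).sub
      (L2Lim.const (memLp_box (contDiff_pderiv (contDiff_pderiv hw i) j).continuous _ _))

theorem integrable_sq_mul_weight (z : Fin (m + 1)) (lam : ℝ) {q : (Fin (m + 1) → ℝ) → ℝ}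
    (hq : MemLp q 2 (volume.restrict (box lo hi))) :
    Integrable (fun x => q x ^ 2 * Real.exp (2 * lam * x z ^ 2)) (volume.restrict (box lo hi)) := by
  have h := ((L2Lim.const hq).continuous_mul (contDiff_weight z lam).continuous).sq.integrable_lim
  refine h.congr (Eventually.of_forall fun x => ?_)
  simp only [exp_two_mul]
  ring

theorem integrable_energy (z : Fin (m + 1)) (lam : ℝ) {u : (Fin (m + 1) → ℝ) → ℝ}
    {g : Fin (m + 1) → (Fin (m + 1) → ℝ) → ℝ} (hu : MemLp u 2 (volume.restrict (box lo hi)))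
    (hg : ∀ i, MemLp (g i) 2 (volume.restrict (box lo hi))) :
    Integrable (fun x => (lam * (∑ i, g i x ^ 2) + lam ^ 3 * u x ^ 2)
      * Real.exp (2 * lam * x z ^ 2)) (volume.restrict (box lo hi)) := by
  have h := ((integrable_finsetSum Finset.univ fun i _ =>
    integrable_sq_mul_weight z lam (hg i)).const_mul lam).add
    ((integrable_sq_mul_weight z lam hu).const_mul (lam ^ 3))
  refine h.congr (Eventually.of_forall fun x => ?_)
  simp only [Pi.add_apply, ← Finset.sum_mul]
  ring

theorem energy_sub_le (z : Fin (m + 1)) {lam : ℝ} (hl : 0 ≤ lam) {u w : (Fin (m + 1) → ℝ) → ℝ}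
    {g p : Fin (m + 1) → (Fin (m + 1) → ℝ) → ℝ} (hu : MemLp u 2 (volume.restrict (box lo hi)))
    (hg : ∀ i, MemLp (g i) 2 (volume.restrict (box lo hi)))
    (hw : MemLp w 2 (volume.restrict (box lo hi)))
    (hp : ∀ i, MemLp (p i) 2 (volume.restrict (box lo hi))) :
    ∫ x in box lo hi, (lam * (∑ i, g i x ^ 2) + lam ^ 3 * u x ^ 2) * Real.exp (2 * lam * x z ^ 2)
      ≤ 2 * (∫ x in box lo hi, (lam * (∑ i, (g i x - p i x) ^ 2) + lam ^ 3 * (u x - w x) ^ 2)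
          * Real.exp (2 * lam * x z ^ 2))
        + 2 * ∫ x in box lo hi, (lam * (∑ i, p i x ^ 2) + lam ^ 3 * w x ^ 2)
          * Real.exp (2 * lam * x z ^ 2) := by
  have i1 := integrable_energy z lam hu hg
  have i2 := integrable_energy z lam (hu.sub hw) fun i => (hg i).sub (hp i)
  have i3 := integrable_energy z lam hw hp
  simp only [Pi.sub_apply] at i2
  rw [← integral_const_mul, ← integral_const_mul,
    ← integral_add (i2.const_mul 2) (i3.const_mul 2)]
  refine integral_mono i1 ((i2.const_mul 2).add (i3.const_mul 2)) fun x => ?_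
  have key : ∀ s t : ℝ, s ^ 2 ≤ 2 * (s - t) ^ 2 + 2 * t ^ 2 := fun s t => by
    nlinarith [sq_nonneg (s - 2 * t)]
  have h1 : ∑ i, g i x ^ 2 ≤ 2 * ∑ i, (g i x - p i x) ^ 2 + 2 * ∑ i, p i x ^ 2 := by
    rw [Finset.mul_sum, Finset.mul_sum, ← Finset.sum_add_distrib]
    exact Finset.sum_le_sum fun i _ => key _ _
  have h2 := mul_le_mul_of_nonneg_left h1 hl
  have h3 := mul_le_mul_of_nonneg_left (key (u x) (w x)) (by positivity : 0 ≤ lam ^ 3)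
  have h4 := mul_le_mul_of_nonneg_right (add_le_add h2 h3)
    (Real.exp_pos (2 * lam * x z ^ 2)).le
  dsimp only [Pi.add_apply]
  linarith

theorem integral_sq_sub_le {q r : (Fin (m + 1) → ℝ) → ℝ} (z : Fin (m + 1)) (lam : ℝ)
    (hq : MemLp q 2 (volume.restrict (box lo hi))) (hr : MemLp r 2 (volume.restrict (box lo hi))) :
    ∫ x in box lo hi, (q x - r x) ^ 2 * Real.exp (2 * lam * x z ^ 2)
      ≤ 2 * (∫ x in box lo hi, q x ^ 2 * Real.exp (2 * lam * x z ^ 2))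
        + 2 * ∫ x in box lo hi, r x ^ 2 * Real.exp (2 * lam * x z ^ 2) := by
  have i1 := integrable_sq_mul_weight z lam hq
  have i2 := integrable_sq_mul_weight z lam hr
  rw [← integral_const_mul, ← integral_const_mul, ← integral_add (i1.const_mul 2) (i2.const_mul 2)]
  refine integral_mono (integrable_sq_mul_weight z lam (hq.sub hr))
    ((i1.const_mul 2).add (i2.const_mul 2)) fun x => ?_
  have h : (q x - r x) ^ 2 ≤ 2 * q x ^ 2 + 2 * r x ^ 2 := by nlinarith [sq_nonneg (q x + r x)]
  have h4 := mul_le_mul_of_nonneg_right h (Real.exp_pos (2 * lam * x z ^ 2)).le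
  dsimp only [Pi.add_apply, Pi.sub_apply]
  linarith

theorem energy_faceLift_le (z : Fin (m + 1)) (hlt : ∀ i, lo i < hi i) (ha : 0 < lo z) {lam : ℝ}
    (hl : 0 < lam) {f : (Fin m → ℝ) → ℝ} (hf : ContDiff ℝ ∞ f) :
    ∫ x in box lo hi, (lam * (∑ i, pderiv i (faceLift z lo hi f) x ^ 2)
        + lam ^ 3 * faceLift z lo hi f x ^ 2) * Real.exp (2 * lam * x z ^ 2)
      ≤ Real.exp (2 * lam * hi z ^ 2) / (4 * lam * lo z) *
        (lam * (∑ j, ∫ y in faceBox lo hi z, pderiv j f y ^ 2)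
          + (lam * (hi z - lo z)⁻¹ ^ 2 + lam ^ 3) * ∫ y in faceBox lo hi z, f y ^ 2) := by
  set E := Real.exp (2 * lam * hi z ^ 2) / (4 * lam * lo z) with hE
  have hE0 : 0 ≤ E := by positivity
  have hfj : ∀ j, ContDiff ℝ ∞ (pderiv j f) := contDiff_pderiv hf
  have ic : ∀ {q : (Fin m → ℝ) → ℝ}, ContDiff ℝ ∞ q → Integrable (fun x : Fin (m + 1) → ℝ =>
      (q fun j => x (z.succAbove j)) ^ 2 * Real.exp (2 * lam * x z ^ 2))
      (volume.restrict (box lo hi)) := fun hq =>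
    integrable_sq_mul_weight z lam (memLp_box (contDiff_comp_succAbove z hq).continuous _ _)
  have iw : Integrable (fun x => (lam * (∑ i, pderiv i (faceLift z lo hi f) x ^ 2)
      + lam ^ 3 * faceLift z lo hi f x ^ 2) * Real.exp (2 * lam * x z ^ 2))
      (volume.restrict (box lo hi)) :=
    integrable_energy z lam (memLp_box (contDiff_faceLift z hf).continuous _ _) fun i =>
      memLp_box (contDiff_pderiv (contDiff_faceLift z hf) i).continuous _ _
  have i1 := (integrable_finsetSum Finset.univ fun j _ => ic (hfj j)).const_mul lam
  have i2 := (ic hf).const_mul (lam * (hi z - lo z)⁻¹ ^ 2 + lam ^ 3)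
  calc _ ≤ ∫ x in box lo hi, (lam * (∑ j, (pderiv j f fun j => x (z.succAbove j)) ^ 2
            * Real.exp (2 * lam * x z ^ 2))
          + (lam * (hi z - lo z)⁻¹ ^ 2 + lam ^ 3) * ((f fun j => x (z.succAbove j)) ^ 2
            * Real.exp (2 * lam * x z ^ 2))) := by
        refine setIntegral_mono_on iw (i1.add i2) (measurableSet_box lo hi) fun x hx => ?_
        rw [Fin.sum_univ_succAbove _ z, pderiv_faceLift_self z hf]
        simp only [pderiv_faceLift z hf]
        have h1 : ∑ j, faceLift z lo hi (pderiv j f) x ^ 2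
            ≤ ∑ j, (pderiv j f fun j => x (z.succAbove j)) ^ 2 :=
          Finset.sum_le_sum fun j _ => faceLift_sq_le z hx _
        have h2 := mul_le_mul_of_nonneg_left h1 hl.le
        have h3 := mul_le_mul_of_nonneg_left (faceLift_sq_le z hx f)
          (by positivity : 0 ≤ lam ^ 3)
        have h4 := mul_le_mul_of_nonneg_right (add_le_add h2 h3)
          (Real.exp_pos (2 * lam * x z ^ 2)).le
        rw [← Finset.sum_mul]
        linarith
    _ = lam * (∑ j, ∫ x in box lo hi, (pderiv j f fun j => x (z.succAbove j)) ^ 2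
            * Real.exp (2 * lam * x z ^ 2))
          + (lam * (hi z - lo z)⁻¹ ^ 2 + lam ^ 3) * ∫ x in box lo hi,
            (f fun j => x (z.succAbove j)) ^ 2 * Real.exp (2 * lam * x z ^ 2) := by
        rw [integral_add i1 i2, integral_const_mul, integral_const_mul,
          integral_finsetSum _ fun j _ => ic (hfj j)]
    _ ≤ lam * (∑ j, E * ∫ y in faceBox lo hi z, pderiv j f y ^ 2)
          + (lam * (hi z - lo z)⁻¹ ^ 2 + lam ^ 3) * (E * ∫ y in faceBox lo hi z, f y ^ 2) := by
        gcongr with j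
        · exact integral_weight_le z hlt ha hl (hfj j)
        · exact integral_weight_le z hlt ha hl hf
    _ = _ := by rw [← Finset.mul_sum]; ring

/-- The lift is linear in z, so only tangential second derivatives of f occur. With f regularized at
scale 1/λ these cost λ², of which the weight returns one power. -/
theorem laplacian_faceLift_le (z : Fin (m + 1)) (hlt : ∀ i, lo i < hi i) (ha : 0 < lo z) {lam : ℝ}
    (hl : 0 < lam) {f : (Fin m → ℝ) → ℝ} (hf : ContDiff ℝ ∞ f) :
    ∫ x in box lo hi, (∑ i, pderiv i (pderiv i (faceLift z lo hi f)) x) ^ 2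
        * Real.exp (2 * lam * x z ^ 2)
      ≤ Real.exp (2 * lam * hi z ^ 2) / (4 * lam * lo z) *
        (m * ∑ j, ∫ y in faceBox lo hi z, pderiv j (pderiv j f) y ^ 2) := by
  set E := Real.exp (2 * lam * hi z ^ 2) / (4 * lam * lo z) with hE
  have hfj : ∀ j, ContDiff ℝ ∞ (pderiv j (pderiv j f)) := fun j =>
    contDiff_pderiv (contDiff_pderiv hf j) j
  have ic : ∀ j, Integrable (fun x : Fin (m + 1) → ℝ =>
      (pderiv j (pderiv j f) fun j => x (z.succAbove j)) ^ 2 * Real.exp (2 * lam * x z ^ 2))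
      (volume.restrict (box lo hi)) := fun j =>
    integrable_sq_mul_weight z lam (memLp_box (contDiff_comp_succAbove z (hfj j)).continuous _ _)
  have iw : Integrable (fun x => (∑ i, pderiv i (pderiv i (faceLift z lo hi f)) x) ^ 2
      * Real.exp (2 * lam * x z ^ 2)) (volume.restrict (box lo hi)) :=
    integrable_sq_mul_weight z lam (memLp_box (continuous_finsetSum _ fun i _ =>
      (contDiff_pderiv (contDiff_pderiv (contDiff_faceLift z hf) i) i).continuous) _ _)
  have i1 := (integrable_finsetSum Finset.univ fun j _ => ic j).const_mul (m : ℝ)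
  calc _ ≤ ∫ x in box lo hi, (m : ℝ) * ∑ j,
          (pderiv j (pderiv j f) fun j => x (z.succAbove j)) ^ 2
            * Real.exp (2 * lam * x z ^ 2) := by
        refine setIntegral_mono_on iw i1 (measurableSet_box lo hi) fun x hx => ?_
        rw [Fin.sum_univ_succAbove _ z, pderiv_pderiv_faceLift_self z hf, zero_add]
        simp only [pderiv_faceLift z hf, pderiv_faceLift z (contDiff_pderiv hf _)]
        rw [← Finset.sum_mul, ← mul_assoc]
        refine mul_le_mul_of_nonneg_right ?_ (Real.exp_pos _).le
        have h1 := sq_sum_le_card_mul_sum_sq (s := Finset.univ)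
          (f := fun j => faceLift z lo hi (pderiv j (pderiv j f)) x)
        rw [Finset.card_univ, Fintype.card_fin] at h1
        refine h1.trans (mul_le_mul_of_nonneg_left ?_ (Nat.cast_nonneg m))
        exact Finset.sum_le_sum fun j _ => faceLift_sq_le z hx _
    _ = m * ∑ j, ∫ x in box lo hi, (pderiv j (pderiv j f) fun j => x (z.succAbove j)) ^ 2
            * Real.exp (2 * lam * x z ^ 2) := by
        rw [integral_const_mul, integral_finsetSum _ fun j _ => ic j]
    _ ≤ m * ∑ j, E * ∫ y in faceBox lo hi z, pderiv j (pderiv j f) y ^ 2 := by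
        gcongr with j
        exact integral_weight_le z hlt ha hl (hfj j)
    _ = _ := by rw [← Finset.mul_sum]; ring

end Final


/-! ### Improvement of the boundary term to order λ² -/

section Assembly

variable {m : ℕ} {lo hi : Fin (m + 1) → ℝ}

/-- The bookkeeping of the correction. X and L are the energy and the Laplacian integral, with
suffix d for the difference u - w and w for the lift; S is the top boundary integral of the
difference, D the weight there; t, σ, ν are the squared norms of T, ∇T and N. The quarter in c/4 is
the price of splitting a square twice. -/
theorem absorb_boundary_terms {m : ℕ} {a K d c Q D lam t σ ν X Xd Xw L Ld Lw S : ℝ} (ha : 0 < a)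
    (hK : 0 ≤ K) (hd : 0 ≤ d) (hc : 0 < c) (hQ : 0 ≤ Q) (hD : 0 ≤ D) (hl1 : 1 ≤ lam) (ht : 0 ≤ t)
    (hσ : 0 ≤ σ) (hν : 0 ≤ ν) (main : c * Xd ≤ Ld + Q * S * D) (hsub : X ≤ 2 * Xd + 2 * Xw)
    (hlap : Ld ≤ 2 * L + 2 * Lw)
    (hEw' : Xw ≤ D * K / (4 * a) * (σ + (d + lam ^ 2) * t))
    (hLw' : Lw ≤ D * K / (4 * a) * (m * lam * σ))
    (htop : S ≤ lam * (2 * ν + 2 * (K * d * t) + K * σ)) :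
    c / 4 * X ≤ L + (m * K / (4 * a) + Q * (1 + K * d + K) + c * K * (2 + d) / (4 * a)) * lam ^ 2
      * (t + σ + ν) * D := by
  have htop' := mul_le_mul_of_nonneg_right (mul_le_mul_of_nonneg_left htop hQ) hD
  have q1 : lam ≤ lam ^ 2 := le_self_pow₀ hl1 (by norm_num)
  have q2 : 1 ≤ lam ^ 2 := one_le_pow₀ hl1
  set Y := t + σ + ν with hY
  have hY0 : 0 ≤ Y := by positivity
  have b1 : Xw ≤ D * K / (4 * a) * ((2 + d) * lam ^ 2 * Y) := by
    refine hEw'.trans (mul_le_mul_of_nonneg_left ?_ (by positivity))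
    have r1 : σ ≤ lam ^ 2 * Y := by
      have := mul_le_mul_of_nonneg_right q2 hY0
      linarith
    have r2 : t ≤ Y := by linarith
    have r3 : d * t ≤ d * (lam ^ 2 * Y) := by
      refine mul_le_mul_of_nonneg_left ?_ hd
      have := mul_le_mul_of_nonneg_right q2 hY0
      linarith
    have r4 := mul_le_mul_of_nonneg_left r2 (sq_nonneg lam)
    linarith
  have b2 : Lw ≤ D * K / (4 * a) * (m * lam ^ 2 * Y) := by
    refine hLw'.trans (mul_le_mul_of_nonneg_left ?_ (by positivity))
    have : σ ≤ Y := by linarith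
    exact mul_le_mul (mul_le_mul_of_nonneg_left q1 (Nat.cast_nonneg m)) this hσ (by positivity)
  have b3 : Q * (lam * (2 * ν + 2 * (K * d * t) + K * σ)) * D
      ≤ Q * (lam ^ 2 * (2 * (1 + K * d + K) * Y)) * D := by
    have r1 : 2 * ν + 2 * (K * d * t) + K * σ ≤ 2 * (1 + K * d + K) * Y := by
      have r2 : ν ≤ Y := by linarith
      have r3 : K * d * t ≤ K * d * Y :=
        mul_le_mul_of_nonneg_left (by linarith) (by positivity)
      have r4 : K * σ ≤ K * Y := mul_le_mul_of_nonneg_left (by linarith) hK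
      have r5 : 0 ≤ K * Y := by positivity
      linarith
    refine mul_le_mul_of_nonneg_right (mul_le_mul_of_nonneg_left ?_ hQ) hD
    exact mul_le_mul q1 r1 (by positivity) (by positivity)
  have b4 : c * Xd ≤ 2 * L + 2 * Lw + Q * (lam ^ 2 * (2 * (1 + K * d + K) * Y)) * D := by
    linarith
  have b5 := mul_le_mul_of_nonneg_left hsub hc.le
  have b6 := mul_le_mul_of_nonneg_left b1 hc.le
  have goal : c * X ≤ 4 * L + 4 * ((m * K / (4 * a) + Q * (1 + K * d + K) + c * K * (2 + d) / (4 * a)) * lam ^ 2 * Y * D) := by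
    have e : 4 * ((m * K / (4 * a) + Q * (1 + K * d + K) + c * K * (2 + d) / (4 * a)) * lam ^ 2 * Y * D) = 4 * (D * K / (4 * a) * (m * lam ^ 2 * Y))
        + 2 * (Q * (lam ^ 2 * (2 * (1 + K * d + K) * Y)) * D)
        + 4 * (c * (D * K / (4 * a) * ((2 + d) * lam ^ 2 * Y))) := by
      ring
    have p6 : 0 ≤ c * (D * K / (4 * a) * ((2 + d) * lam ^ 2 * Y)) := by positivity
    rw [e]
    linarith
  linarith

/-- The Carleman estimate with boundary terms of order `λ²`: the function is corrected by the lift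
of a regularization of its trace at scale `1 / λ`. -/
theorem carleman_small_boundary (z : Fin (m + 1)) (hlt : ∀ i, lo i < hi i) (ha : 0 < lo z) {B : ℝ}
    (hB : 0 < B) (hface : faceBox lo hi z = topFace m B)
    (hcube : ∀ j, lo (z.succAbove j) = -B ∧ hi (z.succAbove j) = B) :
    ∃ c M lam₀ : ℝ, 0 < c ∧ 0 ≤ M ∧ ∀ lam, lam₀ ≤ lam →
      ∀ (φ : ℕ → (Fin (m + 1) → ℝ) → ℝ) (u : (Fin (m + 1) → ℝ) → ℝ)
        (g : Fin (m + 1) → (Fin (m + 1) → ℝ) → ℝ)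
        (h : Fin (m + 1) → Fin (m + 1) → (Fin (m + 1) → ℝ) → ℝ) (T : (Fin m → ℝ) → ℝ)
        (τ : Fin m → (Fin m → ℝ) → ℝ) (N : (Fin m → ℝ) → ℝ),
        SmoothApprox lo hi φ u g h →
        L2Lim (volume.restrict (faceBox lo hi z)) (fun k y => φ k (z.insertNth (lo z) y)) 0 →
        (∀ j c, c = lo (z.succAbove j) ∨ c = hi (z.succAbove j) →
          L2Lim (volume.restrict (faceBox lo hi (z.succAbove j)))
            (fun k y => φ k ((z.succAbove j).insertNth c y)) 0) →
        L2Lim (volume.restrict (topFace m B)) (fun k y => φ k (z.insertNth (hi z) y)) T →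
        (∀ j, MemLp (τ j) 2 (volume.restrict (topFace m B))) →
        L2Lim (volume.restrict (topFace m B))
          (fun k y => pderiv z (φ k) (z.insertNth (hi z) y)) N →
        IsZeroExtDeriv B T τ →
        c * (∫ x in box lo hi, (lam * (∑ i, g i x ^ 2) + lam ^ 3 * u x ^ 2)
            * Real.exp (2 * lam * x z ^ 2))
          ≤ (∫ x in box lo hi, (∑ i, h i i x) ^ 2 * Real.exp (2 * lam * x z ^ 2))
            + M * lam ^ 2 * ((∫ y in topFace m B, T y ^ 2) + (∑ j, ∫ y in topFace m B, τ j y ^ 2)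
              + ∫ y in topFace m B, N y ^ 2) * Real.exp (2 * lam * hi z ^ 2) := by
  obtain ⟨K, hK, hsm⟩ := exists_smoothing m hB
  set a := lo z with haz
  set b := hi z with hbz
  set d : ℝ := (b - a)⁻¹ ^ 2 with hd
  set c : ℝ := min (1 / 2) (a ^ 2) with hc
  have hc0 : 0 < c := lt_min (by norm_num) (by positivity)
  have hb : 0 < b := ha.trans (hlt z)
  set Q : ℝ := 12 + 16 * b + 32 * b ^ 2 + 48 * b ^ 3 with hQ
  have hQ0 : 0 < Q := by positivity
  have hd0 : 0 ≤ d := by positivity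
  set M : ℝ := m * K / (4 * a) + Q * (1 + K * d + K) + c * K * (2 + d) / (4 * a) with hM
  have hM0 : 0 ≤ M := by positivity
  -- The three summands ensure λ ≥ 1, λa² ≥ 1 and 1/λ ≤ B, the last admitting 1/λ as a smoothing
  -- scale.
  refine ⟨c / 4, M, 1 + 1 / a ^ 2 + 1 / B, by positivity, hM0, ?_⟩
  intro lam hlam φ u g h T τ N hφ hbot hside hT hτ hN hTS
  have hl1 : 1 ≤ lam := by
    have : 0 < 1 / a ^ 2 + 1 / B := by positivity
    linarith
  have hl0 : 0 < lam := by linarith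
  have hla : 1 ≤ lam * a ^ 2 := by
    have : 1 / a ^ 2 ≤ lam := by
      have : 0 < 1 / B := by positivity
      linarith
    rwa [div_le_iff₀ (by positivity)] at this
  have hlB : lam⁻¹ ≤ B := by
    have : 1 / B ≤ lam := by
      have : 0 < 1 / a ^ 2 := by positivity
      linarith
    rw [inv_le_comm₀ hl0 hB, ← one_div]
    exact this
  obtain ⟨f, hf, hf0, e1, e2, e3, e4⟩ :=
    hsm lam⁻¹ (by positivity) hlB T τ hT.memLp_lim hτ hTS
  set w := faceLift z lo hi f with hw
  have hwc : ContDiff ℝ ∞ w := contDiff_faceLift z hf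
  have hwp : ∀ i, MemLp (pderiv i w) 2 (volume.restrict (box lo hi)) := fun i =>
    memLp_box (contDiff_pderiv hwc i).continuous _ _
  have hba : b - a ≠ 0 := (sub_pos.2 (hlt z)).ne'
  have wbot : ∀ y, w (z.insertNth (lo z) y) = 0 := fun y => by simp [hw, faceLift]
  have wtop : ∀ y, w (z.insertNth (hi z) y) = f y := fun y => by
    simp [hw, faceLift, ← haz, ← hbz, hba]
  have wtop' : ∀ y, pderiv z w (z.insertNth (hi z) y) = f y * (b - a)⁻¹ := fun y => by
    rw [hw, pderiv_faceLift_self z hf]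
    simp [← haz, ← hbz]
  have wside : ∀ j c, c = lo (z.succAbove j) ∨ c = hi (z.succAbove j) → ∀ y,
      w ((z.succAbove j).insertNth c y) = 0 := fun j c hc y => by
    rw [hw, faceLift, hf0, zero_mul]
    intro hmem
    have h1 := mem_box.1 hmem j
    simp only [Fin.insertNth_apply_same] at h1
    rcases hc with rfl | rfl
    · rw [(hcube j).1] at h1; exact lt_irrefl _ h1.1
    · rw [(hcube j).2] at h1; exact lt_irrefl _ h1.2
  have hφw := hφ.sub_smooth hwc
  have mf : ∀ {q : (Fin m → ℝ) → ℝ}, ContDiff ℝ ∞ q →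
      MemLp q 2 (volume.restrict (topFace m B)) := fun hq => memLp_box hq.continuous _ _
  have hfm := mf hf
  have hdw : ∀ k i, pderiv i (fun x => φ k x - w x) = fun x => pderiv i (φ k) x - pderiv i w x :=
    fun k i => funext fun x => pderiv_sub ((hφ.contDiff k).differentiable (by simp))
      (hwc.differentiable (by simp)) i x
  have hTw : L2Lim (volume.restrict (faceBox lo hi z))
      (fun k y => φ k (z.insertNth (hi z) y) - w (z.insertNth (hi z) y)) (fun y => T y - f y) := by
    simp only [wtop, hface]
    exact hT.sub (L2Lim.const hfm)
  have hNw : L2Lim (volume.restrict (faceBox lo hi z))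
      (fun k y => pderiv z (fun x => φ k x - w x) (z.insertNth (hi z) y))
      (fun y => N y - f y * (b - a)⁻¹) := by
    simp only [hdw, wtop', hface]
    exact hN.sub (L2Lim.const (hfm.mul_const _))
  have main := carleman_of_smoothApprox z lam hlt ha hl1 hla (c := c) (min_le_left _ _)
    (min_le_right _ _) hφw (by simpa [wbot] using hbot)
    (fun j c hc => by simpa [wside j c hc] using hside j c hc) hTw hNw
  rw [hface, ← hbz, ← hQ] at main
  set D := Real.exp (2 * lam * b ^ 2) with hD
  have hD0 : 0 < D := Real.exp_pos _
  set t := ∫ y in topFace m B, T y ^ 2 with ht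
  set σ := ∑ j, ∫ y in topFace m B, τ j y ^ 2 with hσ
  set ν := ∫ y in topFace m B, N y ^ 2 with hν
  have ht0 : 0 ≤ t := integral_nonneg fun _ => sq_nonneg _
  have hσ0 : 0 ≤ σ := Finset.sum_nonneg fun _ _ => integral_nonneg fun _ => sq_nonneg _
  have hν0 : 0 ≤ ν := integral_nonneg fun _ => sq_nonneg _
  have e2' : ∑ j, ∫ y in topFace m B, pderiv j f y ^ 2 ≤ K * σ := by
    rw [hσ, Finset.mul_sum]; exact Finset.sum_le_sum fun j _ => e2 j
  have e3' : ∑ j, ∫ y in topFace m B, pderiv j (pderiv j f) y ^ 2 ≤ K * lam ^ 2 * σ := by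
    rw [hσ, Finset.mul_sum]
    refine Finset.sum_le_sum fun j _ => (e3 j).trans (le_of_eq ?_)
    rw [inv_pow, div_inv_eq_mul]
  have e4' : ∫ y in topFace m B, (T y - f y) ^ 2 ≤ K / lam ^ 2 * σ := by
    have : ∫ y in topFace m B, (T y - f y) ^ 2 = ∫ y in topFace m B, (f y - T y) ^ 2 := by
      refine integral_congr_ae (Eventually.of_forall fun y => ?_)
      dsimp only
      ring
    rw [this]
    refine e4.trans (le_of_eq ?_)
    rw [inv_pow, div_eq_mul_inv]
  -- The decisive gain: ‖T - f‖² ≤ Kλ⁻²σ reduces λ³ to λ, at the price of the tangential gradient of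
  -- the trace.
  have htop : ∫ y in topFace m B, (lam * (N y - f y * (b - a)⁻¹) ^ 2 + lam ^ 3 * (T y - f y) ^ 2)
      ≤ lam * (2 * ν + 2 * (K * d * t) + K * σ) := by
    have iN := hN.memLp_lim.integrable_sq
    have iT := (hT.memLp_lim.sub hfm).integrable_sq
    have if' := hfm.integrable_sq
    calc _ ≤ ∫ y in topFace m B, (2 * lam * N y ^ 2 + 2 * lam * d * f y ^ 2
            + lam ^ 3 * (T y - f y) ^ 2) := by
          refine integral_mono (((hN.memLp_lim.sub (hfm.mul_const _)).integrable_sq.const_mul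
            lam).add (iT.const_mul _))
            (((iN.const_mul _).add (if'.const_mul _)).add (iT.const_mul _)) fun y => ?_
          have h1 := mul_nonneg hl0.le (sq_nonneg (N y + f y * (b - a)⁻¹))
          simp only [hd]
          nlinarith
      _ = 2 * lam * ν + 2 * lam * d * (∫ y in topFace m B, f y ^ 2)
            + lam ^ 3 * ∫ y in topFace m B, (T y - f y) ^ 2 := by
          have s1 := integral_add ((iN.const_mul (2 * lam)).add (if'.const_mul (2 * lam * d)))
            (iT.const_mul (lam ^ 3))
          have s2 := integral_add (iN.const_mul (2 * lam)) (if'.const_mul (2 * lam * d))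
          simp only [Pi.add_apply, Pi.sub_apply, integral_const_mul] at s1 s2
          rw [s1, s2]
      _ ≤ 2 * lam * ν + 2 * lam * d * (K * t) + lam ^ 3 * (K / lam ^ 2 * σ) := by gcongr
      _ = _ := by field_simp
  have hEw := energy_faceLift_le z hlt ha hl0 hf
  have hLw := laplacian_faceLift_le z hlt ha hl0 hf
  rw [hface, ← hw, ← haz, ← hbz, ← hD] at hEw hLw
  have hsub := energy_sub_le z hl0.le hφ.lim.memLp_lim (fun i => (hφ.lim_grad i).memLp_lim)
    (memLp_box hwc.continuous lo hi) hwp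
  have hlap := integral_sq_sub_le z lam
    (q := fun x => ∑ i, h i i x) (r := fun x => ∑ i, pderiv i (pderiv i w) x)
    (memLp_finsetSum _ fun i _ => (hφ.lim_hess i i).memLp_lim)
    (memLp_box (continuous_finsetSum _ fun i _ =>
      (contDiff_pderiv (contDiff_pderiv hwc i) i).continuous) lo hi)
  simp only [← Finset.sum_sub_distrib] at hlap
  set X := ∫ x in box lo hi, (lam * (∑ i, g i x ^ 2) + lam ^ 3 * u x ^ 2)
    * Real.exp (2 * lam * x z ^ 2)
  set Xd := ∫ x in box lo hi, (lam * (∑ i, (g i x - pderiv i w x) ^ 2)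
    + lam ^ 3 * (u x - w x) ^ 2) * Real.exp (2 * lam * x z ^ 2)
  set Xw := ∫ x in box lo hi, (lam * (∑ i, pderiv i w x ^ 2) + lam ^ 3 * w x ^ 2)
    * Real.exp (2 * lam * x z ^ 2)
  set L := ∫ x in box lo hi, (∑ i, h i i x) ^ 2 * Real.exp (2 * lam * x z ^ 2)
  set Ld := ∫ x in box lo hi, (∑ i, (h i i x - pderiv i (pderiv i w) x)) ^ 2
    * Real.exp (2 * lam * x z ^ 2)
  set Lw := ∫ x in box lo hi, (∑ i, pderiv i (pderiv i w) x) ^ 2 * Real.exp (2 * lam * x z ^ 2)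
  have hEw' : Xw ≤ D * K / (4 * a) * (σ + (d + lam ^ 2) * t) := by
    calc Xw ≤ D / (4 * lam * a) * (lam * (K * σ) + (lam * d + lam ^ 3) * (K * t)) := by
          refine hEw.trans ?_
          gcongr
      _ = _ := by field_simp
  have hLw' : Lw ≤ D * K / (4 * a) * (m * lam * σ) := by
    calc Lw ≤ D / (4 * lam * a) * (m * (K * lam ^ 2 * σ)) := by
          refine hLw.trans ?_
          gcongr
      _ = _ := by field_simp
  exact absorb_boundary_terms (m := m) ha hK.le hd0 hc0 hQ0.le hD0.le hl1 ht0 hσ0 hν0 main hsub hlap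
    hEw' hLw' htop

theorem faceBox_prism_last (m : ℕ) (B a b : ℝ) :
    faceBox (prismLo m B a) (prismHi m B b) (Fin.last m) = topFace m B := by
  simp [faceBox, topFace, prismLo, prismHi]

end Assembly

end Carleman

open Carleman in
theorem theorem4p2 (m : ℕ) (B a b : ℝ) (hB : 0 < B) (ha : 0 < a) (hab : a < b) :
    ∃ C : ℝ, 0 < C ∧ ∃ lam₀ : ℝ, 1 < lam₀ ∧
      ∀ (u : (Fin (m + 1) → ℝ) → ℝ) (g : Fin (m + 1) → (Fin (m + 1) → ℝ) → ℝ)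
        (h : Fin (m + 1) → Fin (m + 1) → (Fin (m + 1) → ℝ) → ℝ),
        Carleman.IsH20 m B a b u g h →
        ∃ (T : (Fin m → ℝ) → ℝ) (τ : Fin m → (Fin m → ℝ) → ℝ) (N : (Fin m → ℝ) → ℝ),
          Carleman.IsTopTrace m B a b u g T ∧
          Carleman.IsH1 (Carleman.topFace m B) T τ ∧
          Carleman.IsTopTrace m B a b (g (Fin.last m)) (h (Fin.last m)) N ∧
          ∀ lam : ℝ, lam₀ ≤ lam →
            ∫ x in Carleman.prism m B a b,
                (∑ i, h i i x) ^ 2 * Real.exp (2 * lam * x (Fin.last m) ^ 2) ≥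
              C * (∫ x in Carleman.prism m B a b,
                (lam * (∑ i, g i x ^ 2) + lam ^ 3 * u x ^ 2) *
                  Real.exp (2 * lam * x (Fin.last m) ^ 2)) -
              C * lam ^ 3 *
                ((∫ y in Carleman.topFace m B, (T y ^ 2 + ∑ j, τ j y ^ 2)) +
                  ∫ y in Carleman.topFace m B, N y ^ 2) *
                Real.exp (2 * lam * b ^ 2) := by
  set lo := prismLo m B a with hlo
  set hi := prismHi m B b with hhi
  set z := Fin.last m with hz
  have loz : lo z = a := by simp [hlo, hz, prismLo]
  have hiz : hi z = b := by simp [hhi, hz, prismHi]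
  have hcube : ∀ j, lo (z.succAbove j) = -B ∧ hi (z.succAbove j) = B := fun j => by
    simp [hlo, hhi, hz, prismLo, prismHi]
  have hlt : ∀ i, lo i < hi i := fun i => by
    refine Fin.succAboveCases z ?_ (fun j => ?_) i
    · rw [loz, hiz]; exact hab
    · rw [(hcube j).1, (hcube j).2]; linarith
  have hface : faceBox lo hi z = topFace m B := faceBox_prism_last m B a b
  obtain ⟨c, M, L₀, hc, hM, hmain⟩ :=
    carleman_small_boundary z hlt (by rw [loz]; exact ha) hB hface hcube
  -- The bound M / c gives Mλ² ≤ cλ³, so the boundary term carries the same constant c as the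
  -- energy. The 2 only secures λ₀ > 1.
  refine ⟨c, hc, max 2 (max L₀ (M / c)), lt_of_lt_of_le one_lt_two (le_max_left _ _),
    fun u g h hu => ?_⟩
  have hu2 : IsH2 (box lo hi) u g h := hu.isH2
  obtain ⟨φ, hφc, hφu, hφg, hφh⟩ := hu2.exists_approx hlt
  have hφ : SmoothApprox lo hi φ u g h := ⟨hφc, hφu, hφg, hφh⟩
  have tr_lower : ∀ i, L2Lim (volume.restrict (faceBox lo hi i))
      (fun k y => φ k (i.insertNth (lo i) y)) 0 := fun i =>
    hφ.trace_of_isTrace hlt (Or.inl rfl) (hu.trace_lower i)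
  have tr_side : ∀ j c, c = lo (z.succAbove j) ∨ c = hi (z.succAbove j) →
      L2Lim (volume.restrict (faceBox lo hi (z.succAbove j)))
        (fun k y => φ k ((z.succAbove j).insertNth c y)) 0 := fun j c hc => by
    rcases hc with rfl | rfl
    · exact tr_lower _
    · exact hφ.trace_of_isTrace hlt (Or.inr rfl) (hu.trace_upper _ (Fin.succAbove_ne z j))
  obtain ⟨T, hT⟩ := exists_trace hlt hφc hφu (hφg z) (Or.inr rfl : hi z = lo z ∨ hi z = hi z)
  have hpc := fun i k => contDiff_pderiv (hφc k) i
  have hG : ∀ i, ∃ G, L2Lim (volume.restrict (faceBox lo hi z))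
      (fun k y => pderiv i (φ k) (z.insertNth (hi z) y)) G := fun i =>
    exists_trace hlt (hpc i) (hφg i) (hφh i z) (Or.inr rfl)
  choose G hG using hG
  -- On a side face both u and its z-derivative have zero trace, the latter because z is tangential
  -- there. Hence T extends by zero as an H¹ function, with gradient the traces of the tangential
  -- derivatives.
  have hzero : ∀ j, ∀ θ : (Fin m → ℝ) → ℝ, ContDiff ℝ ∞ θ →
      ∫ y in faceBox lo hi z, T y * pderiv j θ y
        = -∫ y in faceBox lo hi z, G (z.succAbove j) y * θ y := fun j θ hθ => by
    refine integral_trace_mul_pderiv hlt hφc hT (hG _) (fun c hc => ⟨tr_side j c hc, ?_⟩) hθ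
    obtain ⟨j', hj'⟩ := Fin.exists_succAbove_eq (Fin.succAbove_ne z j).symm
    have := tangential_trace_zero hlt hφ hc (tr_side j c hc) j'
    rwa [hj'] at this
  have hTtop : IsTrace lo hi u g z (hi z) T :=
    ⟨hT.memLp_lim, φ, hφc, hφu.tendsto, fun j => (hφg j).tendsto, hT.tendsto⟩
  have hNtop : IsTrace lo hi (g z) (h z) z (hi z) (G z) :=
    ⟨(hG z).memLp_lim, fun k => pderiv z (φ k), hpc z, (hφg z).tendsto,
      fun j => (hφh z j).tendsto, (hG z).tendsto⟩
  rw [hiz] at hTtop hNtop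
  have hbot := tr_lower z
  simp only [hface] at hT hG hzero
  have hH1 : IsH1 (topFace m B) T fun j => G (z.succAbove j) :=
    ⟨hT.memLp_lim, fun j => (hG _).memLp_lim, fun j θ hθ _ _ => hzero j θ hθ⟩
  refine ⟨T, fun j => G (z.succAbove j), G z, hTtop, hH1, hNtop, fun lam hlam => ?_⟩
  have hl2 : 2 ≤ lam := (le_max_left _ _).trans hlam
  have hlL : L₀ ≤ lam := ((le_max_left _ _).trans (le_max_right _ _)).trans hlam
  have hlM : M ≤ c * lam := by
    have : M / c ≤ lam := ((le_max_right _ _).trans (le_max_right _ _)).trans hlam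
    rwa [div_le_iff₀ hc, mul_comm] at this
  have key := hmain lam hlL φ u g h T (fun j => G (z.succAbove j)) (G z) hφ hbot tr_side hT
    (fun j => (hG _).memLp_lim) (hG z) hzero
  have hsum : ∫ y in topFace m B, (T y ^ 2 + ∑ j, G (z.succAbove j) y ^ 2)
      = (∫ y in topFace m B, T y ^ 2) + ∑ j, ∫ y in topFace m B, G (z.succAbove j) y ^ 2 := by
    rw [integral_add hT.memLp_lim.integrable_sq
      (integrable_finsetSum _ fun j _ => (hG _).memLp_lim.integrable_sq),
      integral_finsetSum _ fun j _ => (hG _).memLp_lim.integrable_sq]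
  rw [hiz] at key
  rw [hsum]
  set Y := (∫ y in topFace m B, T y ^ 2) + (∑ j, ∫ y in topFace m B, G (z.succAbove j) y ^ 2)
    + ∫ y in topFace m B, G z y ^ 2 with hY
  have hY0 : 0 ≤ Y := add_nonneg (add_nonneg (integral_nonneg fun _ => sq_nonneg _)
    (Finset.sum_nonneg fun _ _ => integral_nonneg fun _ => sq_nonneg _))
    (integral_nonneg fun _ => sq_nonneg _)
  have hfin : M * lam ^ 2 * Y * Real.exp (2 * lam * b ^ 2)
      ≤ c * lam ^ 3 * Y * Real.exp (2 * lam * b ^ 2) := by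
    have : M * lam ^ 2 ≤ c * lam ^ 3 := by
      calc M * lam ^ 2 ≤ c * lam * lam ^ 2 := by gcongr
        _ = _ := by ring
    gcongr
  have hprism : prism m B a b = box lo hi := rfl
  rw [hprism]
  linarith
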